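/- For integers $t,n\ge 0$, a Temperley--Lieb diagram $t\to n$ is a perfect matching, by pairwise non-crossing arcs, of $t$ points on the bottom and $n$ points on the top edge of a rectangle (up to isotopy); it is monic if every bottom point is joined to a top point. For $q\in\mathbb C^\times$, diagrams are composed by stacking, each closed loop being replaced by the factor $-(q+q^{-1})$. Let $W_t(n)$ be the complex vector space with basis the monic diagrams $t\to n$ (the cell module of the Temperley--Lieb algebra $\mathrm{TL}_n(q)$; it is $0$ if $t>n$ or $t\not\equiv n \pmod 2$), with the bilinear form given on monic diagrams by $D_1^*D_2=(D_1,D_2)\,\mathrm{id}_t$ if $D_1^*D_2:t\to t$ is a multiple of a monic diagram (which is then $\mathrm{id}_t$), and $(D_1,D_2)=0$ otherwise, where $D^*$ is the reflection of $D$ in a horizontal line. Let $\mathrm{Rad}_t(n)$ be the radical of this form and $L_t(n)=W_t(n)/\mathrm{Rad}_t(n)$. Put $w_t(n)=\dim W_t(n)$ and $l_t(n)=\dim L_t(n)$. Let $q\in\mathbb C$ be such that $q^2$ has finite multiplicative order $\ell$, and let $t\ge 0$ be an integer with $t\not\equiv -1\pmod \ell$. Write $t=a\ell+b(t)$ with $0\le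 b(t)\le \ell-2$ and put $\overline{b(t)}=\ell-1-b(t)$. Then for every integer $n\ge 0$ the following sums have only finitely many non-zero terms, and $$l_t(n)=\sum_{i=0}^\infty w_{t+2i\ell}(n)-\sum_{i=0}^\infty w_{t+2\overline{b(t)}+2i\ell}(n)=\sum_{i=0}^\infty\bigl(w_{t+2i\ell}(n)-w_{t+2\overline{b(t)}+2i\ell}(n)\bigr).$$ Equivalently, if $g$ is the map defined on the integers $s\ge 0$ with $s\not\equiv-1\pmod \ell$ by $g(a\ell+b)=(a+1)\ell+\ell-2-b$ for $a\ge 0$, $0\le b\le \ell-2$, then $$l_t(n)=\sum_{i=0}^\infty(-1)^i\,w_{g^i(t)}(n),$$ again a sum with only finitely many non-zero terms. -/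

import Mathlib

namespace TemperleyLieb

/-- Position of a boundary point of a diagram `m → n` on the boundary of the rectangle, read along
the `m` lower points from left to right and then along the `n` upper points from right to left. -/
def pos {m n : ℕ} : Fin m ⊕ Fin n → ℕ
  | Sum.inl i => (i : ℕ)
  | Sum.inr j => m + (n - 1 - (j : ℕ))

/-- A (loop-free) Temperley-Lieb diagram `m → n`: a perfect matching of the `m` lower and the `n`
upper boundary points of a rectangle by pairwise non-crossing arcs. The map `partner` sends each
point to the other end of its arc. -/
@[ext]
structure Diagram (m n : ℕ) where
  partner : Fin m ⊕ Fin n → Fin m ⊕ Fin n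
  partner_partner : ∀ x, partner (partner x) = x
  partner_ne : ∀ x, partner x ≠ x
  noncrossing : ∀ x y,
    ¬ (pos x < pos y ∧ pos y < pos (partner x) ∧ pos (partner x) < pos (partner y))

instance (m n : ℕ) : Finite (Diagram m n) :=
  Finite.of_injective (fun D : Diagram m n => D.partner) fun _ _ h => Diagram.ext h

theorem pos_swap {m n : ℕ} (x : Fin m ⊕ Fin n) : pos x.swap + pos x + 1 = m + n := by
  rcases x with i | j
  · have := i.isLt
    simp only [Sum.swap_inl, pos]
    omega
  · have := j.isLt
    simp only [Sum.swap_inr, pos]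
    omega

/-- The reflection `D^* : n → m` of a diagram `D : m → n` in a horizontal line. -/
def Diagram.reflect {m n : ℕ} (D : Diagram m n) : Diagram n m where
  partner x := (D.partner x.swap).swap
  partner_partner x := by simp [D.partner_partner]
  partner_ne x h := D.partner_ne x.swap (by
    have := congrArg Sum.swap h
    simpa using this)
  noncrossing x y h := by
    have hx := pos_swap x
    have hy := pos_swap y
    have hx' := pos_swap (D.partner x.swap)
    have hy' := pos_swap (D.partner y.swap)
    refine D.noncrossing (D.partner y.swap) (D.partner x.swap) ?_
    rw [D.partner_partner, D.partner_partner]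
    omega

/-- A diagram `t → n` is monic if every lower point is joined to an upper point. -/
def Diagram.IsMonic {t n : ℕ} (D : Diagram t n) : Prop :=
  ∀ i : Fin t, ∃ j : Fin n, D.partner (Sum.inl i) = Sum.inr j

/-- The monic diagrams `t → n`. -/
abbrev MonicDiagram (t n : ℕ) : Type := {D : Diagram t n // D.IsMonic}

/-- The picture obtained by putting `E : n → p` on top of `D : m → n`, as a graph on the `m` lower,
the `n` middle and the `p` upper points, whose edges are the arcs of `D` and of `E`. -/
def stack {m n p : ℕ} (E : Diagram n p) (D : Diagram m n) :
    SimpleGraph (Fin m ⊕ Fin n ⊕ Fin p) :=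
  SimpleGraph.fromRel fun x y =>
    (∃ a : Fin m ⊕ Fin n, x = Sum.map id Sum.inl a ∧ y = Sum.map id Sum.inl (D.partner a)) ∨
    (∃ b : Fin n ⊕ Fin p, x = Sum.inr b ∧ y = Sum.inr (E.partner b))

/-- The number of closed loops of the stacked picture: the number of its connected components
that consist of middle points only. -/
noncomputable def numLoops {m n p : ℕ} (E : Diagram n p) (D : Diagram m n) : ℕ :=
  Nat.card {C : (stack E D).ConnectedComponent //
    ∀ x ∈ C.supp, ∃ j : Fin n, x = Sum.inr (Sum.inl j)}

/-- The diagram underlying the composite `E D : m → p` is monic: every lower point of the stacked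
picture is joined, through the picture, to an upper point. -/
def CompIsMonic {m n p : ℕ} (E : Diagram n p) (D : Diagram m n) : Prop :=
  ∀ i : Fin m, ∃ k : Fin p, (stack E D).Reachable (Sum.inl i) (Sum.inr (Sum.inr k))

open Classical in
/-- The value of the form on two monic diagrams `t → n`. A closed loop counts as the factor
`-(q + q⁻¹)`. If `D₁^* D₂ : t → t` is monic then its underlying diagram is the identity diagram, so
`D₁^* D₂ = (-(q + q⁻¹)) ^ (number of loops) • id_t`. -/
noncomputable def pairing (q : ℂ) {t n : ℕ} (D₁ D₂ : MonicDiagram t n) : ℂ :=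
  if CompIsMonic D₁.1.reflect D₂.1 then (-(q + q⁻¹)) ^ numLoops D₁.1.reflect D₂.1 else 0

/-- The (underlying vector space of the) cell module `W_t(n)` of `TL_n(q)`: the complex vector
space with basis the monic diagrams `t → n`. -/
abbrev CellModule (t n : ℕ) : Type := MonicDiagram t n →₀ ℂ

/-- The invariant bilinear form on `W_t(n)`. -/
noncomputable def form (q : ℂ) (t n : ℕ) : CellModule t n →ₗ[ℂ] CellModule t n →ₗ[ℂ] ℂ :=
  Finsupp.linearCombination ℂ fun D₁ => Finsupp.linearCombination ℂ fun D₂ => pairing q D₁ D₂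

/-- The radical of the form on `W_t(n)`. -/
noncomputable def radical (q : ℂ) (t n : ℕ) : Submodule ℂ (CellModule t n) :=
  LinearMap.ker (form q t n)

/-- The (underlying vector space of the) module `L_t(n) = W_t(n) / Rad_t` of `TL_n(q)`. -/
abbrev SimpleModule (q : ℂ) (t n : ℕ) : Type := CellModule t n ⧸ radical q t n

/-- `w_t(n) = dim W_t(n)`. -/
noncomputable def w (t n : ℕ) : ℕ := Module.finrank ℂ (CellModule t n)

/-- `l_t(n) = dim L_t(n)`, for the parameter `q`. -/
noncomputable def l (q : ℂ) (t n : ℕ) : ℕ := Module.finrank ℂ (SimpleModule q t n)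

/-- `b(t)`: the remainder of `t` modulo `ℓ`. -/
def b (ℓ t : ℕ) : ℕ := t % ℓ

/-- `ℓ - 1 - b(t)`, which for `ℓ > 0` is not truncated. -/
def bBar (ℓ t : ℕ) : ℕ := ℓ - 1 - b ℓ t

/-- The linkage map `g(aℓ + b) = (a + 1)ℓ + ℓ - 2 - b`, meant for `0 ≤ b ≤ ℓ - 2`, that is for
arguments not congruent to `-1` modulo `ℓ`; this set of arguments is mapped into itself. -/
def g (ℓ t : ℕ) : ℕ := (t / ℓ + 1) * ℓ + (ℓ - 2 - b ℓ t)

end TemperleyLieb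

/-! Write [k] for the quantum integer and G(n,t) for the Gram matrix of W_t(n), whose rank is l_t(n)
(`l_eq_rank`). Bending down an arc at the last upper point splits the monic diagrams t → n+1 into
those t-1 → n and t+1 → n (`linkSuccEquiv`). If [t+1] ≠ 0, the second family can be corrected by
combinations of the first so as to become orthogonal to it, and G(n+1,t) turns into the direct sum
of G(n,t-1) and -([t+2]/[t+1]) G(n,t+1) (`gram_succ`). So the rank obeys the branching rule of the
dimensions, except that the second summand drops out when [t+2] = 0 (`rank_gram_succ`).

This recursion is used only at t ≢ -1 modulo ℓ, but it leads to t-1 ≡ -1. There the form is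
non-degenerate (`rank_gram_of_dvd`): for generic q the determinant is, up to sign, the product over
j ≥ 1 of ([t+1+j]/[j])^{w_{t+2j}(n)} (`norm_det_gram`), and if ℓ divides t+1 every factor has a
non-zero limit at the root of unity. The difference of the two sums of dimensions satisfies the same
recursion with the same boundary values (`rank_gram_eq`).

The block form is obtained in a concrete model. Choose ω with ω^4 = -q. A diagram gives a vector of
the n-fold tensor power of ℂ², a basis state being the set of its negative sites: arcs carry
opposite signs at their ends and the weight ω^{±2}, through strands carry +. The standard scalar
product of two such vectors is the pairing (`pairing_eq_dot`). It factorizes over the curves of the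
stacked picture: a closed curve turns by ±4 quarter turns, so its two orientations add up to ω^4 +
ω^{-4} = -(q + q⁻¹); a path from bottom to top has total turning 0 and gives 1; a path returning to
its own side gives 0 (`Linked.turning_cases`, `sum_orientWeight`). The operator `flipSum`, which is
E + F for quantum sl₂, is self-adjoint and annihilates arcs, so it only flips through strands
(`IsLink.flipSum_vec`); it supplies the orthogonal correction.

Diagrams are treated as involutions of ℕ that are trivial from n on, so that appending a through
strand does not change the permutation. The number of strands is an integer, so that t-1 makes sense
at t = 0, where there are no diagrams. -/

namespace TemperleyLieb

/-! ### Systems of non-crossing arcs and the turning of the curves they form -/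

/-- `c` restricts to an involution of `S` whose arcs are pairwise non-crossing and do not pass over
a fixed point. -/
structure Nested (S : Finset ℕ) (c : ℕ → ℕ) : Prop where
  maps : ∀ i ∈ S, c i ∈ S
  invol : ∀ i ∈ S, c (c i) = i
  nest : ∀ i ∈ S, ∀ j ∈ S, i < j → j < c i → c j ≠ j ∧ i < c j ∧ c j < c i

/-- The sign `±1` of a left or right end of an arc of `c`, and `0` at a fixed point. -/
def side (c : ℕ → ℕ) (i : ℕ) : ℤ := Int.sign ((c i : ℤ) - i)

theorem side_of_lt {c : ℕ → ℕ} {i : ℕ} (h : i < c i) : side c i = 1 :=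
  Int.sign_eq_one_of_pos (by omega)

theorem side_of_gt {c : ℕ → ℕ} {i : ℕ} (h : c i < i) : side c i = -1 :=
  Int.sign_eq_neg_one_of_neg (by omega)

theorem side_of_eq {c : ℕ → ℕ} {i : ℕ} (h : c i = i) : side c i = 0 := by
  simp [side, h]

theorem side_congr {c d : ℕ → ℕ} {i : ℕ} (h : c i = d i) : side c i = side d i := by
  simp [side, h]

/-- The total turning, in units of a quarter turn, of the curves formed by the arcs of `c` and
`d` and oriented by `s`. -/
def turning (S : Finset ℕ) (s : ℕ → ℤ) (c d : ℕ → ℕ) : ℤ :=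
  ∑ i ∈ S, s i * (side c i + side d i)

/-- `s` changes sign along every arc of `c`. -/
def Alternates (S : Finset ℕ) (s : ℕ → ℤ) (c : ℕ → ℕ) : Prop :=
  ∀ i ∈ S, c i ≠ i → s (c i) = -s i

/-- `S` has no proper non-empty subset that is stable under `c` and `d`. -/
def Linked (S : Finset ℕ) (c d : ℕ → ℕ) : Prop :=
  ∀ T ⊆ S, T.Nonempty → (∀ i ∈ T, c i ∈ T ∧ d i ∈ T) → T = S

/-- The fixed points of `c` in `S`. -/
def fix (S : Finset ℕ) (c : ℕ → ℕ) : Finset ℕ := S.filter fun i => c i = i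

theorem mem_fix {S : Finset ℕ} {c : ℕ → ℕ} {i : ℕ} : i ∈ fix S c ↔ i ∈ S ∧ c i = i := by
  simp [fix]

theorem turning_comm (S : Finset ℕ) (s : ℕ → ℤ) (c d : ℕ → ℕ) :
    turning S s c d = turning S s d c := by
  simp only [turning, add_comm]

theorem Linked.symm {S : Finset ℕ} {c d : ℕ → ℕ} (h : Linked S c d) : Linked S d c :=
  fun T hT hne hst => h T hT hne fun i hi => (hst i hi).symm

/-- Take an arc of minimal length: a point beneath it would be the end of a shorter arc, because
fixed points beneath arcs are excluded. -/
theorem Nested.exists_short_arc {S : Finset ℕ} {c : ℕ → ℕ} (hc : Nested S c)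
    (h : ∃ i ∈ S, c i ≠ i) : ∃ j ∈ S, j < c j ∧ ∀ k ∈ S, ¬ (j < k ∧ k < c j) := by
  have hex : ∃ m, ∃ j ∈ S, j < c j ∧ c j - j = m := by
    obtain ⟨i, hi, hne⟩ := h
    rcases lt_or_gt_of_ne hne with h1 | h1
    · exact ⟨_, c i, hc.maps i hi, by rw [hc.invol i hi]; exact h1, rfl⟩
    · exact ⟨_, i, hi, h1, rfl⟩
  classical
  obtain ⟨j, hj, hlt, hm⟩ := Nat.find_spec hex
  refine ⟨j, hj, hlt, fun k hk hjk => ?_⟩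
  obtain ⟨h1, h2, h3⟩ := hc.nest j hj k hk hjk.1 hjk.2
  rcases lt_or_gt_of_ne h1 with h4 | h4
  · have := Nat.find_min' hex ⟨c k, hc.maps k hk, by rw [hc.invol k hk]; exact h4, rfl⟩
    rw [hc.invol k hk] at this
    omega
  · have := Nat.find_min' hex ⟨k, hk, h4, rfl⟩
    omega

/-- The outcome of removing the two points `j`, `c j` and joining up the loose ends of `d`. -/
structure IsReduction (S : Finset ℕ) (s : ℕ → ℤ) (c d : ℕ → ℕ) (S' : Finset ℕ) (d' : ℕ → ℕ) :
    Prop where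
  nested : Nested S' d'
  alternates : Alternates S' s d'
  linked : Linked S' c d'
  card_fix : (fix S' d').card = (fix S d).card
  turning_eq : turning S' s c d' = turning S s c d

section Removal

variable {S : Finset ℕ} {s : ℕ → ℤ} {c d : ℕ → ℕ} {j : ℕ}

/-- An arc of `c` with no point beneath it is contracted, and the two arcs of `d` attached to its
ends merge into one. As no point of `S` separates `j` from `c j`, the merged arc crosses nothing
that the old ones did not cross. -/
theorem isReduction_of_join (hc : Nested S c) (hd : Nested S d) (hsc : Alternates S s c)
    (hsd : Alternates S s d) (hl : Linked S c d) (hj : j ∈ S) (hlt : j < c j)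
    (hadj : ∀ k ∈ S, ¬ (j < k ∧ k < c j)) (h1 : d j ≠ j) (h2 : d (c j) ≠ c j) (h3 : d j ≠ c j) :
    IsReduction S s c d ((S.erase j).erase (c j))
      (Function.update (Function.update d (d j) (d (c j))) (d (c j)) (d j)) := by
  have hj' := hc.maps j hj
  have hcj := hc.invol j hj
  set j' := c j with hj'def
  have ha := hd.maps j hj
  have hb := hd.maps j' hj'
  have hda := hd.invol j hj
  have hdb := hd.invol j' hj'
  set a := d j with hadef
  set b := d j' with hbdef
  have hab : a ≠ b := by intro h; rw [h] at hda; omega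
  have hbj : b ≠ j := by intro h; rw [h] at hdb; omega
  set d' := Function.update (Function.update d a b) b a with hd'
  have d'a : d' a = b := by simp [hd', Function.update, hab]
  have d'b : d' b = a := by simp [hd']
  have d'x : ∀ x, x ≠ a → x ≠ b → d' x = d x := by
    intro x hx hx'; simp [hd', Function.update, hx, hx']
  clear_value d'
  -- The two arcs of `d` leave to opposite sides, or to the same side and are then nested; all other
  -- orders would be crossings.
  have key : (a < j ∧ j' < b) ∨ (j' < b ∧ b < a) ∨ (b < a ∧ a < j) := by
    have q1 := hadj a ha
    have q2 := hadj b hb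
    have n1 := hd.nest j hj j' hj' hlt
    have n2 := hd.nest b hb j hj
    rw [hdb] at n2
    have n3 : a < j ∨ j' < a := by omega
    have n4 : b < j ∨ j' < b := by omega
    rcases n3 with n3 | n3 <;> rcases n4 with n4 | n4
    · have := n2 n4 hlt; omega
    · omega
    · have := n1 (by omega); omega
    · have := n1 (by omega); omega
  have dinj : ∀ x ∈ S, ∀ y ∈ S, d x = d y → x = y := by
    intro x hx y hy h
    rw [← hd.invol x hx, h, hd.invol y hy]
  refine ⟨⟨?_, ?_, ?_⟩, ?_, ?_, ?_, ?_⟩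
  · grind [Nested]
  · grind [Nested]
  · intro x hx y hy hxy hyx
    have hxS : x ∈ S := by grind
    have hyS : y ∈ S := by grind
    have hdy := hd.maps y hyS
    have e1 := hd.nest x hxS y hyS
    have q2 := hadj y hyS
    have q3 := hadj _ hdy
    have y1 : y ≠ j := by grind
    have y2 : y ≠ j' := by grind
    have x1 : x ≠ j := by grind
    have y3 : d y = j → y = a := fun h => by rw [← hd.invol y hyS, h]
    have y4 : d y = j' → y = b := fun h => by rw [← hd.invol y hyS, h]
    have y5 : d y = a → y = j := dinj y hyS j hj
    have y6 : d y = b → y = j' := dinj y hyS j' hj'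
    by_cases hxa : x = a
    · rw [hxa] at hxy hyx ⊢
      rw [d'a] at hyx ⊢
      rw [d'x y (by omega) (by omega)]
      have e5 := hd.nest j' hj' y hyS
      have e8 := hd.nest a ha y hyS
      rw [← hbdef] at e5
      rw [hda] at e8
      clear e1
      have k1 : a < j ∧ j' < b := by omega
      rcases lt_or_gt_of_ne y1 with h | h
      · have := e8 hxy h
        omega
      · have := e5 (by omega) hyx
        omega
    by_cases hxb : x = b
    · rw [hxb] at hxy hyx ⊢
      rw [d'b] at hyx ⊢
      rw [d'x y (by omega) (by omega)]
      clear e1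
      have e4 := hd.nest j hj y hyS
      have e9 := hd.nest b hb y hyS
      have e10 := hd.nest y hyS a ha
      have e14 := hd.nest (d y) hdy b hb
      rw [← hadef] at e4
      rw [hdb] at e9 e14
      rw [hda] at e10
      rw [hd.invol y hyS] at e14
      rcases key with k | k | k
      · omega
      · have h4 := e4 (by omega) hyx
        refine ⟨h4.1, ?_, h4.2.2⟩
        by_contra h
        have := e14 (by omega) hxy
        omega
      · have h4 := e9 hxy (by omega)
        refine ⟨h4.1, h4.2.1, ?_⟩
        by_contra h
        have := e10 hyx (by omega)
        omega
    rw [d'x x hxa hxb] at hyx ⊢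
    have q4 := hadj _ (hd.maps x hxS)
    have q5 := hadj x hxS
    have x5 : d x = j' → x = b := fun h => by rw [← hd.invol x hxS, h]
    by_cases hya : y = a
    · rw [hya] at hxy hyx ⊢
      rw [d'a]
      have h1 := hd.nest x hxS a ha hxy hyx
      rw [hda] at h1
      have h2 := hd.nest x hxS j' hj' (by omega) (by omega)
      omega
    by_cases hyb : y = b
    · rw [hyb] at hxy hyx ⊢
      rw [d'b]
      have h1 := hd.nest x hxS b hb hxy hyx
      rw [hdb] at h1
      have h2 := hd.nest x hxS j hj (by omega) (by omega)
      omega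
    rw [d'x y hya hyb]
    exact e1 hxy hyx
  · intro x hx hne
    have := hsd j hj; have := hsd j' hj'; have := hsc j hj; have := hsd x
    grind
  -- A stable set that contains the merged arc becomes stable for the old arcs after adding `j` and
  -- `j'`; one that misses the merged arc was stable already.
  · intro T hT hne hst
    have hTS : T ⊆ S := fun x hx => by grind
    have hjT : j ∉ T := fun h => by simpa using hT h
    have hjT' : j' ∉ T := fun h => by simpa using hT h
    by_cases haT : a ∈ T
    · have hbT : b ∈ T := d'a ▸ (hst a haT).2
      have := hl (insert j (insert j' T)) (by
        intro x
        simp only [Finset.mem_insert]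
        rintro (rfl | rfl | h)
        exacts [hj, hj', hTS h]) (by simp) (by
        intro x hx
        simp only [Finset.mem_insert] at hx ⊢
        rcases hx with rfl | rfl | hx
        · exact ⟨Or.inr (Or.inl rfl), Or.inr (Or.inr haT)⟩
        · exact ⟨Or.inl hcj, Or.inr (Or.inr hbT)⟩
        · refine ⟨Or.inr (Or.inr (hst x hx).1), ?_⟩
          by_cases hxa : x = a
          · exact Or.inl (hxa ▸ hda)
          by_cases hxb : x = b
          · exact Or.inr (Or.inl (hxb ▸ hdb))
          · exact Or.inr (Or.inr (d'x x hxa hxb ▸ (hst x hx).2)))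
      rw [← this]
      ext x
      simp only [Finset.mem_insert, Finset.mem_erase]
      constructor
      · rintro h
        exact ⟨fun h' => hjT' (h' ▸ h), fun h' => hjT (h' ▸ h), Or.inr (Or.inr h)⟩
      · tauto
    · have hbT : b ∉ T := fun h => haT (d'b ▸ (hst b h).2)
      have := hl T hTS hne (by
        intro x hx
        refine ⟨(hst x hx).1, ?_⟩
        rw [← d'x x (fun h => haT (h ▸ hx)) (fun h => hbT (h ▸ hx))]
        exact (hst x hx).2)
      exact absurd (this ▸ hj) hjT
  · congr 1
    ext x
    simp only [mem_fix]
    grind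
  · have hs : ∀ f : ℕ → ℤ, ∑ i ∈ S, f i = f j + f j' + ∑ i ∈ (S.erase j).erase j', f i := by
      intro f
      rw [add_assoc, Finset.add_sum_erase _ _ (by grind), Finset.add_sum_erase _ _ hj]
    have hp : ∑ i ∈ (S.erase j).erase j', s i * (side c i + side d' i) -
        ∑ i ∈ (S.erase j).erase j', s i * (side c i + side d i) =
        s a * (side d' a - side d a) + s b * (side d' b - side d b) := by
      rw [← Finset.sum_sub_distrib, ← Finset.sum_pair (f := fun i => s i * (side d' i - side d i))
        hab]
      symm
      refine Finset.sum_subset_zero_on_sdiff (by grind) ?_ ?_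
      · intro x hx
        rw [side_congr (d'x x (by grind) (by grind))]
        ring
      · intro x hx
        ring
    unfold turning
    rw [hs]
    have s1 := hsd j hj h1
    have s2 := hsd j' hj' h2
    have s3 := hsc j hj hlt.ne'
    have t1 := side_of_lt hlt
    have t2 : side c j' = -1 := side_of_gt (by omega)
    rw [← hadef] at s1
    rw [← hbdef] at s2
    rw [← hj'def] at s3
    rw [s1, s2, s3] at hp
    rw [t1, t2, s3]
    -- With arcs leaving to opposite sides, the contributions of `j` and `j'` cancel and the sides
    -- of `a` and `b` persist. With nested arcs, `j` and `j'` contribute `2 * s j`, which is what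
    -- the far end of the inner arc gains by reversing its side.
    rcases key with k | k | k
    · rw [side_of_lt (c := d') (i := a) (by omega), side_of_lt (c := d) (i := a) (by omega),
        side_of_gt (c := d') (i := b) (by omega), side_of_gt (c := d) (i := b) (by omega)] at hp
      rw [side_of_gt (c := d) (i := j) (by omega), side_of_lt (c := d) (i := j') (by omega)]
      linarith
    · rw [side_of_gt (c := d') (i := a) (by omega), side_of_gt (c := d) (i := a) (by omega),
        side_of_lt (c := d') (i := b) (by omega), side_of_gt (c := d) (i := b) (by omega)] at hp
      rw [side_of_lt (c := d) (i := j) (by omega), side_of_lt (c := d) (i := j') (by omega)]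
      linarith
    · rw [side_of_gt (c := d') (i := a) (by omega), side_of_lt (c := d) (i := a) (by omega),
        side_of_lt (c := d') (i := b) (by omega), side_of_lt (c := d) (i := b) (by omega)] at hp
      rw [side_of_gt (c := d) (i := j) (by omega), side_of_gt (c := d) (i := j') (by omega)]
      linarith

/-- Here the path ends at `j`, and after the contraction it ends at `d (c j)`. That point lies to
the right of `c j`, since otherwise its arc would pass over the fixed point `j`. -/
theorem isReduction_of_left_fixed (hc : Nested S c) (hd : Nested S d) (hsc : Alternates S s c)
    (hsd : Alternates S s d) (hl : Linked S c d) (hj : j ∈ S) (hlt : j < c j)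
    (hadj : ∀ k ∈ S, ¬ (j < k ∧ k < c j)) (h1 : d j = j) (h2 : d (c j) ≠ c j) :
    IsReduction S s c d ((S.erase j).erase (c j))
      (Function.update d (d (c j)) (d (c j))) := by
  have hj' := hc.maps j hj
  have hcj := hc.invol j hj
  set j' := c j with hj'def
  have hb := hd.maps j' hj'
  have hdb := hd.invol j' hj'
  set b := d j' with hbdef
  have hbj : b ≠ j := by intro h; rw [h] at hdb; omega
  set d' := Function.update d b b with hd'
  have d'b : d' b = b := by simp [hd']
  have d'x : ∀ x, x ≠ b → d' x = d x := by
    intro x hx; simp [hd', hx]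
  clear_value d'
  have key : j' < b := by
    have q2 := hadj b hb
    have n2 := hd.nest b hb j hj
    rw [hdb] at n2
    by_contra
    have := n2 (by omega) hlt
    omega
  have dinj : ∀ x ∈ S, ∀ y ∈ S, d x = d y → x = y := by
    intro x hx y hy h
    rw [← hd.invol x hx, h, hd.invol y hy]
  refine ⟨⟨?_, ?_, ?_⟩, ?_, ?_, ?_, ?_⟩
  · grind [Nested]
  · grind [Nested]
  · intro x hx y hy hxy hyx
    have hxS : x ∈ S := by grind
    have hyS : y ∈ S := by grind
    have e1 := hd.nest x hxS y hyS
    have e2 := hd.nest x hxS j hj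
    have q1 := hadj x hxS
    by_cases hxb : x = b
    · rw [hxb, d'b] at hyx
      omega
    rw [d'x x hxb] at hyx ⊢
    by_cases hyb : y = b
    · subst hyb
      grind
    rw [d'x y hyb]
    exact e1 hxy hyx
  · intro x hx hne
    have := hsd x
    grind
  · intro T hT hne hst
    have hTS : T ⊆ S := fun x hx => by grind
    have hjT : j ∉ T := fun h => by simpa using hT h
    have hjT' : j' ∉ T := fun h => by simpa using hT h
    by_cases hbT : b ∈ T
    · have := hl (insert j (insert j' T)) (by
        intro x
        simp only [Finset.mem_insert]
        rintro (rfl | rfl | h)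
        exacts [hj, hj', hTS h]) (by simp) (by
        intro x hx
        simp only [Finset.mem_insert] at hx ⊢
        rcases hx with rfl | rfl | hx
        · exact ⟨Or.inr (Or.inl rfl), Or.inl h1⟩
        · exact ⟨Or.inl hcj, Or.inr (Or.inr hbT)⟩
        · refine ⟨Or.inr (Or.inr (hst x hx).1), ?_⟩
          by_cases hxb : x = b
          · exact Or.inr (Or.inl (hxb ▸ hdb))
          · exact Or.inr (Or.inr (d'x x hxb ▸ (hst x hx).2)))
      rw [← this]
      ext x
      simp only [Finset.mem_insert, Finset.mem_erase]
      constructor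
      · rintro h
        exact ⟨fun h' => hjT' (h' ▸ h), fun h' => hjT (h' ▸ h), Or.inr (Or.inr h)⟩
      · tauto
    · have := hl T hTS hne (by
        intro x hx
        refine ⟨(hst x hx).1, ?_⟩
        rw [← d'x x (fun h => hbT (h ▸ hx))]
        exact (hst x hx).2)
      exact absurd (this ▸ hj) hjT
  · have : fix ((S.erase j).erase j') d' = insert b ((fix S d).erase j) := by
      ext x
      simp only [mem_fix, Finset.mem_insert, Finset.mem_erase]
      grind
    rw [this, Finset.card_insert_of_notMem (by simp only [Finset.mem_erase, mem_fix]; grind),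
      Finset.card_erase_add_one (by rw [mem_fix]; exact ⟨hj, h1⟩)]
  · have hs : ∀ f : ℕ → ℤ, ∑ i ∈ S, f i = f j + f j' + ∑ i ∈ (S.erase j).erase j', f i := by
      intro f
      rw [add_assoc, Finset.add_sum_erase _ _ (by grind), Finset.add_sum_erase _ _ hj]
    have hp : ∑ i ∈ (S.erase j).erase j', s i * (side c i + side d' i) -
        ∑ i ∈ (S.erase j).erase j', s i * (side c i + side d i) =
        s b * (side d' b - side d b) := by
      rw [← Finset.sum_sub_distrib,
        ← Finset.sum_singleton (f := fun i => s i * (side d' i - side d i)) (a := b)]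
      symm
      refine Finset.sum_subset_zero_on_sdiff (by grind) ?_ ?_
      · intro x hx
        rw [side_congr (d'x x (by grind))]
        ring
      · intro x hx
        ring
    unfold turning
    rw [hs]
    have s2 := hsd j' hj' h2
    have s3 := hsc j hj hlt.ne'
    have t1 := side_of_lt hlt
    have t2 : side c j' = -1 := side_of_gt (by omega)
    rw [← hbdef] at s2
    rw [← hj'def] at s3
    rw [s2, s3] at hp
    rw [t1, t2, s3, side_of_eq h1]
    rw [side_of_eq d'b, side_of_gt (c := d) (i := b) (by omega)] at hp
    rw [side_of_lt (c := d) (i := j') (by omega)]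
    linarith

/-- Mirror image of `isReduction_of_left_fixed`. -/
theorem isReduction_of_right_fixed (hc : Nested S c) (hd : Nested S d) (hsc : Alternates S s c)
    (hsd : Alternates S s d) (hl : Linked S c d) (hj : j ∈ S) (hlt : j < c j)
    (hadj : ∀ k ∈ S, ¬ (j < k ∧ k < c j)) (h1 : d j ≠ j) (h2 : d (c j) = c j) :
    IsReduction S s c d ((S.erase j).erase (c j)) (Function.update d (d j) (d j)) := by
  have hj' := hc.maps j hj
  have hcj := hc.invol j hj
  set j' := c j with hj'def
  have ha := hd.maps j hj
  have hda := hd.invol j hj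
  set a := d j with hadef
  have haj : a ≠ j' := by intro h; rw [h] at hda; omega
  set d' := Function.update d a a with hd'
  have d'a : d' a = a := by simp [hd']
  have d'x : ∀ x, x ≠ a → d' x = d x := by
    intro x hx; simp [hd', hx]
  clear_value d'
  have key : a < j := by
    have q2 := hadj a ha
    have n2 := hd.nest j hj j' hj' hlt
    by_contra
    have := n2 (by omega)
    omega
  have dinj : ∀ x ∈ S, ∀ y ∈ S, d x = d y → x = y := by
    intro x hx y hy h
    rw [← hd.invol x hx, h, hd.invol y hy]
  refine ⟨⟨?_, ?_, ?_⟩, ?_, ?_, ?_, ?_⟩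
  · grind [Nested]
  · grind [Nested]
  · intro x hx y hy hxy hyx
    have hxS : x ∈ S := by grind
    have hyS : y ∈ S := by grind
    have e1 := hd.nest x hxS y hyS
    have e2 := hd.nest x hxS j' hj'
    have q1 := hadj _ (hd.maps x hxS)
    by_cases hxb : x = a
    · subst hxb
      omega
    rw [d'x x hxb] at hyx ⊢
    by_cases hyb : y = a
    · subst hyb
      grind
    rw [d'x y hyb]
    exact e1 hxy hyx
  · intro x hx hne
    have := hsd x
    grind
  · intro T hT hne hst
    have hTS : T ⊆ S := fun x hx => by grind
    have hjT : j ∉ T := fun h => by simpa using hT h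
    have hjT' : j' ∉ T := fun h => by simpa using hT h
    by_cases hbT : a ∈ T
    · have := hl (insert j (insert j' T)) (by
        intro x
        simp only [Finset.mem_insert]
        rintro (rfl | rfl | h)
        exacts [hj, hj', hTS h]) (by simp) (by
        intro x hx
        simp only [Finset.mem_insert] at hx ⊢
        rcases hx with rfl | rfl | hx
        · exact ⟨Or.inr (Or.inl rfl), Or.inr (Or.inr hbT)⟩
        · exact ⟨Or.inl hcj, Or.inr (Or.inl h2)⟩
        · refine ⟨Or.inr (Or.inr (hst x hx).1), ?_⟩
          by_cases hxb : x = a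
          · exact Or.inl (hxb ▸ hda)
          · exact Or.inr (Or.inr (d'x x hxb ▸ (hst x hx).2)))
      rw [← this]
      ext x
      simp only [Finset.mem_insert, Finset.mem_erase]
      constructor
      · rintro h
        exact ⟨fun h' => hjT' (h' ▸ h), fun h' => hjT (h' ▸ h), Or.inr (Or.inr h)⟩
      · tauto
    · have := hl T hTS hne (by
        intro x hx
        refine ⟨(hst x hx).1, ?_⟩
        rw [← d'x x (fun h => hbT (h ▸ hx))]
        exact (hst x hx).2)
      exact absurd (this ▸ hj) hjT
  · have : fix ((S.erase j).erase j') d' = insert a ((fix S d).erase j') := by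
      ext x
      simp only [mem_fix, Finset.mem_insert, Finset.mem_erase]
      grind
    rw [this, Finset.card_insert_of_notMem (by simp only [Finset.mem_erase, mem_fix]; grind),
      Finset.card_erase_add_one (by rw [mem_fix]; exact ⟨hj', h2⟩)]
  · have hs : ∀ f : ℕ → ℤ, ∑ i ∈ S, f i = f j + f j' + ∑ i ∈ (S.erase j).erase j', f i := by
      intro f
      rw [add_assoc, Finset.add_sum_erase _ _ (by grind), Finset.add_sum_erase _ _ hj]
    have hp : ∑ i ∈ (S.erase j).erase j', s i * (side c i + side d' i) -
        ∑ i ∈ (S.erase j).erase j', s i * (side c i + side d i) =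
        s a * (side d' a - side d a) := by
      rw [← Finset.sum_sub_distrib,
        ← Finset.sum_singleton (f := fun i => s i * (side d' i - side d i)) (a := a)]
      symm
      refine Finset.sum_subset_zero_on_sdiff (by grind) ?_ ?_
      · intro x hx
        rw [side_congr (d'x x (by grind))]
        ring
      · intro x hx
        ring
    unfold turning
    rw [hs]
    have s2 := hsd j hj h1
    have s3 := hsc j hj hlt.ne'
    have t1 := side_of_lt hlt
    have t2 : side c j' = -1 := side_of_gt (by omega)
    rw [← hadef] at s2
    rw [← hj'def] at s3
    rw [s2] at hp
    rw [t1, t2, s3, side_of_eq h2]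
    rw [side_of_eq d'a, side_of_lt (c := d) (i := a) (by omega)] at hp
    rw [side_of_gt (c := d) (i := j) (by omega)]
    linarith

end Removal

theorem Nested.erase_arc {S : Finset ℕ} {c : ℕ → ℕ} (hc : Nested S c) {j : ℕ} (hj : j ∈ S) :
    Nested ((S.erase j).erase (c j)) c := by
  have hcj := hc.invol j hj
  have cinj : ∀ x ∈ S, ∀ y ∈ S, c x = c y → x = y := by
    intro x hx y hy h
    rw [← hc.invol x hx, h, hc.invol y hy]
  refine ⟨fun i hi => ?_, fun i hi => ?_, fun i hi k hk => ?_⟩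
  · have h1 := hc.maps i
    have h2 := cinj i
    have h3 := cinj i
    have h4 := hc.maps j hj
    have h5 := hc.invol i
    grind
  · exact hc.invol i (by grind)
  · exact hc.nest i (by grind) k (by grind)

/-- A connected configuration of arcs is a closed curve, which makes one full turn, or a path with
two ends; a path from a fixed point of `c` to a fixed point of `d` does not turn. -/
theorem Linked.turning_cases : ∀ (m : ℕ) {S : Finset ℕ} {s : ℕ → ℤ} {c d : ℕ → ℕ}, S.card ≤ m →
    S.Nonempty → Nested S c → Nested S d → Alternates S s c → Alternates S s d →
    (∀ i ∈ S, s i = 1 ∨ s i = -1) → Linked S c d →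
    (fix S c).card + (fix S d).card ≤ 2 ∧
    (fix S c = ∅ → fix S d = ∅ → turning S s c d = 4 ∨ turning S s c d = -4) ∧
    ((fix S c).card = 1 → (fix S d).card = 1 → turning S s c d = 0) := by
  intro m
  induction m with
  | zero =>
    intro S s c d hm hne
    have := hne.card_pos
    omega
  | succ m ih =>
    -- It suffices to treat the case that `c` has an arc, since the claim is symmetric in `c` and
    -- `d`; without any arcs the linked set is a single point.
    have step : ∀ {S : Finset ℕ} {s : ℕ → ℤ} {c d : ℕ → ℕ}, S.card ≤ m + 1 →
        S.Nonempty → Nested S c → Nested S d → Alternates S s c → Alternates S s d →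
        (∀ i ∈ S, s i = 1 ∨ s i = -1) → Linked S c d → (∃ i ∈ S, c i ≠ i) →
        (fix S c).card + (fix S d).card ≤ 2 ∧
        (fix S c = ∅ → fix S d = ∅ → turning S s c d = 4 ∨ turning S s c d = -4) ∧
        ((fix S c).card = 1 → (fix S d).card = 1 → turning S s c d = 0) := by
      intro S s c d hm hne hc hd hsc hsd hs hl hex
      obtain ⟨j, hj, hlt, hadj⟩ := hc.exists_short_arc hex
      have hj' := hc.maps j hj
      have hcj := hc.invol j hj
      have hfc : fix ((S.erase j).erase (c j)) c = fix S c := by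
        ext x
        simp only [mem_fix, Finset.mem_erase]
        grind
      have finish : ∀ d', IsReduction S s c d ((S.erase j).erase (c j)) d' →
          ((S.erase j).erase (c j)).Nonempty →
          (fix S c).card + (fix S d).card ≤ 2 ∧
          (fix S c = ∅ → fix S d = ∅ → turning S s c d = 4 ∨ turning S s c d = -4) ∧
          ((fix S c).card = 1 → (fix S d).card = 1 → turning S s c d = 0) := by
        intro d' h hne'
        have hlt' : ((S.erase j).erase (c j)).card ≤ m := by
          rw [Finset.card_erase_of_mem (by grind), Finset.card_erase_of_mem hj]
          omega
        have := ih hlt' hne' (hc.erase_arc hj) h.nested (fun i hi => hsc i (by grind)) h.alternates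
          (fun i hi => hs i (by grind)) h.linked
        rw [hfc, h.card_fix, h.turning_eq] at this
        refine ⟨this.1, fun h1 h2 => this.2.1 h1 ?_, this.2.2⟩
        rw [← Finset.card_eq_zero, h.card_fix, h2, Finset.card_empty]
      -- The induction bottoms out when the short arc is everything: then `d` has either the same
      -- arc, and the curve is a circle, or two fixed points.
      by_cases hpair : S = {j, c j}
      · have h2 : ({j, c j} : Finset ℕ).card = 2 := Finset.card_pair hlt.ne
        have hfc0 : fix S c = ∅ := by
          ext x
          simp only [mem_fix]
          grind
        have hfd : (fix S d).card ≤ 2 := by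
          rw [← h2, ← hpair]
          exact Finset.card_filter_le _ _
        refine ⟨by rw [hfc0]; simpa using hfd, fun _ h => ?_, fun h => by simp [hfc0] at h⟩
        have hdj : d j = c j := by
          have : j ∉ fix S d := by simp [h]
          have := hd.maps j hj
          simp only [mem_fix] at *
          grind
        have hdj' : d (c j) = j := by rw [← hdj]; exact hd.invol j hj
        have h5 : turning S s c d = s j * (side c j + side d j) +
            s (c j) * (side c (c j) + side d (c j)) := by
          rw [turning, hpair, Finset.sum_pair hlt.ne]
        rw [h5, hsc j hj hlt.ne', side_of_lt hlt, side_of_lt (c := d) (i := j) (by omega),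
          side_of_gt (c := c) (i := c j) (by omega), side_of_gt (c := d) (i := c j) (by omega)]
        rcases hs j hj with h6 | h6 <;> rw [h6] <;> norm_num
      -- Otherwise `{j, c j}` would be a proper stable subset.
      · have hbad : ¬ (d j = j ∧ d (c j) = c j) ∧ d j ≠ c j := by
          constructor
          · rintro ⟨h1, h2⟩
            exact hpair (hl {j, c j} (by grind) (by simp) (by grind)).symm
          · intro h1
            have := hd.invol j hj
            exact hpair (hl {j, c j} (by grind) (by simp) (by grind)).symm
        have hne' : ((S.erase j).erase (c j)).Nonempty := by
          by_contra h
          rw [Finset.not_nonempty_iff_eq_empty] at h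
          apply hpair
          ext x
          have : x ∉ (S.erase j).erase (c j) := by simp [h]
          grind
        by_cases h1 : d j = j
        · exact finish _ (isReduction_of_left_fixed hc hd hsc hsd hl hj hlt hadj h1
            fun h2 => hbad.1 ⟨h1, h2⟩) hne'
        by_cases h2 : d (c j) = c j
        · exact finish _ (isReduction_of_right_fixed hc hd hsc hsd hl hj hlt hadj h1 h2) hne'
        exact finish _ (isReduction_of_join hc hd hsc hsd hl hj hlt hadj h1 h2 hbad.2) hne'
    intro S s c d hm hne hc hd hsc hsd hs hl
    by_cases h1 : ∃ i ∈ S, c i ≠ i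
    · exact step hm hne hc hd hsc hsd hs hl h1
    by_cases h2 : ∃ i ∈ S, d i ≠ i
    · have := step hm hne hd hc hsd hsc hs hl.symm h2
      rw [turning_comm, add_comm (fix S c).card]
      exact ⟨this.1, fun h h' => this.2.1 h' h, fun h h' => this.2.2 h' h⟩
    push Not at h1 h2
    obtain ⟨i, hi⟩ := hne
    have hS : S = {i} :=
      (hl {i} (by grind) (by simp) (by grind)).symm
    have hfc : fix S c = S := by ext x; rw [mem_fix]; grind
    have hfd : fix S d = S := by ext x; rw [mem_fix]; grind
    refine ⟨by rw [hfc, hfd, hS]; simp, fun h => ?_, fun _ _ => ?_⟩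
    · rw [hfc, hS] at h
      simp at h
    · rw [turning, hS, Finset.sum_singleton, side_of_eq (h1 i hi), side_of_eq (h2 i hi)]
      simp

/-- The ends of each arc cancel. Applied to both `c` and `d`, this relates the signs at the two ends
of a path. -/
theorem sum_eq_sum_fix {S : Finset ℕ} {s : ℕ → ℤ} {c : ℕ → ℕ} (hc : Nested S c)
    (hs : Alternates S s c) : ∑ i ∈ S, s i = ∑ i ∈ fix S c, s i := by
  rw [fix, ← Finset.sum_filter_add_sum_filter_not S (fun i => c i = i), add_eq_left]
  refine Finset.sum_involution (fun i _ => c i) ?_ ?_ ?_ ?_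
  · intro i hi
    simp only [Finset.mem_filter] at hi
    rw [hs i hi.1 hi.2]
    ring
  · intro i hi _
    simp only [Finset.mem_filter] at hi
    exact hi.2
  · intro i hi
    simp only [Finset.mem_filter] at hi ⊢
    have := hc.invol i hi.1
    exact ⟨hc.maps i hi.1, by rw [this]; exact fun h => hi.2 h.symm⟩
  · intro i hi
    simp only [Finset.mem_filter] at hi
    exact hc.invol i hi.1
-- Monic diagrams as non-crossing involutions
/-- `c` describes a monic diagram `t → n`: it interchanges the ends of the arcs among the `n` upper
points and fixes the ends of the `t` through strands. -/
structure IsLink (n : ℕ) (t : ℤ) (c : Equiv.Perm ℕ) : Prop where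
  invol : ∀ i, c (c i) = i
  fixed_of_le : ∀ i, n ≤ i → c i = i
  nest : ∀ i j, i < j → j < c i → c j ≠ j ∧ i < c j ∧ c j < c i
  card_fix : ((fix (Finset.range n) c).card : ℤ) = t

/-- The monic diagrams `t → n`, as involutions. -/
abbrev Link (n : ℕ) (t : ℤ) : Type := {c : Equiv.Perm ℕ // IsLink n t c}

theorem IsLink.lt {n : ℕ} {t : ℤ} {c : Equiv.Perm ℕ} (hc : IsLink n t c) {i : ℕ} (hi : i < n) :
    c i < n := by
  by_contra h
  have := hc.fixed_of_le (c i) (by omega)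
  rw [hc.invol] at this
  omega

theorem IsLink.nested {n : ℕ} {t : ℤ} {c : Equiv.Perm ℕ} (hc : IsLink n t c) {S : Finset ℕ}
    (hS : ∀ i ∈ S, c i ∈ S) : Nested S c :=
  ⟨hS, fun i _ => hc.invol i, fun i _ j _ => hc.nest i j⟩

theorem IsLink.nested_range {n : ℕ} {t : ℤ} {c : Equiv.Perm ℕ} (hc : IsLink n t c) :
    Nested (Finset.range n) c :=
  hc.nested fun i hi => by simpa using hc.lt (by simpa using hi)

instance (n : ℕ) (t : ℤ) : Finite (Link n t) := by
  refine Finite.of_injective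
    (fun c : Link n t => fun i : Fin n => (⟨c.1 i, c.2.lt i.2⟩ : Fin n)) fun c d h => ?_
  ext i
  by_cases hi : i < n
  · have := congrFun h ⟨i, hi⟩
    simpa using this
  · rw [c.2.fixed_of_le i (by omega), d.2.fixed_of_le i (by omega)]

section OfDiagram

variable {t n : ℕ}

/-- The upper end of the arc starting at the upper point `i`, or `i` itself if it is the end of a
through strand. -/
def Diagram.mate (D : Diagram t n) (i : ℕ) : ℕ :=
  if h : i < n then Sum.elim (fun _ => i) (fun j : Fin n => (j : ℕ)) (D.partner (Sum.inr ⟨i, h⟩)) else i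

theorem Diagram.mate_of_inl {D : Diagram t n} {i : Fin n} {k : Fin t}
    (h : D.partner (Sum.inr i) = Sum.inl k) : D.mate i = i := by
  simp [mate, h]

theorem Diagram.mate_of_inr {D : Diagram t n} {i k : Fin n}
    (h : D.partner (Sum.inr i) = Sum.inr k) : D.mate i = k := by
  simp [mate, h]

theorem Diagram.mate_of_le (D : Diagram t n) {i : ℕ} (h : n ≤ i) : D.mate i = i := by
  simp [mate, not_lt.2 h]

theorem Diagram.mate_eq_self_iff (D : Diagram t n) (i : Fin n) :
    D.mate i = i ↔ ∃ k, D.partner (Sum.inr i) = Sum.inl k := by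
  rcases h : D.partner (Sum.inr i) with k | k
  · simp [mate_of_inl h]
  · rw [mate_of_inr h]
    simp only [reduceCtorEq, exists_false, iff_false]
    intro h'
    rw [Fin.val_inj.1 h'] at h
    exact D.partner_ne _ h

theorem Diagram.mate_mate (D : Diagram t n) (i : ℕ) : D.mate (D.mate i) = i := by
  by_cases hi : i < n
  · rcases h : D.partner (Sum.inr ⟨i, hi⟩) with k | k
    · have := mate_of_inl h
      simp only at this
      rw [this, this]
    · have := mate_of_inr h
      simp only at this
      rw [this]
      have h2 := D.partner_partner (Sum.inr ⟨i, hi⟩)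
      rw [h] at h2
      exact mate_of_inr h2
  · rw [D.mate_of_le (not_lt.1 hi), D.mate_of_le (not_lt.1 hi)]

/-- `mate` as a permutation. -/
def Diagram.matePerm (D : Diagram t n) : Equiv.Perm ℕ :=
  Function.Involutive.toPerm D.mate D.mate_mate

@[simp] theorem Diagram.matePerm_apply (D : Diagram t n) (i : ℕ) : D.matePerm i = D.mate i := rfl

/-- `pos` reverses the order of the upper points. A through strand starting beneath an arc, or an
arc leaving from there to the outside, violates `noncrossing` for a suitable choice of ends. -/
theorem Diagram.mate_nest (D : Diagram t n) (i j : ℕ) (hij : i < j) (hj : j < D.mate i) :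
    D.mate j ≠ j ∧ i < D.mate j ∧ D.mate j < D.mate i := by
  have hi : i < n := by
    by_contra h
    rw [D.mate_of_le (by omega)] at hj
    omega
  rcases h : D.partner (Sum.inr ⟨i, hi⟩) with k | k
  · have := mate_of_inl h
    simp only at this
    omega
  have hik := mate_of_inr h
  simp only at hik
  rw [hik] at hj ⊢
  have hk := k.2
  have hjn : j < n := by omega
  have h' := D.partner_partner (Sum.inr ⟨i, hi⟩)
  rw [h] at h'
  rcases h2 : D.partner (Sum.inr ⟨j, hjn⟩) with m | m
  · exfalso
    have h2' := D.partner_partner (Sum.inr ⟨j, hjn⟩)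
    rw [h2] at h2'
    have hm := m.2
    refine D.noncrossing (Sum.inl m) (Sum.inr k) ?_
    rw [h', h2']
    simp only [pos]
    omega
  · have hjm := mate_of_inr h2
    simp only at hjm
    have hm := m.2
    have hne : (m : ℕ) ≠ j := fun h0 => D.partner_ne (Sum.inr ⟨j, hjn⟩) (by
      rw [h2]; congr 1; exact Fin.ext h0)
    have hne1 : (m : ℕ) ≠ i := by
      intro h0
      have h2' := D.partner_partner (Sum.inr ⟨j, hjn⟩)
      rw [h2, show m = ⟨i, hi⟩ from Fin.ext h0, h] at h2'
      have := congrArg (Sum.elim (fun _ => 0) (fun x : Fin n => (x : ℕ))) h2'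
      simp only [Sum.elim_inr] at this
      omega
    have hne2 : (m : ℕ) ≠ k := by
      intro h0
      have h2' := D.partner_partner (Sum.inr ⟨j, hjn⟩)
      rw [h2, show m = k from Fin.ext h0, h'] at h2'
      have := congrArg (Sum.elim (fun _ => 0) (fun x : Fin n => (x : ℕ))) h2'
      simp only [Sum.elim_inr] at this
      omega
    have c1 := D.noncrossing (Sum.inr k) (Sum.inr ⟨j, hjn⟩)
    have h2' := D.partner_partner (Sum.inr ⟨j, hjn⟩)
    rw [h2] at h2'
    have c2 := D.noncrossing (Sum.inr m) (Sum.inr k)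
    rw [h', h2] at c1
    rw [h', h2'] at c2
    simp only [pos] at c1 c2
    omega

theorem Diagram.IsMonic.isLink {D : Diagram t n} (hD : D.IsMonic) :
    IsLink n t D.matePerm := by
  refine ⟨D.mate_mate, fun i hi => D.mate_of_le hi, D.mate_nest, ?_⟩
  rw [Nat.cast_inj]
  choose p hp using hD
  have hp' : ∀ i, D.partner (Sum.inr (p i)) = Sum.inl i := fun i => by
    rw [← hp, D.partner_partner]
  have : (fix (Finset.range n) D.matePerm) = Finset.univ.image fun i => (p i : ℕ) := by
    ext j
    simp only [mem_fix, Finset.mem_range, matePerm_apply, Finset.mem_image, Finset.mem_univ,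
      true_and]
    constructor
    · rintro ⟨hj, h⟩
      obtain ⟨k, hk⟩ := (D.mate_eq_self_iff ⟨j, hj⟩).1 h
      refine ⟨k, ?_⟩
      have h2 := hp k
      rw [← hk, D.partner_partner] at h2
      rw [← Sum.inr.inj h2]
    · rintro ⟨i, rfl⟩
      exact ⟨(p i).2, (D.mate_eq_self_iff (p i)).2 ⟨i, hp' i⟩⟩
  rw [this, Finset.card_image_of_injective, Finset.card_univ, Fintype.card_fin]
  intro i j h
  have h1 := hp' i
  rw [Fin.val_inj.1 h, hp' j] at h1
  exact (Sum.inl.inj h1).symm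

/-- The involution that describes a monic diagram. -/
def MonicDiagram.toLink (D : MonicDiagram t n) : Link n t := ⟨D.1.matePerm, D.2.isLink⟩

/-- Through strands do not cross, so they are matched with the fixed points in increasing order.
Hence the involution on the upper points determines the lower half of the diagram as well. -/
theorem MonicDiagram.partner_inl (D : MonicDiagram t n)
    (h : (fix (Finset.range n) D.1.matePerm).card = t) (i : Fin t) :
    ∃ j : Fin n, D.1.partner (Sum.inl i) = Sum.inr j ∧
      (j : ℕ) = (fix (Finset.range n) D.1.matePerm).orderEmbOfFin h i := by
  obtain ⟨D, hD⟩ := D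
  have hD' := hD
  choose p hp using hD'
  refine ⟨p i, hp i, ?_⟩
  have hp' : ∀ i, D.partner (Sum.inr (p i)) = Sum.inl i := fun i => by
    rw [← hp, D.partner_partner]
  have := Finset.orderEmbOfFin_unique h (f := fun i => (p i : ℕ)) (fun i => by
      rw [mem_fix]
      exact ⟨by simp, (D.mate_eq_self_iff (p i)).2 ⟨i, hp' i⟩⟩) (by
      intro i j hij
      have h1 := D.noncrossing (Sum.inl i) (Sum.inl j)
      rw [hp, hp] at h1
      have h2 : (p i : ℕ) ≠ p j := by
        intro h
        have h3 := hp' i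
        rw [Fin.val_inj.1 h, hp' j] at h3
        exact hij.ne (Sum.inl.inj h3).symm
      have h4 := (p i).2
      have h5 := (p j).2
      have h6 := i.2
      have h7 := j.2
      simp only [pos] at h1
      rw [Fin.lt_def] at hij
      show (p i : ℕ) < p j
      omega)
  exact congrFun this i

theorem MonicDiagram.toLink_injective :
    Function.Injective (MonicDiagram.toLink (t := t) (n := n)) := by
  intro D D' h
  have hm : D.1.matePerm = D'.1.matePerm := congrArg Subtype.val h
  have hcard : (fix (Finset.range n) D.1.matePerm).card = t := by
    exact_mod_cast D.toLink.2.card_fix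
  have hl : ∀ i, D.1.partner (Sum.inl i) = D'.1.partner (Sum.inl i) := by
    intro i
    obtain ⟨j, hj, hj'⟩ := D.partner_inl hcard i
    obtain ⟨k, hk, hk'⟩ := D'.partner_inl (by rw [← hm]; exact hcard) i
    simp only [← hm] at hk'
    rw [hj, hk, Fin.ext (hj'.trans hk'.symm)]
  apply Subtype.ext
  ext1
  funext x
  rcases x with i | j
  · exact hl i
  · rcases h1 : D.1.partner (Sum.inr j) with k | k
    · have h2 := D.1.partner_partner (Sum.inr j)
      rw [h1, hl] at h2
      rw [← h2, D'.1.partner_partner]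
    · have h2 := D.1.mate_of_inr h1
      have h3 : D'.1.mate j = k := by
        rw [← h2]
        exact (DFunLike.congr_fun hm (j : ℕ)).symm
      rcases h4 : D'.1.partner (Sum.inr j) with m | m
      · rw [Diagram.mate_of_inl h4, Fin.val_inj] at h3
        rw [h3] at h1
        exact absurd h1 (D.1.partner_ne _)
      · rw [Diagram.mate_of_inr h4, Fin.val_inj] at h3
        rw [h3]

/-- The diagram is rebuilt by joining the `i`-th lower point to the `i`-th fixed point; fixed points
do not lie beneath arcs, so the strands cross nothing. -/
theorem MonicDiagram.toLink_surjective :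
    Function.Surjective (MonicDiagram.toLink (t := t) (n := n)) := by
  classical
  rintro ⟨c, hc⟩
  have hcard : (fix (Finset.range n) c).card = t := by exact_mod_cast hc.card_fix
  set e := (fix (Finset.range n) c).orderIsoOfFin hcard with he
  have hen : ∀ i, ((e i : ℕ)) < n := fun i => by
    have := mem_fix.1 (e i).2
    simpa using this.1
  have hef : ∀ i, c (e i : ℕ) = (e i : ℕ) := fun i => (mem_fix.1 (e i).2).2
  have hmem : ∀ j : Fin n, c j = j → (j : ℕ) ∈ fix (Finset.range n) c := fun j h =>
    mem_fix.2 ⟨by simp, h⟩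
  let f : Fin t ⊕ Fin n → Fin t ⊕ Fin n := Sum.elim (fun i => Sum.inr ⟨e i, hen i⟩)
    (fun j => if h : c j = j then Sum.inl (e.symm ⟨j, hmem j h⟩) else Sum.inr ⟨c j, hc.lt j.2⟩)
  have f1 : ∀ i, f (Sum.inl i) = Sum.inr ⟨e i, hen i⟩ := fun i => rfl
  have f2 : ∀ (j : Fin n) (h : c j = j), f (Sum.inr j) = Sum.inl (e.symm ⟨j, hmem j h⟩) :=
    fun j h => by simp [f, h]
  have f3 : ∀ (j : Fin n) (h : c j ≠ j), f (Sum.inr j) = Sum.inr ⟨c j, hc.lt j.2⟩ :=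
    fun j h => by simp [f, h]
  clear_value f
  have hmono : ∀ i j : Fin t, (i : ℕ) < j → (e i : ℕ) < e j := fun i j h =>
    e.strictMono (Fin.lt_def.2 h)
  have hmate : ∀ j : Fin n, Sum.elim (fun _ => (j : ℕ)) (fun k : Fin n => (k : ℕ)) (f (Sum.inr j))
      = c j := by
    intro j
    by_cases h : c j = j
    · rw [f2 j h, h]; rfl
    · rw [f3 j h]; rfl
  refine ⟨⟨⟨f, ?_, ?_, ?_⟩, ?_⟩, ?_⟩
  · rintro (i | j)
    · rw [f1, f2 _ (hef i)]
      simp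
    · by_cases h : c j = j
      · rw [f2 j h, f1]
        simp
      · rw [f3 j h, f3]
        · simp [hc.invol]
        · simpa [hc.invol] using fun h' => h h'.symm
  · rintro (i | j)
    · rw [f1]; simp
    · by_cases h : c j = j
      · rw [f2 j h]; simp
      · rw [f3 j h]
        intro h'
        exact h (congrArg Fin.val (Sum.inr.inj h'))
  · rintro (i | i) (j | j) h
    · rw [f1, f1] at h
      simp only [pos] at h
      have := hmono i j h.1
      have := hen i
      have := hen j
      omega
    · rw [f1] at h
      by_cases hj : c j = j
      · rw [f2 j hj] at h
        simp only [pos] at h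
        have := (e.symm ⟨j, hmem j hj⟩).2
        omega
      · rw [f3 j hj] at h
        simp only [pos] at h
        have h1 := hen i
        have h2 := j.2
        have h3 := hc.lt j.2
        have h4 := hc.nest (c j) (e i) (by omega) (by rw [hc.invol]; omega)
        exact h4.1 (hef i)
    · simp only [pos] at h
      have := j.2
      omega
    · by_cases hi : c i = i
      · rw [f2 i hi] at h
        simp only [pos] at h
        have := (e.symm ⟨i, hmem i hi⟩).2
        omega
      · rw [f3 i hi] at h
        have h1 := hc.lt i.2
        have h2 := hc.lt j.2
        by_cases hj : c j = j
        · rw [f2 j hj] at h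
          simp only [pos] at h
          have := (e.symm ⟨j, hmem j hj⟩).2
          omega
        · rw [f3 j hj] at h
          simp only [pos] at h
          have h4 := hc.nest (c i) j (by omega) (by rw [hc.invol]; omega)
          rw [hc.invol] at h4
          omega
  · intro i
    exact ⟨_, f1 i⟩
  · apply Subtype.ext
    ext j
    show Diagram.mate _ j = c j
    by_cases hj : j < n
    · simp only [Diagram.mate, hj, dif_pos]
      exact hmate ⟨j, hj⟩
    · rw [Diagram.mate_of_le _ (by omega), hc.fixed_of_le j (by omega)]

/-- Monic diagrams and the involutions that describe them. -/
noncomputable def linkEquiv (t n : ℕ) : MonicDiagram t n ≃ Link n t :=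
  Equiv.ofBijective _ ⟨MonicDiagram.toLink_injective, MonicDiagram.toLink_surjective⟩

end OfDiagram
-- Diagram vectors in the tensor power of ℂ² and their scalar products
/-- The sign of the site `i` in the state whose set of negative sites is `A`. -/
def sgn (A : Finset ℕ) (i : ℕ) : ℤ := if i ∈ A then -1 else 1

theorem sgn_eq_or (A : Finset ℕ) (i : ℕ) : sgn A i = 1 ∨ sgn A i = -1 := by
  unfold sgn; split <;> simp

theorem sgn_eq_sgn_iff {A B : Finset ℕ} {i j : ℕ} : sgn A i = sgn B j ↔ (i ∈ A ↔ j ∈ B) := by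
  unfold sgn; split <;> split <;> simp_all

theorem sgn_empty (i : ℕ) : sgn ∅ i = 1 := by simp [sgn]

/-- The local weight at `i` of the state `A` on the diagram `c`, whose through strands carry the
signs given by `B`. -/
noncomputable def siteWeight (ω : ℂ) (c : ℕ → ℕ) (B A : Finset ℕ) (i : ℕ) : ℂ :=
  if c i = i then (if i ∈ A ↔ i ∈ B then 1 else 0)
  else if c i ∈ A ↔ i ∈ A then 0 else ω ^ (sgn A i * side c i)

/-- The vector of the `n`-fold tensor power of `ℂ²` that is defined by the diagram `c`. -/
noncomputable def vec (ω : ℂ) (n : ℕ) (c : ℕ → ℕ) (B A : Finset ℕ) : ℂ :=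
  ∏ i ∈ Finset.range n, siteWeight ω c B A i

/-- The standard symmetric bilinear form on the `n`-fold tensor power of `ℂ²`. -/
noncomputable def dot (n : ℕ) (f g : Finset ℕ → ℂ) : ℂ :=
  ∑ A ∈ (Finset.range n).powerset, f A * g A

theorem vec_ne_zero_iff {ω : ℂ} (hω : ω ≠ 0) {n : ℕ} {c : ℕ → ℕ} {B A : Finset ℕ} :
    vec ω n c B A ≠ 0 ↔ (∀ i < n, c i = i → sgn A i = sgn B i) ∧
      ∀ i < n, c i ≠ i → sgn A (c i) = -sgn A i := by
  rw [vec, Finset.prod_ne_zero_iff]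
  have : ∀ i, siteWeight ω c B A i ≠ 0 ↔ (c i = i → sgn A i = sgn B i) ∧
      (c i ≠ i → sgn A (c i) = -sgn A i) := by
    intro i
    have hz : ω ^ (sgn A i * side c i) ≠ 0 := zpow_ne_zero _ hω
    unfold siteWeight
    by_cases h : c i = i
    · simp [h, sgn_eq_sgn_iff]
    · rw [if_neg h]
      simp only [h, false_imp_iff, true_and, ne_eq, not_false_eq_true, true_imp_iff]
      unfold sgn
      by_cases h1 : c i ∈ A <;> by_cases h2 : i ∈ A <;> simp [h1, h2, zpow_ne_zero _ hω]
  simp only [this, Finset.mem_range]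
  exact ⟨fun h => ⟨fun i hi => (h i hi).1, fun i hi => (h i hi).2⟩,
    fun h i hi => ⟨h.1 i hi, h.2 i hi⟩⟩

section Component

variable {ω q : ℂ} {S : Finset ℕ} {s : ℕ → ℤ} {c d : ℕ → ℕ}

/-- The local weight at `i` for the orientation `e • s`. -/
noncomputable def orientWeight (ω : ℂ) (s : ℕ → ℤ) (c : ℕ → ℕ) (e : ℤ) (i : ℕ) : ℂ :=
  if c i = i then (if e * s i = 1 then 1 else 0) else ω ^ (e * s i * side c i)

/-- At a fixed point `side` is 0, so a factor 1 there is also the expected power of `ω`. The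
exponents add up to the turning, unless some end of the curve carries the wrong sign. -/
theorem prod_orientWeight (hω : ω ≠ 0) (e : ℤ) :
    ∏ i ∈ S, (orientWeight ω s c e i * orientWeight ω s d e i) =
      if ∀ i ∈ S, (c i = i ∨ d i = i) → e * s i = 1 then ω ^ (e * turning S s c d) else 0 := by
  split_ifs with h
  · rw [turning, Finset.mul_sum]
    have hz : ∀ (T : Finset ℕ) (f : ℕ → ℤ), ω ^ (∑ i ∈ T, f i) = ∏ i ∈ T, ω ^ f i := by
      intro T f
      classical
      induction T using Finset.induction_on with
      | empty => simp
      | insert a T ha ih => rw [Finset.sum_insert ha, Finset.prod_insert ha, zpow_add₀ hω, ih]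
    rw [hz]
    refine Finset.prod_congr rfl fun i hi => ?_
    have e1 : ∀ c : ℕ → ℕ, (c i = i → e * s i = 1) →
        orientWeight ω s c e i = ω ^ (e * s i * side c i) := by
      intro c hc
      unfold orientWeight
      split_ifs with h1 h2
      · simp [side_of_eq h1]
      · exact absurd (hc h1) h2
      · rfl
    rw [e1 c fun h1 => h i hi (Or.inl h1), e1 d fun h1 => h i hi (Or.inr h1), ← zpow_add₀ hω]
    congr 1
    ring
  · push Not at h
    obtain ⟨i, hi, h1, h2⟩ := h
    refine Finset.prod_eq_zero hi ?_
    rcases h1 with h1 | h1 <;> simp [orientWeight, h1, h2]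

/-- A closed curve contributes the loop value, a path between a fixed point of `c` and a fixed
point of `d` contributes `1`, and the other paths contribute `0`. -/
theorem sum_orientWeight (hω : ω ≠ 0) (hq : ω ^ 4 = -q) (hne : S.Nonempty) (hc : Nested S c)
    (hd : Nested S d) (hsc : Alternates S s c) (hsd : Alternates S s d)
    (hs : ∀ i ∈ S, s i = 1 ∨ s i = -1) (hl : Linked S c d) :
    ∏ i ∈ S, (orientWeight ω s c 1 i * orientWeight ω s d 1 i) +
      ∏ i ∈ S, (orientWeight ω s c (-1) i * orientWeight ω s d (-1) i) =
    if fix S c = ∅ ∧ fix S d = ∅ then -(q + q⁻¹) else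
      if (fix S c).card = (fix S d).card then 1 else 0 := by
  obtain ⟨h1, h2, h3⟩ := Linked.turning_cases S.card le_rfl hne hc hd hsc hsd hs hl
  have hsum : ∑ i ∈ fix S c, s i = ∑ i ∈ fix S d, s i :=
    (sum_eq_sum_fix hc hsc).symm.trans (sum_eq_sum_fix hd hsd)
  rw [prod_orientWeight hω, prod_orientWeight hω]
  by_cases h0 : fix S c = ∅ ∧ fix S d = ∅
  · rw [if_pos h0]
    have hno : ∀ e : ℤ, ∀ i ∈ S, (c i = i ∨ d i = i) → e * s i = 1 := by
      rintro e i hi (h | h)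
      · have : i ∈ fix S c := mem_fix.2 ⟨hi, h⟩
        simp [h0.1] at this
      · have : i ∈ fix S d := mem_fix.2 ⟨hi, h⟩
        simp [h0.2] at this
    rw [if_pos (hno 1), if_pos (hno (-1))]
    have h4 : ω ^ (4 : ℤ) = -q := by exact_mod_cast hq
    have h5 : ω ^ (-4 : ℤ) = -q⁻¹ := by rw [zpow_neg, h4, inv_neg]
    rcases h2 h0.1 h0.2 with h | h <;> rw [h]
    · rw [show (1 : ℤ) * 4 = 4 by rfl, show (-1 : ℤ) * 4 = -4 by rfl, h4, h5]
      ring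
    · rw [show (1 : ℤ) * -4 = -4 by rfl, show (-1 : ℤ) * -4 = 4 by rfl, h4, h5]
      ring
  rw [if_neg h0]
  have hs0 : ∀ i ∈ S, s i ≠ 0 := fun i hi h => by rcases hs i hi with h' | h' <;> omega
  by_cases h11 : (fix S c).card = (fix S d).card
  · rw [if_pos h11]
    have hc1 : (fix S c).card = 1 := by
      have : (fix S c).card ≠ 0 := by
        intro h
        exact h0 ⟨Finset.card_eq_zero.1 h, Finset.card_eq_zero.1 (by omega)⟩
      omega
    rw [h3 hc1 (by omega)]
    obtain ⟨p, hp⟩ := Finset.card_eq_one.1 hc1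
    obtain ⟨p', hp'⟩ := Finset.card_eq_one.1 (h11 ▸ hc1)
    rw [hp, hp', Finset.sum_singleton, Finset.sum_singleton] at hsum
    have hpS : p ∈ S ∧ c p = p := mem_fix.1 (by simp [hp])
    have hall : ∀ e : ℤ, (∀ i ∈ S, (c i = i ∨ d i = i) → e * s i = 1) ↔ e * s p = 1 := by
      intro e
      constructor
      · intro h
        exact h p hpS.1 (Or.inl hpS.2)
      · rintro h i hi (h' | h')
        · have : i ∈ fix S c := mem_fix.2 ⟨hi, h'⟩
          rw [hp, Finset.mem_singleton] at this
          rwa [this]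
        · have : i ∈ fix S d := mem_fix.2 ⟨hi, h'⟩
          rw [hp', Finset.mem_singleton] at this
          rwa [this, ← hsum]
    simp only [hall]
    rcases hs p hpS.1 with h | h <;> rw [h] <;> norm_num
  · rw [if_neg h11]
    -- There are at most two ends, and the signs of the two kinds of ends have equal sums. Unequal
    -- numbers of ends therefore mean two ends of one kind with opposite signs, which cannot both be
    -- positive.
    have key : ∃ p ∈ S, ∃ p' ∈ S, (c p = p ∨ d p = p) ∧ (c p' = p' ∨ d p' = p') ∧
        s p + s p' = 0 := by
      have case : ∀ c d : ℕ → ℕ, (fix S c).card + (fix S d).card ≤ 2 →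
          ∑ i ∈ fix S c, s i = ∑ i ∈ fix S d, s i → (fix S c).card < (fix S d).card →
          ∃ p ∈ S, ∃ p' ∈ S, d p = p ∧ d p' = p' ∧ s p + s p' = 0 := by
        intro c d h1 hsum hlt
        have hc0 : fix S c = ∅ := Finset.card_eq_zero.1 (by omega)
        rw [hc0, Finset.sum_empty] at hsum
        rcases (by omega : (fix S d).card = 1 ∨ (fix S d).card = 2) with h | h
        · obtain ⟨p, hp⟩ := Finset.card_eq_one.1 h
          rw [hp, Finset.sum_singleton] at hsum
          exact absurd hsum.symm (hs0 p (mem_fix.1 (by simp [hp] : p ∈ fix S d)).1)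
        · obtain ⟨p, p', hne, hp⟩ := Finset.card_eq_two.1 h
          rw [hp, Finset.sum_pair hne] at hsum
          have m1 := mem_fix.1 (by simp [hp] : p ∈ fix S d)
          have m2 := mem_fix.1 (by simp [hp] : p' ∈ fix S d)
          exact ⟨p, m1.1, p', m2.1, m1.2, m2.2, hsum.symm⟩
      rcases lt_or_gt_of_ne h11 with h | h
      · obtain ⟨p, hp, p', hp', h1, h2, h3⟩ := case c d h1 hsum h
        exact ⟨p, hp, p', hp', Or.inr h1, Or.inr h2, h3⟩
      · obtain ⟨p, hp, p', hp', h1, h2, h3⟩ := case d c (by omega) hsum.symm h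
        exact ⟨p, hp, p', hp', Or.inl h1, Or.inl h2, h3⟩
    obtain ⟨p, hp, p', hp', h4, h5, h6⟩ := key
    have hno : ∀ e : ℤ, ¬ ∀ i ∈ S, (c i = i ∨ d i = i) → e * s i = 1 := by
      intro e h
      have e1 := h p hp h4
      have e2 := h p' hp' h5
      have : e * (s p + s p') = 2 := by rw [mul_add, e1, e2]; norm_num
      rw [h6] at this
      simp at this
    rw [if_neg (hno 1), if_neg (hno (-1)), add_zero]

end Component

/-- The points strictly beneath an arc are paired among themselves, so their number is even and the
ends of the arc have different parity. Thus parity orients all curves consistently at once. -/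
theorem IsLink.alternates_parity {n : ℕ} {t : ℤ} {c : Equiv.Perm ℕ} (hc : IsLink n t c)
    (S : Finset ℕ) : Alternates S (fun i => (-1) ^ i) c := by
  have key : ∀ i, i < c i → ((-1 : ℤ)) ^ (c i) = -(-1) ^ i := by
    intro i hi
    have h2 : ∑ _k ∈ Finset.Ioo i (c i), (1 : ZMod 2) = 0 := by
      refine Finset.sum_involution (fun k _ => c k) (fun _ _ => by decide) ?_ ?_ ?_
      · intro k hk _
        rw [Finset.mem_Ioo] at hk
        exact (hc.nest i k hk.1 hk.2).1
      · intro k hk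
        rw [Finset.mem_Ioo] at hk ⊢
        exact (hc.nest i k hk.1 hk.2).2
      · intro k _
        exact hc.invol k
    simp only [Finset.sum_const, Nat.card_Ioo, nsmul_eq_mul, mul_one] at h2
    rw [ZMod.natCast_eq_zero_iff] at h2
    obtain ⟨m, hm⟩ := h2
    have : c i = i + (2 * m + 1) := by omega
    rw [this, pow_add, pow_succ, pow_mul]
    simp
  intro i _ hne
  rcases lt_or_gt_of_ne hne with h | h
  · have := key (c i) (by rwa [hc.invol])
    rw [hc.invol] at this
    simp only [this, neg_neg]
  · exact key i h

/-- The form of two diagram vectors factorizes over the curves formed by the arcs. -/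
theorem dot_vec_vec {ω q : ℂ} (hω : ω ≠ 0) (hq : ω ^ 4 = -q) {n : ℕ} {t t' : ℤ}
    {c d : Equiv.Perm ℕ} (hc : IsLink n t c) (hd : IsLink n t' d) {Q : Type} [Fintype Q]
    (S : Q → Finset ℕ) (hcov : ∀ i, i < n ↔ ∃ C, i ∈ S C)
    (hdis : ∀ C C' i, i ∈ S C → i ∈ S C' → C = C') (hne : ∀ C, (S C).Nonempty)
    (hSc : ∀ C, ∀ i ∈ S C, c i ∈ S C) (hSd : ∀ C, ∀ i ∈ S C, d i ∈ S C)
    (hl : ∀ C, Linked (S C) c d) :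
    dot n (vec ω n c ∅) (vec ω n d ∅) = ∏ C, if fix (S C) c = ∅ ∧ fix (S C) d = ∅ then -(q + q⁻¹)
      else if (fix (S C) c).card = (fix (S C) d).card then 1 else 0 := by
  classical
  set s : ℕ → ℤ := fun i => (-1) ^ i with hsdef
  have hs : ∀ i, s i = 1 ∨ s i = -1 := fun i => neg_one_pow_eq_or ℤ i
  let sg : Bool → ℤ := fun b => if b then 1 else -1
  have hsg : ∀ b, sg b = 1 ∨ sg b = -1 := by intro b; cases b <;> simp [sg]
  -- The state with the parity signs, reversed on the curves `C` with `η C = false`.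
  let U : (Q → Bool) → Finset ℕ := fun η =>
    Finset.univ.biUnion fun C => (S C).filter fun i => sg (η C) * s i = -1
  have hU : ∀ η C i, i ∈ S C → sgn (U η) i = sg (η C) * s i := by
    intro η C i hi
    have : i ∈ U η ↔ sg (η C) * s i = -1 := by
      simp only [U, Finset.mem_biUnion, Finset.mem_univ, true_and, Finset.mem_filter]
      constructor
      · rintro ⟨C', h1, h2⟩
        rwa [hdis C C' i hi h1]
      · exact fun h => ⟨C, hi, h⟩
    unfold sgn
    split_ifs with h
    · exact (this.1 h).symm
    · have h' : ¬ sg (η C) * s i = -1 := fun h1 => h (this.2 h1)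
      rcases hs i with h1 | h1 <;> rcases hsg (η C) with h2 | h2 <;> rw [h1, h2] at h' ⊢ <;>
        simp at h' ⊢
  have hloc : ∀ (c : Equiv.Perm ℕ) η C i, c i ∈ S C → i ∈ S C → Alternates (S C) s c →
      siteWeight ω c ∅ (U η) i = orientWeight ω s c (sg (η C)) i := by
    intro c η C i hi' hi hal
    unfold siteWeight orientWeight
    by_cases h : c i = i
    · rw [if_pos h, if_pos h]
      congr 1
      rw [← sgn_eq_sgn_iff, hU η C i hi, sgn_empty]
    · rw [if_neg h, if_neg h, if_neg, hU η C i hi]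
      rw [← sgn_eq_sgn_iff, hU η C i hi, hU η C _ hi', hal i hi h]
      rcases hs i with h1 | h1 <;> rcases hsg (η C) with h2 | h2 <;> rw [h1, h2] <;> norm_num
  have hrange : Finset.range n = Finset.univ.biUnion S := by
    ext i; simp [hcov]
  have hpd : (↑(Finset.univ : Finset Q) : Set Q).PairwiseDisjoint S := by
    intro C _ C' _ hCC
    rw [Function.onFun, Finset.disjoint_left]
    exact fun i hi hi' => hCC (hdis C C' i hi hi')
  have hUprod : ∀ η, vec ω n c ∅ (U η) * vec ω n d ∅ (U η) =
      ∏ C, ∏ i ∈ S C, (orientWeight ω s c (sg (η C)) i * orientWeight ω s d (sg (η C)) i) := by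
    intro η
    rw [vec, vec, ← Finset.prod_mul_distrib, hrange, Finset.prod_biUnion hpd]
    refine Finset.prod_congr rfl fun C _ => Finset.prod_congr rfl fun i hi => ?_
    rw [hloc c η C i (hSc C i hi) hi (hc.alternates_parity _),
      hloc d η C i (hSd C i hi) hi (hd.alternates_parity _)]
  have hUinj : Function.Injective U := by
    intro η η' h
    funext C
    obtain ⟨i, hi⟩ := hne C
    have h1 := hU η C i hi
    rw [h, hU η' C i hi] at h1
    have h2 := mul_right_cancel₀ (by rcases hs i with h | h <;> omega) h1
    revert h2
    cases η C <;> cases η' C <;> simp [sg]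
  -- A state on which neither vector vanishes alternates along all arcs. Its ratio to the parity
  -- signs is then constant on every linked set, so the state is some `U η`.
  have hsum : dot n (vec ω n c ∅) (vec ω n d ∅) =
      ∑ η, vec ω n c ∅ (U η) * vec ω n d ∅ (U η) := by
    rw [dot, ← Finset.sum_image (s := Finset.univ) (g := U)
      (f := fun A => vec ω n c ∅ A * vec ω n d ∅ A) hUinj.injOn]
    symm
    refine Finset.sum_subset ?_ ?_
    · intro A hA
      obtain ⟨η, _, rfl⟩ := Finset.mem_image.1 hA
      rw [Finset.mem_powerset, hrange]
      exact Finset.biUnion_mono fun C _ => Finset.filter_subset _ _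
    · intro A hA hA'
      by_contra hnz
      apply hA'
      rw [Finset.mem_powerset] at hA
      have h1 := ((vec_ne_zero_iff hω).1 (left_ne_zero_of_mul hnz)).2
      have h2 := ((vec_ne_zero_iff hω).1 (right_ne_zero_of_mul hnz)).2
      have hex : ∀ C, ∃ b : Bool, ∀ i ∈ S C, sgn A i = sg b * s i := by
        intro C
        obtain ⟨x, hx⟩ := hne C
        obtain ⟨b, hb⟩ : ∃ b : Bool, sgn A x = sg b * s x := by
          rcases hs x with h | h <;> rcases sgn_eq_or A x with h' | h' <;> rw [h, h']
          exacts [⟨true, by simp [sg]⟩, ⟨false, by simp [sg]⟩, ⟨false, by simp [sg]⟩,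
            ⟨true, by simp [sg]⟩]
        refine ⟨b, ?_⟩
        have hT := hl C ((S C).filter fun i => sgn A i = sg b * s i) (Finset.filter_subset _ _)
          ⟨x, by simp [hx, hb]⟩ (by
            intro i hi
            rw [Finset.mem_filter] at hi
            have hin := (hcov i).2 ⟨C, hi.1⟩
            rw [Finset.mem_filter, Finset.mem_filter]
            refine ⟨⟨hSc C i hi.1, ?_⟩, ⟨hSd C i hi.1, ?_⟩⟩
            · by_cases h : c i = i
              · rw [h]; exact hi.2
              · rw [h1 i hin h, hi.2, show s (c i) = -s i from hc.alternates_parity _ i hi.1 h]; ring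
            · by_cases h : d i = i
              · rw [h]; exact hi.2
              · rw [h2 i hin h, hi.2, show s (d i) = -s i from hd.alternates_parity _ i hi.1 h]; ring)
        intro i hi
        rw [← hT] at hi
        exact (Finset.mem_filter.1 hi).2
      choose η hη using hex
      rw [Finset.mem_image]
      refine ⟨η, Finset.mem_univ _, ?_⟩
      ext i
      by_cases hi : i < n
      · obtain ⟨C, hC⟩ := (hcov i).1 hi
        rw [← sgn_eq_sgn_iff, hU η C i hC, hη C i hC]
      · have e1 : i ∉ A := fun h => hi (by simpa using hA h)
        have e2 : i ∉ U η := by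
          simp only [U, Finset.mem_biUnion, Finset.mem_univ, true_and, Finset.mem_filter,
            not_exists, not_and]
          exact fun C h => absurd ((hcov i).2 ⟨C, h⟩) hi
        simp [e1, e2]
  rw [hsum]
  simp only [hUprod]
  -- The sum over independent orientations of the curves is the product over the curves of the sums
  -- over their two orientations.
  rw [← Fintype.piFinset_univ, ← Finset.prod_univ_sum (fun _ : Q => (Finset.univ : Finset Bool))
    (fun C b => ∏ i ∈ S C, (orientWeight ω s c (sg b) i * orientWeight ω s d (sg b) i))]
  refine Finset.prod_congr rfl fun C _ => ?_
  rw [Fintype.sum_bool]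
  exact sum_orientWeight hω hq (hne C) (hc.nested (hSc C)) (hd.nested (hSd C))
    (hc.alternates_parity _) (hd.alternates_parity _) (fun i _ => hs i) (hl C)

/-! ### Components of the stacked picture and the pairing as a scalar product -/

section StackGraph

variable {t n : ℕ} (D₁ D₂ : MonicDiagram t n)

/-- The upper end of the `i`-th through strand. -/
noncomputable def MonicDiagram.top (D : MonicDiagram t n) (i : Fin t) : Fin n := (D.2 i).choose

theorem MonicDiagram.partner_inl_eq (D : MonicDiagram t n) (i : Fin t) :
    D.1.partner (Sum.inl i) = Sum.inr (D.top i) := (D.2 i).choose_spec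

theorem MonicDiagram.partner_top (D : MonicDiagram t n) (i : Fin t) :
    D.1.partner (Sum.inr (D.top i)) = Sum.inl i := by
  rw [← D.partner_inl_eq, D.1.partner_partner]

theorem MonicDiagram.mate_top (D : MonicDiagram t n) (i : Fin t) :
    D.1.mate (D.top i) = D.top i := Diagram.mate_of_inl (D.partner_top i)

theorem MonicDiagram.top_eq (D : MonicDiagram t n) {i : Fin t} {j : Fin n}
    (h : D.1.partner (Sum.inr j) = Sum.inl i) : D.top i = j := by
  have := D.partner_inl_eq i
  rw [← h, D.1.partner_partner] at this
  exact (Sum.inr.inj this).symm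

theorem MonicDiagram.exists_top_eq (D : MonicDiagram t n) {j : ℕ} (hj : j < n)
    (h : D.1.mate j = j) : ∃ i, (D.top i : ℕ) = j := by
  obtain ⟨k, hk⟩ := (D.1.mate_eq_self_iff ⟨j, hj⟩).1 h
  exact ⟨k, congrArg Fin.val (D.top_eq hk)⟩

/-- The middle point in which the arc through a point of the stacked picture ends. -/
noncomputable def toMiddle : Fin t ⊕ Fin n ⊕ Fin t → Fin n
  | Sum.inl i => D₂.top i
  | Sum.inr (Sum.inl j) => j
  | Sum.inr (Sum.inr k) => D₁.top k

/-- Pushing outer points along their arcs to the middle turns every edge into equality or an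
application of one of the two `mate` maps. This transfers connectivity of the graph to stability of
sets of middle points. -/
theorem toMiddle_of_adj {x y : Fin t ⊕ Fin n ⊕ Fin t}
    (h : (stack D₁.1.reflect D₂.1).Adj x y) (T : ℕ → Prop) (h₁ : ∀ i, T i → T (D₁.1.mate i))
    (h₂ : ∀ i, T i → T (D₂.1.mate i)) (hx : T (toMiddle D₁ D₂ x)) : T (toMiddle D₁ D₂ y) := by
  have lower : ∀ a : Fin t ⊕ Fin n, T (toMiddle D₁ D₂ (Sum.map id Sum.inl a)) →
      T (toMiddle D₁ D₂ (Sum.map id Sum.inl (D₂.1.partner a))) := by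
    rintro (i | j) ha
    · rw [D₂.partner_inl_eq]
      exact ha
    · rcases hp : D₂.1.partner (Sum.inr j) with k | k
      · simp only [Sum.map_inl, id_eq, toMiddle, D₂.top_eq hp]
        exact ha
      · have := h₂ _ ha
        simp only [Sum.map_inr, toMiddle, D₂.1.mate_of_inr hp] at this ⊢
        exact this
  have upper : ∀ b : Fin n ⊕ Fin t, T (toMiddle D₁ D₂ (Sum.inr b)) →
      T (toMiddle D₁ D₂ (Sum.inr (D₁.1.reflect.partner b))) := by
    rintro (j | k) hb
    · simp only [Diagram.reflect, Sum.swap_inl]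
      rcases hp : D₁.1.partner (Sum.inr j) with k | k
      · simp only [Sum.swap_inl, toMiddle, D₁.top_eq hp]
        exact hb
      · have := h₁ _ hb
        simp only [Sum.swap_inr, toMiddle, D₁.1.mate_of_inr hp] at this ⊢
        exact this
    · simp only [Diagram.reflect, Sum.swap_inr, D₁.partner_inl_eq]
      exact hb
  rw [stack, SimpleGraph.fromRel_adj] at h
  obtain ⟨_, (⟨a, rfl, rfl⟩ | ⟨b, rfl, rfl⟩) | (⟨a, rfl, rfl⟩ | ⟨b, rfl, rfl⟩)⟩ := h
  · exact lower a hx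
  · exact upper b hx
  · have := lower _ hx
    rwa [D₂.1.partner_partner] at this
  · have := upper _ hx
    rwa [D₁.1.reflect.partner_partner] at this

theorem toMiddle_of_reachable {x y : Fin t ⊕ Fin n ⊕ Fin t}
    (h : (stack D₁.1.reflect D₂.1).Reachable x y) (T : ℕ → Prop)
    (h₁ : ∀ i, T i → T (D₁.1.mate i)) (h₂ : ∀ i, T i → T (D₂.1.mate i))
    (hx : T (toMiddle D₁ D₂ x)) : T (toMiddle D₁ D₂ y) := by
  rw [SimpleGraph.reachable_iff_reflTransGen] at h
  induction h with
  | refl => exact hx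
  | tail _ hadj ih => exact toMiddle_of_adj D₁ D₂ hadj T h₁ h₂ ih

theorem reachable_lower (a : Fin t ⊕ Fin n) : (stack D₁.1.reflect D₂.1).Reachable
    (Sum.map id Sum.inl a) (Sum.map id Sum.inl (D₂.1.partner a)) := by
  apply SimpleGraph.Adj.reachable
  rw [stack, SimpleGraph.fromRel_adj]
  refine ⟨fun h => D₂.1.partner_ne a ?_, Or.inl (Or.inl ⟨a, rfl, rfl⟩)⟩
  exact (Sum.map_injective.2 ⟨Function.injective_id, Sum.inl_injective⟩ h).symm

theorem reachable_upper (b : Fin n ⊕ Fin t) : (stack D₁.1.reflect D₂.1).Reachable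
    (Sum.inr b) (Sum.inr (D₁.1.reflect.partner b)) := by
  apply SimpleGraph.Adj.reachable
  rw [stack, SimpleGraph.fromRel_adj]
  exact ⟨fun h => D₁.1.reflect.partner_ne b (Sum.inr.inj h).symm, Or.inl (Or.inr ⟨b, rfl, rfl⟩)⟩

theorem reachable_toMiddle (x : Fin t ⊕ Fin n ⊕ Fin t) : (stack D₁.1.reflect D₂.1).Reachable x
    (Sum.inr (Sum.inl (toMiddle D₁ D₂ x))) := by
  rcases x with i | j | k
  · have := reachable_lower D₁ D₂ (Sum.inl i)
    rwa [D₂.partner_inl_eq] at this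
  · exact SimpleGraph.Reachable.refl _
  · have := reachable_upper D₁ D₂ (Sum.inr k)
    simpa only [Diagram.reflect, Sum.swap_inr, D₁.partner_inl_eq, toMiddle] using this

theorem reachable_mate_right (i j : Fin n) (h : D₂.1.mate i = j) :
    (stack D₁.1.reflect D₂.1).Reachable (Sum.inr (Sum.inl i)) (Sum.inr (Sum.inl j)) := by
  rcases hp : D₂.1.partner (Sum.inr i) with k | k
  · rw [Diagram.mate_of_inl hp, Fin.val_inj] at h
    rw [h]
  · rw [Diagram.mate_of_inr hp, Fin.val_inj] at h
    have := reachable_lower D₁ D₂ (Sum.inr i)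
    rwa [hp, h] at this

theorem reachable_mate_left (i j : Fin n) (h : D₁.1.mate i = j) :
    (stack D₁.1.reflect D₂.1).Reachable (Sum.inr (Sum.inl i)) (Sum.inr (Sum.inl j)) := by
  rcases hp : D₁.1.partner (Sum.inr i) with k | k
  · rw [Diagram.mate_of_inl hp, Fin.val_inj] at h
    rw [h]
  · rw [Diagram.mate_of_inr hp, Fin.val_inj] at h
    have := reachable_upper D₁ D₂ (Sum.inl i)
    simpa only [Diagram.reflect, Sum.swap_inl, hp, h, Sum.swap_inr] using this

open Classical in
/-- The middle points of a component of the stacked picture. -/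
noncomputable def middlePoints (C : (stack D₁.1.reflect D₂.1).ConnectedComponent) : Finset ℕ :=
  (Finset.univ.filter fun j : Fin n =>
    (stack D₁.1.reflect D₂.1).connectedComponentMk (Sum.inr (Sum.inl j)) = C).map Fin.valEmbedding

variable {D₁ D₂} in
theorem mem_middlePoints {C : (stack D₁.1.reflect D₂.1).ConnectedComponent} {i : ℕ} :
    i ∈ middlePoints D₁ D₂ C ↔ ∃ j : Fin n,
      (stack D₁.1.reflect D₂.1).connectedComponentMk (Sum.inr (Sum.inl j)) = C ∧ (j : ℕ) = i := by
  simp [middlePoints]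

theorem toMiddle_mem_middlePoints (x : Fin t ⊕ Fin n ⊕ Fin t) :
    (toMiddle D₁ D₂ x : ℕ) ∈
      middlePoints D₁ D₂ ((stack D₁.1.reflect D₂.1).connectedComponentMk x) :=
  mem_middlePoints.2 ⟨_, (SimpleGraph.ConnectedComponent.sound
    (reachable_toMiddle D₁ D₂ x)).symm, rfl⟩

theorem mate_left_mem_middlePoints (C : (stack D₁.1.reflect D₂.1).ConnectedComponent) (i : ℕ)
    (hi : i ∈ middlePoints D₁ D₂ C) : D₁.1.mate i ∈ middlePoints D₁ D₂ C := by
  obtain ⟨j, rfl, rfl⟩ := mem_middlePoints.1 hi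
  refine mem_middlePoints.2 ⟨⟨D₁.1.mate j, D₁.2.isLink.lt j.2⟩, ?_, rfl⟩
  exact (SimpleGraph.ConnectedComponent.sound (reachable_mate_left D₁ D₂ j _ rfl)).symm

theorem mate_right_mem_middlePoints (C : (stack D₁.1.reflect D₂.1).ConnectedComponent) (i : ℕ)
    (hi : i ∈ middlePoints D₁ D₂ C) : D₂.1.mate i ∈ middlePoints D₁ D₂ C := by
  obtain ⟨j, rfl, rfl⟩ := mem_middlePoints.1 hi
  refine mem_middlePoints.2 ⟨⟨D₂.1.mate j, D₂.2.isLink.lt j.2⟩, ?_, rfl⟩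
  exact (SimpleGraph.ConnectedComponent.sound (reachable_mate_right D₁ D₂ j _ rfl)).symm

/-- A non-empty subset stable under both `mate` maps contains, by `toMiddle_of_reachable`,
everything reachable from one of its points. -/
theorem linked_middlePoints (C : (stack D₁.1.reflect D₂.1).ConnectedComponent) :
    Linked (middlePoints D₁ D₂ C) D₁.1.matePerm D₂.1.matePerm := by
  rintro T hT ⟨x, hx⟩ hst
  refine Finset.Subset.antisymm hT fun i hi => ?_
  obtain ⟨j, hj, rfl⟩ := mem_middlePoints.1 hi
  obtain ⟨k, hk, rfl⟩ := mem_middlePoints.1 (hT hx)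
  have hr := SimpleGraph.ConnectedComponent.exact (hk.trans hj.symm)
  exact toMiddle_of_reachable D₁ D₂ hr (· ∈ T) (fun i hi => (hst i hi).1)
    (fun i hi => (hst i hi).2) hx

/-- Lower points of the picture correspond to the fixed points of `D₂.mate` in the middle row, upper
points to those of `D₁.mate`. -/
theorem compIsMonic_iff : CompIsMonic D₁.1.reflect D₂.1 ↔
    ∀ C, (fix (middlePoints D₁ D₂ C) D₂.1.matePerm).Nonempty →
      (fix (middlePoints D₁ D₂ C) D₁.1.matePerm).Nonempty := by
  constructor
  · rintro h C ⟨x, hx⟩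
    rw [mem_fix] at hx
    obtain ⟨j, hj, rfl⟩ := mem_middlePoints.1 hx.1
    obtain ⟨i, hi⟩ := D₂.exists_top_eq j.2 hx.2
    obtain ⟨k, hk⟩ := h i
    refine ⟨D₁.top k, mem_fix.2 ⟨?_, D₁.mate_top k⟩⟩
    have h1 := toMiddle_mem_middlePoints D₁ D₂ (Sum.inr (Sum.inr k))
    rw [← SimpleGraph.ConnectedComponent.sound hk,
      SimpleGraph.ConnectedComponent.sound (reachable_toMiddle D₁ D₂ (Sum.inl i))] at h1
    have h2 : toMiddle D₁ D₂ (Sum.inl i) = j := Fin.ext hi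
    rw [h2, hj] at h1
    exact h1
  · intro h i
    obtain ⟨x, hx⟩ := h ((stack D₁.1.reflect D₂.1).connectedComponentMk (Sum.inl i))
      ⟨D₂.top i, mem_fix.2 ⟨toMiddle_mem_middlePoints D₁ D₂ (Sum.inl i), D₂.mate_top i⟩⟩
    rw [mem_fix] at hx
    obtain ⟨j, hj, rfl⟩ := mem_middlePoints.1 hx.1
    obtain ⟨k, hk⟩ := D₁.exists_top_eq j.2 hx.2
    refine ⟨k, ?_⟩
    have h1 := reachable_toMiddle D₁ D₂ (Sum.inr (Sum.inr k))
    have h2 : toMiddle D₁ D₂ (Sum.inr (Sum.inr k)) = j := Fin.ext hk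
    rw [h2] at h1
    exact (SimpleGraph.ConnectedComponent.exact hj).symm.trans h1.symm

/-- A component reaches the lower or upper row exactly through the end of a through strand in its
middle points. -/
theorem loop_iff (C : (stack D₁.1.reflect D₂.1).ConnectedComponent) :
    (∀ x ∈ C.supp, ∃ j : Fin n, x = Sum.inr (Sum.inl j)) ↔
      fix (middlePoints D₁ D₂ C) D₁.1.matePerm = ∅ ∧
        fix (middlePoints D₁ D₂ C) D₂.1.matePerm = ∅ := by
  constructor
  · intro h
    constructor <;> rw [← Finset.not_nonempty_iff_eq_empty] <;> rintro ⟨x, hx⟩ <;>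
      rw [mem_fix] at hx <;> obtain ⟨j, hj, rfl⟩ := mem_middlePoints.1 hx.1
    · obtain ⟨k, hk⟩ := D₁.exists_top_eq j.2 hx.2
      have h1 := reachable_toMiddle D₁ D₂ (Sum.inr (Sum.inr k))
      have h2 : toMiddle D₁ D₂ (Sum.inr (Sum.inr k)) = j := Fin.ext hk
      rw [h2] at h1
      obtain ⟨m, hm⟩ := h (Sum.inr (Sum.inr k))
        ((SimpleGraph.ConnectedComponent.sound h1).trans hj)
      simp at hm
    · obtain ⟨k, hk⟩ := D₂.exists_top_eq j.2 hx.2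
      have h1 := reachable_toMiddle D₁ D₂ (Sum.inl k)
      have h2 : toMiddle D₁ D₂ (Sum.inl k) = j := Fin.ext hk
      rw [h2] at h1
      obtain ⟨m, hm⟩ := h (Sum.inl k) ((SimpleGraph.ConnectedComponent.sound h1).trans hj)
      simp at hm
  · rintro ⟨h1, h2⟩ x rfl
    rcases x with i | j | k
    · have : (D₂.top i : ℕ) ∈ (∅ : Finset ℕ) := by
        rw [← h2]
        exact mem_fix.2 ⟨toMiddle_mem_middlePoints D₁ D₂ (Sum.inl i), D₂.mate_top i⟩
      simp at this
    · exact ⟨j, rfl⟩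
    · have : (D₁.top k : ℕ) ∈ (∅ : Finset ℕ) := by
        rw [← h1]
        exact mem_fix.2 ⟨toMiddle_mem_middlePoints D₁ D₂ (Sum.inr (Sum.inr k)), D₁.mate_top k⟩
      simp at this

/-- The pairing of two monic diagrams is the scalar product of their vectors. -/
theorem pairing_eq_dot {ω q : ℂ} (hω : ω ≠ 0) (hq : ω ^ 4 = -q) :
    pairing q D₁ D₂ = dot n (vec ω n D₁.1.matePerm ∅) (vec ω n D₂.1.matePerm ∅) := by
  classical
  have : Fintype (stack D₁.1.reflect D₂.1).ConnectedComponent := Fintype.ofFinite _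
  set c := D₁.1.matePerm with hc
  set d := D₂.1.matePerm with hd
  set S := middlePoints D₁ D₂ with hS
  have hcov : ∀ i, i < n ↔ ∃ C, i ∈ S C := by
    intro i
    constructor
    · intro hi
      exact ⟨_, mem_middlePoints.2 ⟨⟨i, hi⟩, rfl, rfl⟩⟩
    · rintro ⟨C, hC⟩
      obtain ⟨j, -, rfl⟩ := mem_middlePoints.1 hC
      exact j.2
  have hdis : ∀ C C' i, i ∈ S C → i ∈ S C' → C = C' := by
    intro C C' i h h'
    obtain ⟨j, rfl, rfl⟩ := mem_middlePoints.1 h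
    obtain ⟨k, rfl, hk⟩ := mem_middlePoints.1 h'
    rw [Fin.ext hk]
  have hne : ∀ C, (S C).Nonempty := by
    intro C
    induction C using SimpleGraph.ConnectedComponent.ind with
    | h x => exact ⟨_, toMiddle_mem_middlePoints D₁ D₂ x⟩
  have hSc := mate_left_mem_middlePoints D₁ D₂
  have hSd := mate_right_mem_middlePoints D₁ D₂
  have hl := linked_middlePoints D₁ D₂
  rw [dot_vec_vec hω hq D₁.2.isLink D₂.2.isLink S hcov hdis hne hSc hSd hl]
  have hle : ∀ C, (fix (S C) c).card + (fix (S C) d).card ≤ 2 := fun C =>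
    (Linked.turning_cases (S C).card le_rfl (hne C) (D₁.2.isLink.nested (hSc C))
      (D₂.2.isLink.nested (hSd C)) (D₁.2.isLink.alternates_parity _)
      (D₂.2.isLink.alternates_parity _) (fun i _ => neg_one_pow_eq_or ℤ i) (hl C)).1
  have hcount : ∀ c : Equiv.Perm ℕ, IsLink n t c → ∑ C, (fix (S C) c).card = t := by
    intro c hc
    have h1 : (fix (Finset.range n) c).card = t := by exact_mod_cast hc.card_fix
    refine Eq.trans ?_ h1
    rw [← Finset.card_biUnion]
    · congr 1
      ext i
      simp only [Finset.mem_biUnion, Finset.mem_univ, true_and, mem_fix, Finset.mem_range, hcov]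
      exact ⟨fun ⟨C, h, h'⟩ => ⟨⟨C, h⟩, h'⟩, fun ⟨⟨C, h⟩, h'⟩ => ⟨C, h, h'⟩⟩
    · intro C _ C' _ hCC
      rw [Function.onFun, Finset.disjoint_left]
      exact fun i hi hi' => hCC (hdis C C' i (mem_fix.1 hi).1 (mem_fix.1 hi').1)
  unfold pairing
  split_ifs with hm
  · rw [compIsMonic_iff] at hm
    have hdc : ∀ C, (fix (S C) d).card ≤ (fix (S C) c).card := by
      intro C
      have h1 := hle C
      rcases Finset.eq_empty_or_nonempty (fix (S C) d) with h | h
      · rw [h]; simp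
      · have h2 := (hm C h).card_pos
        have h3 := h.card_pos
        change 0 < (fix (S C) c).card at h2
        omega
    -- Both totals equal `t`, so the componentwise inequalities are equalities; every component then
    -- contributes a loop factor or 1.
    have heq : ∀ C, (fix (S C) c).card = (fix (S C) d).card := by
      have := (Finset.sum_eq_sum_iff_of_le (s := Finset.univ) fun C _ => hdc C).1
        ((hcount d D₂.2.isLink).trans (hcount c D₁.2.isLink).symm)
      exact fun C => (this C (Finset.mem_univ C)).symm
    rw [Finset.prod_congr rfl fun C _ => by rw [if_pos (heq C)], Finset.prod_ite, Finset.prod_const, Finset.prod_const_one, mul_one, numLoops]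
    congr 1
    rw [Nat.card_eq_fintype_card, Fintype.card_subtype]
    congr 1
    ext C
    simp only [Finset.mem_filter, Finset.mem_univ, true_and]
    exact loop_iff D₁ D₂ C
  · rw [compIsMonic_iff] at hm
    push Not at hm
    obtain ⟨C, h1, h2⟩ := hm
    symm
    -- A component with ends of `D₂` only contributes 0.
    refine Finset.prod_eq_zero (Finset.mem_univ C) ?_
    change fix (S C) c = ∅ at h2
    rw [if_neg (fun h => h1.ne_empty h.2), if_neg]
    rw [h2, Finset.card_empty]
    exact h1.card_pos.ne

end StackGraph
-- The quantum sl₂ operator on diagram vectors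
/-- The state `A` with the sign at `j` reversed. -/
def toggle (A : Finset ℕ) (j : ℕ) : Finset ℕ := symmDiff A {j}

theorem mem_toggle {A : Finset ℕ} {i j : ℕ} : i ∈ toggle A j ↔ ((i ∈ A) ↔ i ≠ j) := by
  simp only [toggle, Finset.mem_symmDiff, Finset.mem_singleton]
  tauto

theorem toggle_toggle (A : Finset ℕ) (j : ℕ) : toggle (toggle A j) j = A := by
  ext i; simp only [mem_toggle]; tauto

theorem toggle_empty (j : ℕ) : toggle ∅ j = {j} := by
  ext i; simp [mem_toggle]

theorem sgn_toggle_self (A : Finset ℕ) (j : ℕ) : sgn (toggle A j) j = -sgn A j := by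
  by_cases h : j ∈ A <;> simp [sgn, mem_toggle, h]

theorem sgn_toggle_of_ne (A : Finset ℕ) {i j : ℕ} (h : i ≠ j) : sgn (toggle A j) i = sgn A i := by
  simp [sgn, mem_toggle, h]

/-- The exponent of the coproduct weight at the site `j`: the total sign to its right minus the
total sign to its left. -/
def balance (S A : Finset ℕ) (j : ℕ) : ℤ := ∑ k ∈ S, Int.sign ((k : ℤ) - j) * sgn A k

theorem balance_toggle (S A : Finset ℕ) (j : ℕ) : balance S (toggle A j) j = balance S A j := by
  refine Finset.sum_congr rfl fun k _ => ?_
  by_cases h : k = j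
  · simp [h]
  · rw [sgn_toggle_of_ne A h]

/-- The sum of the raising and the lowering operator of quantum `sl₂` on the tensor power. -/
noncomputable def flipSum (ρ : ℂ) (n : ℕ) (f : Finset ℕ → ℂ) (A : Finset ℕ) : ℂ :=
  ∑ j ∈ Finset.range n, ρ ^ balance (Finset.range n) A j * f (toggle A j)

/-- Toggling site `j` is an involution on states, and the coefficient at `j` does not depend on the
sign at `j`; so the operator is a symmetric matrix. -/
theorem dot_flipSum (ρ : ℂ) (n : ℕ) (f g : Finset ℕ → ℂ) :
    dot n (flipSum ρ n f) g = dot n f (flipSum ρ n g) := by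
  simp only [dot, flipSum, Finset.sum_mul, Finset.mul_sum]
  rw [Finset.sum_comm, Finset.sum_comm (s := (Finset.range n).powerset)]
  refine Finset.sum_congr rfl fun j hj => ?_
  have hm : ∀ A ∈ (Finset.range n).powerset, toggle A j ∈ (Finset.range n).powerset := by
    intro A hA
    rw [Finset.mem_powerset] at hA ⊢
    intro i hi
    rw [mem_toggle] at hi
    by_cases h : i = j
    · rwa [h]
    · exact hA (hi.2 h)
  refine Finset.sum_nbij' (fun A => toggle A j) (fun A => toggle A j) hm hm
    (fun A _ => toggle_toggle A j) (fun A _ => toggle_toggle A j) fun A _ => ?_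
  rw [balance_toggle, toggle_toggle]
  ring

theorem dot_comm (n : ℕ) (f g : Finset ℕ → ℂ) : dot n f g = dot n g f := by
  simp only [dot, mul_comm]

theorem dot_add_right (n : ℕ) (f g h : Finset ℕ → ℂ) : dot n f (g + h) = dot n f g + dot n f h := by
  simp only [dot, Pi.add_apply, mul_add, Finset.sum_add_distrib]

theorem dot_smul_right (n : ℕ) (a : ℂ) (f g : Finset ℕ → ℂ) :
    dot n f (a • g) = a * dot n f g := by
  simp only [dot, Pi.smul_apply, smul_eq_mul, Finset.mul_sum, mul_left_comm]

theorem dot_sum_right {ι : Type*} (n : ℕ) (s : Finset ι) (f : Finset ℕ → ℂ)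
    (g : ι → Finset ℕ → ℂ) : dot n f (∑ i ∈ s, g i) = ∑ i ∈ s, dot n f (g i) := by
  simp only [dot, Finset.sum_apply, Finset.mul_sum]
  exact Finset.sum_comm

theorem dot_add_left (n : ℕ) (f g h : Finset ℕ → ℂ) : dot n (f + g) h = dot n f h + dot n g h := by
  rw [dot_comm, dot_add_right, dot_comm n h, dot_comm n h]

theorem dot_smul_left (n : ℕ) (a : ℂ) (f g : Finset ℕ → ℂ) :
    dot n (a • f) g = a * dot n f g := by
  rw [dot_comm, dot_smul_right, dot_comm]

theorem dot_sum_left {ι : Type*} (n : ℕ) (s : Finset ι) (f : Finset ℕ → ℂ)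
    (g : ι → Finset ℕ → ℂ) : dot n (∑ i ∈ s, g i) f = ∑ i ∈ s, dot n (g i) f := by
  rw [dot_comm, dot_sum_right]
  exact Finset.sum_congr rfl fun i _ => dot_comm _ _ _

theorem flipSum_smul (ρ : ℂ) (n : ℕ) (a : ℂ) (f : Finset ℕ → ℂ) :
    flipSum ρ n (a • f) = a • flipSum ρ n f := by
  funext A
  simp only [flipSum, Pi.smul_apply, smul_eq_mul, Finset.mul_sum, mul_left_comm]

theorem flipSum_sum {ι : Type*} (ρ : ℂ) (n : ℕ) (s : Finset ι) (g : ι → Finset ℕ → ℂ) :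
    flipSum ρ n (∑ i ∈ s, g i) = ∑ i ∈ s, flipSum ρ n (g i) := by
  funext A
  simp only [flipSum, Finset.sum_apply, Finset.mul_sum]
  exact Finset.sum_comm

theorem prod_eq_mul_mul_erase {n j k : ℕ} (hj : j < n) (hk : k < n) (hjk : j ≠ k) (f : ℕ → ℂ) :
    ∏ i ∈ Finset.range n, f i = f j * f k * ∏ i ∈ ((Finset.range n).erase j).erase k, f i := by
  rw [mul_assoc, Finset.mul_prod_erase _ _ (by simp [hk, hjk.symm]),
    Finset.mul_prod_erase _ _ (by simp [hj])]

theorem siteWeight_congr {ω : ℂ} {c c' : ℕ → ℕ} {B B' A A' : Finset ℕ} {i : ℕ} (hc : c i = c' i)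
    (hB : c i = i → (i ∈ B ↔ i ∈ B')) (hA : i ∈ A ↔ i ∈ A') (hA' : c i ∈ A ↔ c i ∈ A') :
    siteWeight ω c B A i = siteWeight ω c' B' A' i := by
  unfold siteWeight
  rw [← hc, side_congr hc]
  by_cases h : c i = i
  · simp only [h, if_true, hA, hB h]
  · simp only [h, if_false, hA, hA', sgn_eq_sgn_iff.2 hA]

section Link

variable {ω ρ q : ℂ} {n : ℕ} {t : ℤ} {c : Equiv.Perm ℕ} {A B : Finset ℕ}

theorem IsLink.sum_arcs_eq_zero (hc : IsLink n t c) (hA : ∀ i < n, c i ≠ i → sgn A (c i) = -sgn A i)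
    {S : Finset ℕ} (hS : S ⊆ Finset.range n) (hcS : ∀ i ∈ S, c i ∈ S) (hne : ∀ i ∈ S, c i ≠ i) :
    ∑ k ∈ S, sgn A k = 0 := by
  refine Finset.sum_involution (fun k _ => c k) (fun k hk => ?_) (fun k hk _ => hne k hk) hcS
    fun k _ => hc.invol k
  rw [hA k (by simpa using hS hk) (hne k hk)]
  ring

/-- Flipping an end of an arc with equal signs σ yields one of its two orientations, with weights
ω^{-2σ} and ω^{2σ}. The powers of `ρ` differ by ρ^{2σ}, so the terms cancel because ρ^2 = -ω^4. If
the signs differ, both flips give 0. -/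
theorem IsLink.flip_arc_cancel (hc : IsLink n t c) (hω : ω ≠ 0) (hρ : ρ ^ 2 = -ω ^ 4) {j : ℕ}
    (hj : j < n) (hlt : j < c j) :
    ρ ^ balance (Finset.range n) A j * vec ω n c B (toggle A j) +
      ρ ^ balance (Finset.range n) A (c j) * vec ω n c B (toggle A (c j)) = 0 := by
  have hρ0 : ρ ≠ 0 := by
    rintro rfl
    have : ω ^ 4 ≠ 0 := pow_ne_zero _ hω
    simp at hρ
    exact hω hρ
  have hj' := hc.lt hj
  have hcj := hc.invol j
  by_cases hs : sgn A (c j) = sgn A j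
  swap
  · have h1 : sgn A (c j) = -sgn A j := by
      rcases sgn_eq_or A j with h | h <;> rcases sgn_eq_or A (c j) with h' | h' <;>
        rw [h, h'] at hs ⊢ <;> simp at hs ⊢
    have h2 : sgn A j ≠ 0 := by rcases sgn_eq_or A j with h | h <;> rw [h] <;> simp
    have e1 : vec ω n c B (toggle A j) = 0 := by
      by_contra h
      have := ((vec_ne_zero_iff hω).1 h).2 j hj hlt.ne'
      rw [sgn_toggle_self, sgn_toggle_of_ne _ hlt.ne', h1] at this
      omega
    have e2 : vec ω n c B (toggle A (c j)) = 0 := by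
      by_contra h
      have := ((vec_ne_zero_iff hω).1 h).2 j hj hlt.ne'
      rw [sgn_toggle_self, sgn_toggle_of_ne _ hlt.ne, h1] at this
      omega
    rw [e1, e2]
    ring
  have hrest : ∀ i ∈ ((Finset.range n).erase j).erase (c j),
      siteWeight ω c B (toggle A j) i = siteWeight ω c B (toggle A (c j)) i := by
    intro i hi
    simp only [Finset.mem_erase, Finset.mem_range] at hi
    have h1 : c i ≠ j := fun h => hi.1 (by rw [← h, hc.invol])
    have h2 : c i ≠ c j := fun h => hi.2.1 (c.injective h)
    refine siteWeight_congr rfl (fun _ => Iff.rfl) ?_ ?_ <;>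
      simp [mem_toggle, hi.1, hi.2.1, h1, h2]
  have site : ∀ (k : ℕ) (C : Finset ℕ), c k ≠ k → sgn C (c k) = -sgn C k →
      siteWeight ω c B C k = ω ^ (sgn C k * side c k) := by
    intro k C hk h
    unfold siteWeight
    rw [if_neg hk, if_neg]
    rw [← sgn_eq_sgn_iff, h]
    rcases sgn_eq_or C k with h' | h' <;> rw [h'] <;> simp
  have hcjne : c (c j) ≠ c j := by rw [hcj]; exact hlt.ne
  have w1 := site j (toggle A j) hlt.ne' (by
    rw [sgn_toggle_self, sgn_toggle_of_ne _ hlt.ne', hs, neg_neg])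
  have w2 := site (c j) (toggle A j) hcjne (by
    rw [hcj, sgn_toggle_self, sgn_toggle_of_ne _ hlt.ne', hs])
  have w3 := site j (toggle A (c j)) hlt.ne' (by
    rw [sgn_toggle_self, sgn_toggle_of_ne _ hlt.ne, hs])
  have w4 := site (c j) (toggle A (c j)) hcjne (by
    rw [hcj, sgn_toggle_self, sgn_toggle_of_ne _ hlt.ne, hs, neg_neg])
  rw [sgn_toggle_self, side_of_lt hlt] at w1
  rw [sgn_toggle_of_ne _ hlt.ne', hs, side_of_gt (by rw [hcj]; exact hlt)] at w2
  rw [sgn_toggle_of_ne _ hlt.ne, side_of_lt hlt] at w3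
  rw [sgn_toggle_self, hs, side_of_gt (by rw [hcj]; exact hlt)] at w4
  unfold vec
  rw [prod_eq_mul_mul_erase hj hj' hlt.ne, prod_eq_mul_mul_erase hj hj' hlt.ne
    (siteWeight ω c B (toggle A (c j))), Finset.prod_congr rfl hrest, w1, w2, w3, w4]
  by_cases hz : ∏ i ∈ ((Finset.range n).erase j).erase (c j),
      siteWeight ω c B (toggle A (c j)) i = 0
  · rw [hz]; ring
  have hvec : vec ω n c B (toggle A (c j)) ≠ 0 := by
    rw [vec, prod_eq_mul_mul_erase hj hj' hlt.ne, w3, w4]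
    exact mul_ne_zero (mul_ne_zero (zpow_ne_zero _ hω) (zpow_ne_zero _ hω)) hz
  -- The sites beneath the arc are paired with opposite signs, so only the two ends distinguish the
  -- balances at `j` and `c j`.
  have hinner : ∑ k ∈ Finset.Ioo j (c j), sgn A k = 0 := by
    have h0 : ∑ k ∈ Finset.Ioo j (c j), sgn (toggle A (c j)) k = 0 := by
      refine hc.sum_arcs_eq_zero ((vec_ne_zero_iff hω).1 hvec).2 ?_ ?_ ?_
      · intro k hk
        rw [Finset.mem_Ioo] at hk
        rw [Finset.mem_range]
        omega
      · intro k hk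
        rw [Finset.mem_Ioo] at hk ⊢
        exact (hc.nest j k hk.1 hk.2).2
      · intro k hk
        rw [Finset.mem_Ioo] at hk
        exact (hc.nest j k hk.1 hk.2).1
    rw [← h0]
    refine Finset.sum_congr rfl fun k hk => ?_
    rw [Finset.mem_Ioo] at hk
    rw [sgn_toggle_of_ne _ hk.2.ne]
  have hbal : balance (Finset.range n) A j = balance (Finset.range n) A (c j) + 2 * sgn A j := by
    have hpt : ∀ k ∈ Finset.range n, Int.sign ((k : ℤ) - j) * sgn A k =
        Int.sign ((k : ℤ) - (c j : ℕ)) * sgn A k + ((if k = j then sgn A k else 0) +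
          ((if k = c j then sgn A k else 0) +
            2 * if k ∈ Finset.Ioo j (c j) then sgn A k else 0)) := by
      intro k _
      rcases lt_trichotomy k j with h | h | h
      · rw [Int.sign_eq_neg_one_of_neg (by omega), Int.sign_eq_neg_one_of_neg (by omega),
          if_neg (by omega), if_neg (by omega), if_neg (by rw [Finset.mem_Ioo]; omega)]
        ring
      · rw [Int.sign_eq_neg_one_of_neg (a := (k : ℤ) - (c j : ℕ)) (by omega), if_pos h,
          if_neg (by omega), if_neg (by rw [Finset.mem_Ioo]; omega), h]
        simp
      rcases lt_trichotomy k (c j) with h' | h' | h'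
      · rw [Int.sign_eq_one_of_pos (by omega), Int.sign_eq_neg_one_of_neg (by omega),
          if_neg (by omega), if_neg (by omega), if_pos (by rw [Finset.mem_Ioo]; omega)]
        ring
      · rw [Int.sign_eq_one_of_pos (a := (k : ℤ) - j) (by omega), if_neg (by omega), if_pos h',
          if_neg (by rw [Finset.mem_Ioo]; omega), h']
        simp
      · rw [Int.sign_eq_one_of_pos (by omega), Int.sign_eq_one_of_pos (by omega),
          if_neg (by omega), if_neg (by omega), if_neg (by rw [Finset.mem_Ioo]; omega)]
        ring
    have hsub : (Finset.range n).filter (· ∈ Finset.Ioo j (c j)) = Finset.Ioo j (c j) := by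
      ext k
      simp only [Finset.mem_filter, Finset.mem_range, Finset.mem_Ioo]
      omega
    unfold balance
    rw [Finset.sum_congr rfl hpt, Finset.sum_add_distrib, Finset.sum_add_distrib,
      Finset.sum_add_distrib, Finset.sum_ite_eq', Finset.sum_ite_eq', ← Finset.mul_sum,
      ← Finset.sum_filter, hsub, hinner, if_pos (by simp [hj]), if_pos (by simp [hj']), hs]
    ring
  rw [hbal, zpow_add₀ hρ0]
  generalize ∏ i ∈ ((Finset.range n).erase j).erase (c j), siteWeight ω c B (toggle A (c j)) i = P
  have hz1 : ρ ^ (2 * sgn A j) * (ω ^ (-sgn A j * 1) * ω ^ (sgn A j * -1)) +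
      ω ^ (sgn A j * 1) * ω ^ (-sgn A j * -1) = 0 := by
    rcases sgn_eq_or A j with h | h <;> rw [h]
    · norm_num
      norm_cast
      rw [hρ]
      field_simp
      ring
    · norm_num
      rw [hρ]
      field_simp
      ring
  linear_combination ρ ^ balance (Finset.range n) A (c j) * P * hz1

theorem vec_toggle {j : ℕ} (hj : c j = j) :
    vec ω n c B (toggle A j) = vec ω n c (toggle B j) A := by
  refine Finset.prod_congr rfl fun i _ => ?_
  unfold siteWeight
  by_cases h : c i = i
  · rw [if_pos h, if_pos h]
    congr 1
    simp only [mem_toggle, eq_iff_iff]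
    tauto
  · have h1 : i ≠ j := fun h' => h (by rw [h', hj])
    have h2 : c i ≠ j := fun h' => h1 (c.injective (h'.trans hj.symm))
    have h3 : sgn (toggle A j) i = sgn A i := sgn_toggle_of_ne A h1
    simp only [if_neg h, mem_toggle, h1, h2, ne_eq, not_false_eq_true, iff_true, h3]

/-- No arc passes over the fixed point `j`, so both ends of an arc lie on the same side of it and
cancel. Only the through strands count. -/
theorem IsLink.balance_eq (hc : IsLink n t c) (hω : ω ≠ 0) {j : ℕ} (hj : c j = j)
    (hv : vec ω n c (toggle B j) A ≠ 0) :
    balance (Finset.range n) A j = balance (fix (Finset.range n) c) B j := by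
  obtain ⟨h1, h2⟩ := (vec_ne_zero_iff hω).1 hv
  unfold balance
  rw [← Finset.sum_filter_add_sum_filter_not (Finset.range n) (fun i => c i = i)]
  have hz : ∑ k ∈ (Finset.range n).filter (fun i => ¬ c i = i),
      Int.sign ((k : ℤ) - j) * sgn A k = 0 := by
    refine Finset.sum_involution (fun k _ => c k) (fun k hk => ?_) (fun k hk _ => ?_)
      (fun k hk => ?_) fun k _ => hc.invol k
    all_goals simp only [Finset.mem_filter, Finset.mem_range] at hk ⊢
    · rw [h2 k hk.1 hk.2]
      have hkj : k ≠ j := fun h => hk.2 (by rw [h, hj])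
      have hkj' : c k ≠ j := fun h => hkj (c.injective (h.trans hj.symm))
      have n1 := hc.nest k j
      have n2 := hc.nest (c k) j
      rw [hc.invol] at n2
      have : Int.sign (((c k : ℕ) : ℤ) - j) = Int.sign ((k : ℤ) - j) := by
        rcases lt_or_gt_of_ne hkj with h | h
        · have : c k < j := by
            by_contra h'
            exact (n1 h (by omega)).1 hj
          rw [Int.sign_eq_neg_one_of_neg (by omega), Int.sign_eq_neg_one_of_neg (by omega)]
        · have : j < c k := by
            by_contra h'
            exact (n2 (by omega) h).1 hj
          rw [Int.sign_eq_one_of_pos (by omega), Int.sign_eq_one_of_pos (by omega)]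
      rw [this]
      ring
    · exact hk.2
    · exact ⟨hc.lt hk.1, by rw [hc.invol]; exact fun h => hk.2 h.symm⟩
  rw [hz, add_zero, fix]
  refine Finset.sum_congr rfl fun k hk => ?_
  simp only [Finset.mem_filter, Finset.mem_range] at hk
  by_cases h : k = j
  · simp [h]
  · rw [h1 k hk.1 hk.2, sgn_toggle_of_ne _ h]

/-- The operator `flipSum` reverses the signs of the through strands. -/
theorem IsLink.flipSum_vec (hc : IsLink n t c) (hω : ω ≠ 0) (hρ : ρ ^ 2 = -ω ^ 4) :
    flipSum ρ n (vec ω n c B) = ∑ j ∈ fix (Finset.range n) c,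
      ρ ^ balance (fix (Finset.range n) c) B j • vec ω n c (toggle B j) := by
  funext A
  rw [flipSum, ← Finset.sum_filter_add_sum_filter_not (Finset.range n) (fun i => c i = i)]
  have hz : ∑ j ∈ (Finset.range n).filter (fun i => ¬ c i = i),
      ρ ^ balance (Finset.range n) A j * vec ω n c B (toggle A j) = 0 := by
    refine Finset.sum_involution (fun k _ => c k) (fun k hk => ?_) (fun k hk _ => ?_)
      (fun k hk => ?_) fun k _ => hc.invol k
    all_goals simp only [Finset.mem_filter, Finset.mem_range] at hk ⊢
    · rcases lt_or_gt_of_ne hk.2 with h | h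
      · have := hc.flip_arc_cancel (A := A) (B := B) hω hρ (hc.lt hk.1)
          (by rw [hc.invol]; exact h)
        rw [hc.invol] at this
        rw [add_comm]
        exact this
      · exact hc.flip_arc_cancel hω hρ hk.1 h
    · exact hk.2
    · exact ⟨hc.lt hk.1, by rw [hc.invol]; exact fun h => hk.2 h.symm⟩
  rw [hz, add_zero, Finset.sum_apply, fix]
  refine Finset.sum_congr rfl fun j hj => ?_
  rw [Pi.smul_apply, smul_eq_mul]
  simp only [Finset.mem_filter, Finset.mem_range] at hj
  rw [vec_toggle hj.2]
  by_cases hv : vec ω n c (toggle B j) A = 0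
  · rw [hv]; ring
  · rw [hc.balance_eq hω hj.2 hv, fix]

theorem IsLink.weight_eq (hc : IsLink n t c) (hω : ω ≠ 0) (hv : vec ω n c B A ≠ 0) :
    ∑ i ∈ Finset.range n, sgn A i = ∑ i ∈ fix (Finset.range n) c, sgn B i := by
  obtain ⟨h1, h2⟩ := (vec_ne_zero_iff hω).1 hv
  rw [sum_eq_sum_fix hc.nested_range fun i hi => h2 i (by simpa using hi)]
  refine Finset.sum_congr rfl fun i hi => ?_
  rw [mem_fix, Finset.mem_range] at hi
  exact h1 i hi.1 hi.2

/-- Different weight spaces are orthogonal, and arcs have weight zero. -/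
theorem IsLink.dot_eq_zero {t' : ℤ} {c' : Equiv.Perm ℕ} {B' : Finset ℕ} (hc : IsLink n t c)
    (hc' : IsLink n t' c') (hω : ω ≠ 0)
    (h : ∑ i ∈ fix (Finset.range n) c, sgn B i ≠ ∑ i ∈ fix (Finset.range n) c', sgn B' i) :
    dot n (vec ω n c B) (vec ω n c' B') = 0 := by
  refine Finset.sum_eq_zero fun A _ => ?_
  by_contra hne
  exact h ((hc.weight_eq hω (left_ne_zero_of_mul hne)).symm.trans
    (hc'.weight_eq hω (right_ne_zero_of_mul hne)))

theorem IsLink.sum_sgn_empty (hc : IsLink n t c) :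
    ∑ i ∈ fix (Finset.range n) c, sgn ∅ i = t := by
  simp [sgn_empty, hc.card_fix]

theorem IsLink.sum_sgn_toggle {B : Finset ℕ} {j : ℕ} (hj : j ∈ fix (Finset.range n) c) :
    ∑ i ∈ fix (Finset.range n) c, sgn (toggle B j) i =
      ∑ i ∈ fix (Finset.range n) c, sgn B i - 2 * sgn B j := by
  rw [← Finset.add_sum_erase _ _ hj, ← Finset.add_sum_erase _ (fun i => sgn B i) hj,
    sgn_toggle_self, Finset.sum_congr rfl fun i hi => sgn_toggle_of_ne B (Finset.ne_of_mem_erase hi)]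
  ring

/-- The lowered vector of a diagram is orthogonal to the diagrams with two through strands less. -/
theorem IsLink.dot_flipSum_eq_zero {t' : ℤ} {c' : Equiv.Perm ℕ} (hc : IsLink n t c)
    (hc' : IsLink n t' c') (h : t' ≠ t + 2) (hω : ω ≠ 0) (hρ : ρ ^ 2 = -ω ^ 4) :
    dot n (vec ω n c ∅) (flipSum ρ n (vec ω n c' ∅)) = 0 := by
  rw [hc'.flipSum_vec hω hρ, dot_sum_right]
  refine Finset.sum_eq_zero fun j hj => ?_
  rw [dot_smul_right, hc.dot_eq_zero hc' hω, mul_zero]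
  rw [hc.sum_sgn_empty, IsLink.sum_sgn_toggle hj, hc'.sum_sgn_empty, sgn_empty]
  omega

/-- By self-adjointness the operator is applied twice to one vector. Flipping two different strands
lowers the weight by 4 and is orthogonal to the other vector; flipping the same strand twice returns
the vector, with the square of its coefficient. -/
theorem IsLink.dot_flipSum_flipSum {c' : Equiv.Perm ℕ} (hc : IsLink n t c)
    (hc' : IsLink n t c') (hω : ω ≠ 0) (hρ : ρ ^ 2 = -ω ^ 4) (hρ' : ρ ≠ 0) :
    dot n (flipSum ρ n (vec ω n c ∅)) (flipSum ρ n (vec ω n c' ∅)) =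
      (∑ j ∈ fix (Finset.range n) c', (ρ ^ 2) ^ balance (fix (Finset.range n) c') ∅ j) *
        dot n (vec ω n c ∅) (vec ω n c' ∅) := by
  rw [dot_flipSum, hc'.flipSum_vec hω hρ, flipSum_sum, dot_sum_right, Finset.sum_mul]
  refine Finset.sum_congr rfl fun j hj => ?_
  rw [flipSum_smul, dot_smul_right, hc'.flipSum_vec hω hρ, dot_sum_right, Finset.sum_eq_single j]
  · rw [dot_smul_right, balance_toggle, toggle_toggle, ← mul_assoc, ← zpow_add₀ hρ',
      ← zpow_natCast ρ 2, ← zpow_mul]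
    congr 2
    push_cast
    ring
  · intro i hi hij
    rw [dot_smul_right, hc.dot_eq_zero hc' hω, mul_zero]
    rw [hc.sum_sgn_empty, IsLink.sum_sgn_toggle hi, IsLink.sum_sgn_toggle hj, hc'.sum_sgn_empty,
      sgn_toggle_of_ne _ hij, sgn_empty, sgn_empty]
    omega
  · exact fun h => absurd hj h

end Link
-- Joining through strands and the branching rule
theorem exists_enum (F : Finset ℕ) : ∃ e : ℕ → ℕ, (∀ i j, i < j → j < F.card → e i < e j) ∧
    F = (Finset.range F.card).image e := by
  refine ⟨fun i => if h : i < F.card then F.orderEmbOfFin rfl ⟨i, h⟩ else 0, ?_, ?_⟩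
  · intro i j hij hj
    simp only [hj, hij.trans hj, dif_pos]
    exact (F.orderEmbOfFin rfl).strictMono (Fin.lt_def.2 hij)
  · ext x
    simp only [Finset.mem_image, Finset.mem_range]
    constructor
    · intro hx
      have : x ∈ Set.range (F.orderEmbOfFin rfl) := by
        rw [Finset.range_orderEmbOfFin]; exact hx
      obtain ⟨i, hi⟩ := this
      exact ⟨i, i.2, by simp [hi]⟩
    · rintro ⟨i, hi, rfl⟩
      simp only [hi, dif_pos]
      exact Finset.orderEmbOfFin_mem F rfl _

theorem sum_sign_sub (T i : ℕ) : ∑ m ∈ Finset.range T, Int.sign ((m : ℤ) - i) =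
    if T ≤ i then -(T : ℤ) else T - 1 - 2 * i := by
  induction T with
  | zero => simp
  | succ T ih =>
    rw [Finset.sum_range_succ, ih]
    rcases lt_trichotomy T i with h | h | h
    · rw [Int.sign_eq_neg_one_of_neg (by omega), if_pos (by omega), if_pos (by omega)]
      push_cast; ring
    · subst h
      simp
      ring
    · rw [Int.sign_eq_one_of_pos (by omega), if_neg (by omega), if_neg (by omega)]
      push_cast; ring

/-- The quantum integer `[k]`. -/
noncomputable def qint (q : ℂ) (k : ℕ) : ℂ := ∑ i ∈ Finset.range k, q ^ ((k : ℤ) - 1 - 2 * i)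

section Join

variable {ω ρ q : ℂ} {n : ℕ} {t : ℤ} {c : Equiv.Perm ℕ} {A B : Finset ℕ}

theorem fix_range_succ (c : ℕ → ℕ) (n : ℕ) (hc : c n = n) :
    fix (Finset.range (n + 1)) c = insert n (fix (Finset.range n) c) := by
  rw [fix, Finset.range_add_one, Finset.filter_insert, if_pos hc, fix]

theorem notMem_fix_range (c : ℕ → ℕ) (n : ℕ) : n ∉ fix (Finset.range n) c := by
  simp [mem_fix]

theorem IsLink.succ (hc : IsLink n t c) : IsLink (n + 1) (t + 1) c := by
  refine ⟨hc.invol, fun i hi => hc.fixed_of_le i (by omega), hc.nest, ?_⟩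
  rw [fix_range_succ _ _ (hc.fixed_of_le n le_rfl),
    Finset.card_insert_of_notMem (notMem_fix_range _ _)]
  push_cast
  rw [hc.card_fix]

theorem IsLink.of_succ (hc : IsLink (n + 1) t c) (hn : c n = n) : IsLink n (t - 1) c := by
  refine ⟨hc.invol, fun i hi => ?_, hc.nest, ?_⟩
  · rcases hi.eq_or_lt with rfl | h
    · exact hn
    · exact hc.fixed_of_le i h
  · rw [← hc.card_fix, fix_range_succ _ _ hn,
      Finset.card_insert_of_notMem (notMem_fix_range _ _)]
    push_cast
    ring

theorem mul_swap_left {p p' : ℕ} (h : c p' = p') : (c * Equiv.swap p p') p = p' := by simp [h]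

theorem mul_swap_right {p p' : ℕ} (h : c p = p) : (c * Equiv.swap p p') p' = p := by simp [h]

theorem mul_swap_of_ne {p p' i : ℕ} (h : i ≠ p) (h' : i ≠ p') :
    (c * Equiv.swap p p') i = c i := by simp [Equiv.swap_apply_of_ne_of_ne h h']

/-- Two neighbouring through strands can be joined. -/
theorem IsLink.join (hc : IsLink n t c) {p p' : ℕ} (hp : c p = p) (hp' : c p' = p') (hlt : p < p')
    (hn : p' < n) (hno : ∀ k, p < k → k < p' → c k ≠ k) :
    IsLink n (t - 2) (c * Equiv.swap p p') := by
  have e1 : (c * Equiv.swap p p') p = p' := mul_swap_left hp'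
  have e2 : (c * Equiv.swap p p') p' = p := mul_swap_right hp
  have e3 : ∀ i, i ≠ p → i ≠ p' → (c * Equiv.swap p p') i = c i := fun i => mul_swap_of_ne
  generalize c * Equiv.swap p p' = d at e1 e2 e3
  have f1 : ∀ i, i ≠ p → c i ≠ p := fun i h h' => h (c.injective (h'.trans hp.symm))
  have f2 : ∀ i, i ≠ p' → c i ≠ p' := fun i h h' => h (c.injective (h'.trans hp'.symm))
  refine ⟨fun i => ?_, fun i hi => ?_, fun i j hij hj => ?_, ?_⟩
  · by_cases h1 : i = p
    · rw [h1, e1, e2]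
    by_cases h2 : i = p'
    · rw [h2, e2, e1]
    rw [e3 i h1 h2, e3 _ (f1 i h1) (f2 i h2), hc.invol]
  · rw [e3 i (by omega) (by omega), hc.fixed_of_le i hi]
  · by_cases h1 : i = p
    · rw [h1] at hij hj ⊢
      rw [e1] at hj ⊢
      rw [e3 j (by omega) (by omega)]
      refine ⟨hno j hij hj, ?_, ?_⟩
      · by_contra h
        have h5 := f1 j (by omega)
        exact (hc.nest (c j) p (by omega) (by rw [hc.invol]; exact hij)).1 hp
      · by_contra h
        have h5 := f2 j (by omega)
        exact (hc.nest j p' hj (by omega)).1 hp'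
    by_cases h2 : i = p'
    · rw [h2] at hij hj
      rw [e2] at hj
      omega
    rw [e3 i h1 h2] at hj ⊢
    have h3 := hc.nest i j hij hj
    rw [e3 j (fun h => h3.1 (by rw [h, hp])) (fun h => h3.1 (by rw [h, hp']))]
    exact h3
  · have h1 : fix (Finset.range n) d = ((fix (Finset.range n) c).erase p).erase p' := by
      ext i
      simp only [mem_fix, Finset.mem_erase]
      by_cases h1 : i = p
      · subst h1; simp [e1, hlt.ne']
      by_cases h2 : i = p'
      · subst h2; simp [e2, hlt.ne]
      simp [h1, h2, e3 i h1 h2]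
    have m1 : p ∈ fix (Finset.range n) c := mem_fix.2 ⟨by simp; omega, hp⟩
    have m2 : p' ∈ (fix (Finset.range n) c).erase p :=
      Finset.mem_erase.2 ⟨hlt.ne', mem_fix.2 ⟨by simp [hn], hp'⟩⟩
    have c1 := Finset.card_erase_add_one m1
    have c2 := Finset.card_erase_add_one m2
    rw [h1, ← hc.card_fix]
    omega

/-- The new arc has two orientations, and the sign pattern at its ends decides the weight: ω^{-2} if
the left end is negative and ω^2 if the right end is. -/
theorem vec_join (hω : ω ≠ 0) {p p' : ℕ} (hp : c p = p) (hp' : c p' = p') (hlt : p < p')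
    (hn : p' < n) : vec ω n (c * Equiv.swap p p' : Equiv.Perm ℕ) ∅ =
      (ω ^ 2)⁻¹ • vec ω n c {p} + ω ^ 2 • vec ω n c {p'} := by
  funext A
  rw [Pi.add_apply, Pi.smul_apply, Pi.smul_apply, smul_eq_mul, smul_eq_mul]
  have e1 : (c * Equiv.swap p p') p = p' := mul_swap_left hp'
  have e2 : (c * Equiv.swap p p') p' = p := mul_swap_right hp
  have e3 : ∀ i, i ≠ p → i ≠ p' → (c * Equiv.swap p p') i = c i := fun i => mul_swap_of_ne
  generalize c * Equiv.swap p p' = d at e1 e2 e3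
  have r : ∀ B : Finset ℕ, (∀ i, i ∈ B → i = p ∨ i = p') →
      ∏ i ∈ ((Finset.range n).erase p).erase p', siteWeight ω c B A i =
        ∏ i ∈ ((Finset.range n).erase p).erase p', siteWeight ω d ∅ A i := by
    intro B hB
    refine Finset.prod_congr rfl fun i hi => ?_
    simp only [Finset.mem_erase, Finset.mem_range] at hi
    refine siteWeight_congr (e3 i hi.2.1 hi.1).symm (fun _ => ?_) Iff.rfl Iff.rfl
    have : i ∉ B := fun h => by rcases hB i h with h | h <;> omega
    simp [this]
  unfold vec
  rw [prod_eq_mul_mul_erase (hlt.trans hn) hn hlt.ne, prod_eq_mul_mul_erase (hlt.trans hn) hn hlt.ne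
    (siteWeight ω c {p} A), prod_eq_mul_mul_erase (hlt.trans hn) hn hlt.ne
    (siteWeight ω c {p'} A), r {p} (by simp), r {p'} (by simp)]
  have s1 : side d p = 1 := side_of_lt (by rw [e1]; exact hlt)
  have s2 : side d p' = -1 := side_of_gt (by rw [e2]; exact hlt)
  unfold siteWeight
  rw [e1, e2, hp, hp', s1, s2]
  by_cases h1 : p ∈ A <;> by_cases h2 : p' ∈ A <;>
    simp [h1, h2, hlt.ne, hlt.ne', sgn] <;> left
  · field_simp
  · ring

variable (n) in
/-- Append a positive site. -/
noncomputable def up (f : Finset ℕ → ℂ) (A : Finset ℕ) : ℂ := if n ∈ A then 0 else f A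

variable (n) in
/-- Append a negative site. -/
noncomputable def down (f : Finset ℕ → ℂ) (A : Finset ℕ) : ℂ := if n ∈ A then f A else 0

theorem up_add (f g : Finset ℕ → ℂ) : up n (f + g) = up n f + up n g := by
  funext A; simp only [up, Pi.add_apply]; split <;> simp

theorem up_smul (a : ℂ) (f : Finset ℕ → ℂ) : up n (a • f) = a • up n f := by
  funext A; simp only [up, Pi.smul_apply]; split <;> simp

theorem up_sum {ι : Type*} (s : Finset ι) (f : ι → Finset ℕ → ℂ) :
    up n (∑ i ∈ s, f i) = ∑ i ∈ s, up n (f i) := by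
  funext A; simp only [up, Finset.sum_apply]; split <;> simp

theorem dot_succ (f g : Finset ℕ → ℂ) : dot (n + 1) f g =
    dot n f g + dot n (fun A => f (insert n A)) (fun A => g (insert n A)) := by
  rw [dot, Finset.range_add_one, Finset.sum_powerset_insert Finset.notMem_range_self]
  rfl

theorem dot_congr {f f' g g' : Finset ℕ → ℂ} (hf : ∀ A, n ∉ A → f A = f' A)
    (hg : ∀ A, n ∉ A → g A = g' A) : dot n f g = dot n f' g' := by
  refine Finset.sum_congr rfl fun A hA => ?_
  have : n ∉ A := fun h => by simpa using Finset.mem_powerset.1 hA h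
  rw [hf A this, hg A this]

theorem dot_up_up (f g : Finset ℕ → ℂ) : dot (n + 1) (up n f) (up n g) = dot n f g := by
  rw [dot_succ]
  have : dot n (fun A => up n f (insert n A)) (fun A => up n g (insert n A)) = 0 := by
    simp [dot, up]
  rw [this, add_zero]
  exact dot_congr (fun A h => by simp [up, h]) (fun A h => by simp [up, h])

theorem dot_up_down (f g : Finset ℕ → ℂ) : dot (n + 1) (up n f) (down n g) = 0 := by
  refine Finset.sum_eq_zero fun A _ => ?_
  unfold up down
  split <;> simp

/-- `down` evaluates its argument at states containing `n`, hence the requirement that the site `n`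
be invisible to `f` and `g`. -/
theorem dot_down_down {f g : Finset ℕ → ℂ} (hf : ∀ A, f (insert n A) = f A)
    (hg : ∀ A, g (insert n A) = g A) : dot (n + 1) (down n f) (down n g) = dot n f g := by
  rw [dot_succ]
  have : dot n (down n f) (down n g) = 0 := by
    refine Finset.sum_eq_zero fun A hA => ?_
    have : n ∉ A := fun h => by simpa using Finset.mem_powerset.1 hA h
    simp [down, this]
  rw [this, zero_add]
  exact dot_congr (fun A h => by simp [down, hf]) (fun A h => by simp [down, hg])

theorem IsLink.vec_insert (hc : IsLink n t c) (A : Finset ℕ) :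
    vec ω n c B (insert n A) = vec ω n c B A := by
  refine Finset.prod_congr rfl fun i hi => ?_
  rw [Finset.mem_range] at hi
  have := hc.lt hi
  refine siteWeight_congr rfl (fun _ => Iff.rfl) ?_ ?_ <;>
    simp [hi.ne, this.ne]

theorem vec_succ_up (hc : c n = n) (hB : n ∉ B) : vec ω (n + 1) c B = up n (vec ω n c B) := by
  funext A
  rw [vec, Finset.prod_range_succ, up, vec, siteWeight, if_pos hc]
  by_cases h : n ∈ A <;> simp [h, hB]

theorem vec_succ_down (hc : c n = n) :
    vec ω (n + 1) c {n} = down n (vec ω n c ∅) := by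
  funext A
  rw [vec, Finset.prod_range_succ, down, vec, siteWeight, if_pos hc]
  have : ∏ i ∈ Finset.range n, siteWeight ω c {n} A i =
      ∏ i ∈ Finset.range n, siteWeight ω c ∅ A i := by
    refine Finset.prod_congr rfl fun i hi => siteWeight_congr rfl (fun _ => ?_) Iff.rfl Iff.rfl
    rw [Finset.mem_range] at hi
    simp [hi.ne]
  rw [this]
  by_cases h : n ∈ A <;> simp [h]

/-- The position of the last through strand. -/
def lastFix (n : ℕ) (c : ℕ → ℕ) : ℕ := (fix (Finset.range n) c).sup id

theorem le_lastFix {c : ℕ → ℕ} {i : ℕ} (hi : i ∈ fix (Finset.range n) c) : i ≤ lastFix n c :=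
  Finset.le_sup (f := id) hi

theorem lastFix_mem {c : ℕ → ℕ} (h : (fix (Finset.range n) c).Nonempty) :
    lastFix n c ∈ fix (Finset.range n) c := by
  obtain ⟨i, hi, h'⟩ := Finset.exists_mem_eq_sup _ h id
  rw [lastFix, h']
  exact hi

theorem lastFix_eq {c : ℕ → ℕ} {p : ℕ} (hp : p ∈ fix (Finset.range n) c)
    (h : ∀ i ∈ fix (Finset.range n) c, i ≤ p) : lastFix n c = p :=
  le_antisymm (Finset.sup_le h) (le_lastFix hp)

theorem IsLink.lastFix_spec (hc : IsLink n (t + 1) c) (ht : 0 ≤ t) :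
    lastFix n c < n ∧ c (lastFix n c) = lastFix n c := by
  have h := lastFix_mem (n := n) (c := c) (by
    rw [← Finset.card_pos]
    have := hc.card_fix
    omega)
  simpa [mem_fix] using h

/-- Bend the last through strand to the top. -/
theorem IsLink.bend (hc : IsLink n (t + 1) c) (ht : 0 ≤ t) :
    IsLink (n + 1) t (c * Equiv.swap (lastFix n c) n) := by
  obtain ⟨h1, h2⟩ := hc.lastFix_spec ht
  have := hc.succ.join h2 (hc.fixed_of_le n le_rfl) h1 (by omega) (fun k hk hkn hck => by
    have := le_lastFix (n := n) (c := c) (i := k) (mem_fix.2 ⟨by simp [hkn], hck⟩)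
    omega)
  rwa [show t + 1 + 1 - 2 = t by ring] at this

/-- The last upper point is either the end of a through strand, or of an arc that can be bent down
to a through strand. -/
noncomputable def linkSuccMap (n : ℕ) (t : ℤ) (ht : 0 ≤ t) :
    Link n (t - 1) ⊕ Link n (t + 1) → Link (n + 1) t :=
  Sum.elim (fun x => ⟨x.1, by simpa using x.2.succ⟩)
    (fun y => ⟨y.1 * Equiv.swap (lastFix n y.1) n, y.2.bend ht⟩)

/-- The two cases are told apart by whether `n` is fixed. An arc ending in `n` is cut; its left end
`c n` becomes the last through strand, because everything between `c n` and `n` lies beneath the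
arc. So bending that strand up restores the arc. -/
theorem linkSuccMap_bijective (n : ℕ) (t : ℤ) (ht : 0 ≤ t) :
    Function.Bijective (linkSuccMap n t ht) := by
  have hx : ∀ x : Link n (t - 1), (linkSuccMap n t ht (Sum.inl x)).1 n = n :=
    fun x => x.2.fixed_of_le n le_rfl
  have hy : ∀ y : Link n (t + 1), (linkSuccMap n t ht (Sum.inr y)).1 n = lastFix n y.1 :=
    fun y => mul_swap_right (y.2.lastFix_spec ht).2
  have hlt : ∀ y : Link n (t + 1), lastFix n y.1 < n := fun y => (y.2.lastFix_spec ht).1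
  constructor
  · rintro (x | y) (x' | y') h
    · have h1 : (linkSuccMap n t ht (Sum.inl x)).1 = (linkSuccMap n t ht (Sum.inl x')).1 :=
        congrArg Subtype.val h
      exact congrArg Sum.inl (Subtype.ext h1)
    · have h1 := hx x
      rw [h, hy] at h1
      have := hlt y'
      omega
    · have h1 := hx x'
      rw [← h, hy] at h1
      have := hlt y
      omega
    · have h1 := hy y
      rw [h, hy] at h1
      have h2 : y.1 * Equiv.swap (lastFix n y.1) n = y'.1 * Equiv.swap (lastFix n y'.1) n :=
        congrArg Subtype.val h
      rw [h1] at h2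
      exact congrArg Sum.inr (Subtype.ext (mul_right_cancel h2))
  · rintro ⟨c, hc⟩
    by_cases hn : c n = n
    · exact ⟨Sum.inl ⟨c, hc.of_succ hn⟩, rfl⟩
    set p := c n with hp
    have hpn : p < n := by
      have := hc.lt (Nat.lt_succ_self n)
      omega
    have hcp : c p = n := hc.invol n
    have e1 : (c * Equiv.swap p n) p = p := by simp [hp]
    have e2 : (c * Equiv.swap p n) n = n := by simp [hcp]
    have e3 : ∀ i, i ≠ p → i ≠ n → (c * Equiv.swap p n) i = c i := fun i => mul_swap_of_ne
    have f1 : ∀ i, i ≠ n → c i ≠ p := fun i h h' => h (c.injective h')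
    have f2 : ∀ i, i ≠ p → c i ≠ n := fun i h h' => h (c.injective (h'.trans hcp.symm))
    have hle : ∀ i, i ≤ n → c i ≤ n := fun i hi => Nat.lt_succ_iff.1 (hc.lt (by omega))
    have hcc : c = (c * Equiv.swap p n) * Equiv.swap p n := by
      rw [mul_assoc, Equiv.swap_mul_self, mul_one]
    generalize c * Equiv.swap p n = d at e1 e2 e3 hcc
    have hfix : fix (Finset.range n) d = insert p (fix (Finset.range (n + 1)) c) := by
      ext i
      simp only [mem_fix, Finset.mem_insert, Finset.mem_range]
      by_cases h1 : i = p
      · subst h1; simp [e1, hpn]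
      by_cases h2 : i = n
      · subst h2; simp [← hp, hpn.ne, hpn.ne']
      · rw [e3 i h1 h2]
        simp only [h1, false_or]
        omega
    have hd : IsLink n (t + 1) d := by
      refine ⟨fun i => ?_, fun i hi => ?_, fun i j hij hj => ?_, ?_⟩
      · by_cases h1 : i = p
        · rw [h1, e1, e1]
        by_cases h2 : i = n
        · rw [h2, e2, e2]
        rw [e3 i h1 h2, e3 _ (f1 i h2) (f2 i h1), hc.invol]
      · by_cases h2 : i = n
        · rw [h2, e2]
        rw [e3 i (by omega) h2, hc.fixed_of_le i (by omega)]
      · by_cases h1 : i = p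
        · rw [h1] at hij hj
          omega
        by_cases h2 : i = n
        · rw [h2] at hij hj
          omega
        rw [e3 i h1 h2] at hj ⊢
        have h4 := hc.nest i j hij hj
        have h5 : c i ≤ n := by
          by_contra h
          have := hc.fixed_of_le (c i) (by omega)
          rw [hc.invol] at this
          omega
        rw [e3 j (fun h => by rw [h, hcp] at h4; omega) (by omega)]
        exact h4
      · rw [hfix, Finset.card_insert_of_notMem (by
          rw [mem_fix, hcp]
          exact fun h => hpn.ne' h.2), ← hc.card_fix]
        push_cast
        ring
    refine ⟨Sum.inr ⟨d, hd⟩, Subtype.ext ?_⟩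
    have hlast : lastFix n d = p := by
      refine lastFix_eq (by rw [hfix]; simp) fun i hi => ?_
      rw [hfix, Finset.mem_insert, mem_fix, Finset.mem_range] at hi
      rcases hi with h | ⟨h1, h2⟩
      · exact h.le
      · by_contra h
        have h3 : i ≠ n := fun h' => hn (by rw [hp, ← h']; exact h2)
        exact (hc.nest p i (by omega) (by omega)).1 h2
    show d * Equiv.swap (lastFix n d) n = c
    rw [hlast, ← hcc]

/-- The branching rule for monic diagrams. -/
noncomputable def linkSuccEquiv (n : ℕ) (t : ℤ) (ht : 0 ≤ t) :
    Link n (t - 1) ⊕ Link n (t + 1) ≃ Link (n + 1) t :=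
  Equiv.ofBijective _ (linkSuccMap_bijective n t ht)

end Join
-- Block form of the Gram matrix
noncomputable instance (n : ℕ) (t : ℤ) : Fintype (Link n t) := Fintype.ofFinite _

noncomputable instance (n : ℕ) (t : ℤ) : DecidableEq (Link n t) := Classical.decEq _

section Gram

variable {ω ρ q : ℂ} {n : ℕ} {c : Equiv.Perm ℕ}

/-- The Gram matrix of the cell module. -/
noncomputable def gram (ω : ℂ) (n : ℕ) (t : ℤ) : Matrix (Link n t) (Link n t) ℂ :=
  Matrix.of fun c d => dot n (vec ω n c.1 ∅) (vec ω n d.1 ∅)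

/-- Of the `t + 1` strands, strand `i` has `t - i` to its right and `i` to its left, all positive:
hence the balance t - 2i. -/
theorem IsLink.exists_enum_fix {t : ℕ} (hc : IsLink n (t + 1 : ℤ) c) : ∃ e : ℕ → ℕ,
    (∀ i j, i < j → j ≤ t → e i < e j) ∧
    (∀ i ≤ t, e i < n ∧ c (e i) = e i) ∧ (∀ k < n, c k = k → ∃ i ≤ t, e i = k) ∧
    (∀ i ≤ t, balance (fix (Finset.range n) c) ∅ (e i) = t - 2 * i) ∧
    ∀ (M : Type) [AddCommMonoid M] (f : ℕ → M),
      ∑ j ∈ fix (Finset.range n) c, f j = ∑ i ∈ Finset.range (t + 1), f (e i) := by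
  have hcard : (fix (Finset.range n) c).card = t + 1 := by exact_mod_cast hc.card_fix
  obtain ⟨e, he, hF⟩ := exists_enum (fix (Finset.range n) c)
  rw [hcard] at he hF
  have hinj : Set.InjOn e (Finset.range (t + 1)) := by
    intro i hi j hj h
    simp only [Finset.coe_range, Set.mem_Iio] at hi hj
    by_contra hne
    rcases lt_or_gt_of_ne hne with h' | h'
    · have := he i j h' hj; omega
    · have := he j i h' hi; omega
  have hsum : ∀ (M : Type) [AddCommMonoid M] (f : ℕ → M),
      ∑ j ∈ fix (Finset.range n) c, f j = ∑ i ∈ Finset.range (t + 1), f (e i) := by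
    intro M _ f
    rw [hF, Finset.sum_image hinj]
  refine ⟨e, fun i j hij hj => he i j hij (by omega), fun i hi => ?_, fun k hk hck => ?_, ?_, hsum⟩
  · have : e i ∈ fix (Finset.range n) c := by
      rw [hF]; exact Finset.mem_image_of_mem e (by simp; omega)
    simpa [mem_fix] using this
  · have : k ∈ fix (Finset.range n) c := mem_fix.2 ⟨by simp [hk], hck⟩
    rw [hF, Finset.mem_image] at this
    obtain ⟨i, hi, h⟩ := this
    exact ⟨i, by simpa [Nat.lt_succ_iff] using hi, h⟩
  · intro i hi
    rw [balance, hsum]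
    have : ∀ m ∈ Finset.range (t + 1), Int.sign (((e m : ℕ) : ℤ) - e i) * sgn ∅ (e m) =
        Int.sign ((m : ℤ) - i) := by
      intro m hm
      rw [Finset.mem_range] at hm
      rw [sgn_empty, mul_one]
      rcases lt_trichotomy m i with h | h | h
      · have := he m i h (by omega)
        rw [Int.sign_eq_neg_one_of_neg (by omega), Int.sign_eq_neg_one_of_neg (by omega)]
      · simp [h]
      · have := he i m h (by omega)
        rw [Int.sign_eq_one_of_pos (by omega), Int.sign_eq_one_of_pos (by omega)]
    rw [Finset.sum_congr rfl this, sum_sign_sub, if_neg (by omega)]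
    push_cast
    ring

/-- Modulo the diagrams with two through strands less, lowering the last through strand is a
multiple of lowering all of them symmetrically. -/
theorem IsLink.flipSum_sub_mem_span {t : ℕ} (hc : IsLink n (t + 1 : ℤ) c) (hω : ω ≠ 0)
    (hq : ω ^ 4 = -q) (hρ : ρ ^ 2 = q) :
    flipSum ρ n (vec ω n c ∅) - (ρ ^ t * qint q (t + 1)) • vec ω n c {lastFix n c} ∈
      Submodule.span ℂ (Set.range fun x : Link n (t - 1 : ℤ) => vec ω n x.1 ∅) := by
  obtain ⟨e, hmono, hfix, hex, hbal, hsum⟩ := hc.exists_enum_fix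
  set N := Submodule.span ℂ (Set.range fun x : Link n (t - 1 : ℤ) => vec ω n x.1 ∅) with hN
  have hq0 : q ≠ 0 := by
    rintro rfl
    exact hω (by simpa using hq)
  have hρ0 : ρ ≠ 0 := by
    rintro rfl
    exact hq0 (by simpa using hρ.symm)
  have hlast : lastFix n c = e t := by
    refine lastFix_eq (mem_fix.2 ⟨by simpa using (hfix t le_rfl).1, (hfix t le_rfl).2⟩) ?_
    intro i hi
    rw [mem_fix, Finset.mem_range] at hi
    obtain ⟨k, hk, rfl⟩ := hex i hi.1 hi.2
    rcases hk.eq_or_lt with rfl | h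
    · exact le_rfl
    · exact (hmono k t h le_rfl).le
  -- Joining the neighbouring strands `i` and `i + 1` leaves `t - 1` through strands. By `vec_join`
  -- and ω^4 = -q, ω^2 times the resulting vector is this difference.
  have step : ∀ i, i < t → vec ω n c {e i} - q • vec ω n c {e (i + 1)} ∈ N := by
    intro i hi
    have hlt := hmono i (i + 1) (by omega) (by omega)
    have h1 := hfix i (by omega)
    have h2 := hfix (i + 1) (by omega)
    have hj := hc.join h1.2 h2.2 hlt h2.1 (by
      intro k hk hk' hck
      obtain ⟨m, hm, rfl⟩ := hex k (by omega) hck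
      rcases lt_trichotomy m i with h | h | h
      · have := hmono m i h (by omega); omega
      · subst h; omega
      · rcases (by omega : m = i + 1 ∨ i + 1 < m) with h' | h'
        · subst h'; omega
        · have := hmono _ _ h' hm; omega)
    have hv := vec_join hω h1.2 h2.2 hlt h2.1
    have : vec ω n c {e i} - q • vec ω n c {e (i + 1)} =
        ω ^ 2 • vec ω n (c * Equiv.swap (e i) (e (i + 1)) : Equiv.Perm ℕ) ∅ := by
      rw [hv, smul_add, smul_smul, smul_smul, mul_inv_cancel₀ (pow_ne_zero _ hω), one_smul,
        show ω ^ 2 * ω ^ 2 = -q by rw [← hq]; ring, neg_smul, sub_eq_add_neg]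
    rw [this]
    refine N.smul_mem _ (Submodule.subset_span ⟨⟨_, ?_⟩, rfl⟩)
    rwa [show (t + 1 - 2 : ℤ) = t - 1 by ring] at hj
  have chain : ∀ k, k ≤ t → vec ω n c {e (t - k)} - q ^ k • vec ω n c {e t} ∈ N := by
    intro k
    induction k with
    | zero => simp
    | succ k ih =>
      intro hk
      have h1 := N.smul_mem q (ih (by omega))
      have h2 := step (t - (k + 1)) (by omega)
      rw [show t - (k + 1) + 1 = t - k by omega] at h2
      have h3 := N.add_mem h2 h1
      rw [smul_sub, smul_smul, ← pow_succ'] at h3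
      convert h3 using 1
      abel
  have hz : flipSum ρ n (vec ω n c ∅) =
      ∑ i ∈ Finset.range (t + 1), ρ ^ ((t : ℤ) - 2 * i) • vec ω n c {e i} := by
    rw [hc.flipSum_vec hω (by rw [hρ, hq, neg_neg]), hsum]
    refine Finset.sum_congr rfl fun i hi => ?_
    rw [Finset.mem_range] at hi
    rw [hbal i (by omega), toggle_empty]
  -- With q = ρ^2, both sides have the terms ρ^{3t-4i}: moving the flipped strand `i` to the last
  -- place costs q^{t-i}.
  have hcoef : ρ ^ t * qint q (t + 1) =
      ∑ i ∈ Finset.range (t + 1), ρ ^ ((t : ℤ) - 2 * i) * q ^ (t - i) := by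
    rw [qint, Finset.mul_sum]
    refine Finset.sum_congr rfl fun i hi => ?_
    rw [Finset.mem_range] at hi
    rw [← hρ, ← zpow_natCast ρ 2, ← zpow_natCast ρ t, ← zpow_mul, ← zpow_natCast (ρ ^ ((2 : ℕ) : ℤ)),
      ← zpow_mul, ← zpow_add₀ hρ0, ← zpow_add₀ hρ0]
    congr 1
    push_cast [show i ≤ t by omega]
    ring
  rw [hz, hcoef, Finset.sum_smul, ← Finset.sum_sub_distrib, hlast]
  refine N.sum_mem fun i hi => ?_
  rw [Finset.mem_range] at hi
  have := N.smul_mem (ρ ^ ((t : ℤ) - 2 * i)) (chain (t - i) (by omega))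
  rwa [show t - (t - i) = i by omega, smul_sub, smul_smul] at this

/-- The scalar of `dot_flipSum_flipSum` is the sum of the q^{t-2i}, i = 0, …, t, which is [t+1]. -/
theorem IsLink.dot_flipSum_self {t : ℕ} {c' : Equiv.Perm ℕ} (hc : IsLink n (t + 1 : ℤ) c)
    (hc' : IsLink n (t + 1 : ℤ) c') (hω : ω ≠ 0) (hq : ω ^ 4 = -q) (hρ : ρ ^ 2 = q) (hρ0 : ρ ≠ 0) :
    dot n (flipSum ρ n (vec ω n c ∅)) (flipSum ρ n (vec ω n c' ∅)) =
      qint q (t + 1) * dot n (vec ω n c ∅) (vec ω n c' ∅) := by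
  rw [hc.dot_flipSum_flipSum hc' hω (by rw [hρ, hq, neg_neg]) hρ0]
  obtain ⟨e, hmono, hfix, hex, hbal, hsum⟩ := hc'.exists_enum_fix
  rw [hsum, qint]
  congr 1
  refine Finset.sum_congr rfl fun i hi => ?_
  rw [Finset.mem_range] at hi
  rw [hbal i (by omega), hρ]
  congr 1
  push_cast
  ring

theorem qint_add_two (hq : q ≠ 0) (k : ℕ) :
    q * qint q (k + 1) + q ^ (-(k : ℤ) - 1) = qint q (k + 2) := by
  rw [qint, qint, Finset.sum_range_succ _ (k + 1), Finset.mul_sum]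
  congr 1
  · refine Finset.sum_congr rfl fun i _ => ?_
    rw [← zpow_one_add₀ hq]
    congr 1
    push_cast
    ring
  · congr 1
    push_cast
    ring

/-- The Gram matrix is block diagonal in a basis adapted to the branching rule. -/
theorem gram_succ (n t : ℕ) (hω : ω ≠ 0) (hq : ω ^ 4 = -q) (ht : qint q (t + 1) ≠ 0) :
    ∃ P : Matrix (Link n (t + 1 : ℤ)) (Link n (t - 1 : ℤ)) ℂ,
      (gram ω (n + 1) t).submatrix (linkSuccEquiv n t (Int.natCast_nonneg t))
        (linkSuccEquiv n t (Int.natCast_nonneg t)) =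
      Matrix.fromBlocks 1 0 P 1 * Matrix.fromBlocks (gram ω n (t - 1 : ℤ)) 0 0
        (-(qint q (t + 2) / qint q (t + 1)) • gram ω n (t + 1 : ℤ)) *
        (Matrix.fromBlocks 1 0 P 1).transpose := by
  -- A square root of `q` for which ρ^2 = -ω^4, as needed for the cancellation on arcs.
  obtain ⟨ρ, hρ⟩ : ∃ ρ : ℂ, ρ ^ 2 = q := ⟨Complex.I * ω ^ 2, by
    rw [mul_pow, Complex.I_sq, ← pow_mul, hq]; ring⟩
  have hq0 : q ≠ 0 := by
    rintro rfl
    exact hω (by simpa using hq)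
  have hρ0 : ρ ≠ 0 := by
    rintro rfl
    exact hq0 (by simpa using hρ.symm)
  have ht0 : (0 : ℤ) ≤ t := Int.natCast_nonneg t
  set e := linkSuccEquiv n t ht0 with he
  set μ := (ρ ^ t * qint q (t + 1))⁻¹ with hμ
  have hμ' : ρ ^ t * qint q (t + 1) ≠ 0 := mul_ne_zero (pow_ne_zero _ hρ0) ht
  let v : ∀ {s : ℤ}, Link n s → Finset ℕ → ℂ := fun x => vec ω n x.1 ∅
  let z : Link n (t + 1 : ℤ) → Finset ℕ → ℂ := fun y => flipSum ρ n (v y)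
  have hex : ∀ y : Link n (t + 1 : ℤ), ∃ a : Link n (t - 1 : ℤ) → ℂ,
      vec ω n y.1 {lastFix n y.1} = μ • z y + ∑ x, a x • v x := by
    intro y
    have h := y.2.flipSum_sub_mem_span hω hq hρ
    have h' := Submodule.smul_mem _ (-μ) h
    rw [Submodule.mem_span_range_iff_exists_fun] at h'
    obtain ⟨a, ha⟩ := h'
    refine ⟨a, ?_⟩
    rw [ha, smul_sub, smul_smul, neg_mul, inv_mul_cancel₀ hμ']
    simp [z, v]
  choose a ha using hex
  -- The part of the bent diagram's vector that remains after removing the combination of the `up n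
  -- (v x)`; it is orthogonal to all of these.
  let wv : Link n (t + 1 : ℤ) → Finset ℕ → ℂ := fun y =>
    ((ω ^ 2)⁻¹ * μ) • up n (z y) + ω ^ 2 • down n (v y)
  have hinl : ∀ x, vec ω (n + 1) (e (Sum.inl x)).1 ∅ = up n (v x) := fun x =>
    vec_succ_up (x.2.fixed_of_le n le_rfl) (by simp)
  have hinr : ∀ y, vec ω (n + 1) (e (Sum.inr y)).1 ∅ =
      wv y + ∑ x, ((ω ^ 2)⁻¹ * a y x) • up n (v x) := by
    intro y
    obtain ⟨h1, h2⟩ := y.2.lastFix_spec ht0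
    have h3 := y.2.fixed_of_le n le_rfl
    have h4 : vec ω (n + 1) (e (Sum.inr y)).1 ∅ = _ := vec_join hω h2 h3 h1 (Nat.lt_succ_self n)
    rw [h4, vec_succ_up h3 (by simpa using h1.ne'), vec_succ_down h3, ha y, up_add, up_smul, up_sum,
      smul_add, smul_smul, Finset.smul_sum]
    simp only [up_smul, smul_smul]
    rw [add_assoc, add_comm (∑ x, _), ← add_assoc]
  have hvz : ∀ (x : Link n (t - 1 : ℤ)) y, dot n (v x) (z y) = 0 := by
    intro x y
    rw [← dot_flipSum, dot_comm]
    -- After moving the operator over to `v x`, it lowers the weight t-1 to t-3, which is never t+1.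
    exact y.2.dot_flipSum_eq_zero x.2 (by omega) hω (by rw [hρ, hq, neg_neg])
  have hxw : ∀ (x : Link n (t - 1 : ℤ)) y, dot (n + 1) (up n (v x)) (wv y) = 0 := by
    intro x y
    rw [dot_add_right, dot_smul_right, dot_smul_right, dot_up_up, dot_up_down, hvz]
    ring
  have hwx : ∀ y (x : Link n (t - 1 : ℤ)), dot (n + 1) (wv y) (up n (v x)) = 0 := fun y x => by
    rw [dot_comm, hxw]
  have hww : ∀ y y', dot (n + 1) (wv y) (wv y') =
      -(qint q (t + 2) / qint q (t + 1)) * dot n (v y) (v y') := by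
    intro y y'
    -- The scalar is ω^{-4} μ^2 [t+1] + ω^4 = -(q^{-t-1}/[t+1] + q), and `qint_add_two` turns it
    -- into -[t+2]/[t+1].
    have hdu : dot (n + 1) (down n (v y)) (up n (z y')) = 0 := by rw [dot_comm, dot_up_down]
    rw [dot_add_right, dot_add_left, dot_add_left]
    simp only [dot_smul_left, dot_smul_right]
    rw [dot_up_up, dot_up_down, hdu,
      dot_down_down (fun A => y.2.vec_insert A) (fun A => y'.2.vec_insert A),
      show dot n (z y) (z y') = _ from y.2.dot_flipSum_self y'.2 hω hq hρ hρ0,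
      ← qint_add_two hq0]
    have hpow : q ^ (-(t : ℤ) - 1) = (ρ ^ t * ρ ^ t * q)⁻¹ := by
      rw [← pow_add, ← two_mul, pow_mul, hρ, ← pow_succ, ← zpow_natCast, ← zpow_neg]
      congr 1
      push_cast
      ring
    have hw : ω ^ 4 ≠ 0 := pow_ne_zero _ hω
    have hqw : q = -ω ^ 4 := by rw [hq, neg_neg]
    rw [hpow, hμ]
    have hpt : ρ ^ t ≠ 0 := pow_ne_zero _ hρ0
    generalize qint q (t + 1) = K at ht ⊢
    generalize ρ ^ t = r at hpt ⊢
    rw [hqw]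
    change _ = _ * dot n (vec ω n y.1 ∅) (vec ω n y'.1 ∅)
    field_simp
    ring
  refine ⟨Matrix.of fun y x => (ω ^ 2)⁻¹ * a y x, ?_⟩
  rw [Matrix.fromBlocks_transpose, Matrix.fromBlocks_multiply, Matrix.fromBlocks_multiply]
  ext (x | y) (x' | y')
  · simp [gram, hinl, dot_up_up, v]
  · simp only [gram, Matrix.submatrix_apply, Matrix.of_apply, hinl, hinr, dot_add_right, hxw,
      dot_sum_right, dot_smul_right, dot_up_up]
    simp [Matrix.mul_apply, v, mul_comm]
  · simp only [gram, Matrix.submatrix_apply, Matrix.of_apply, hinl, hinr, dot_add_left,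
      hwx, dot_sum_left, dot_smul_left, dot_up_up]
    simp [Matrix.mul_apply, v]
  · simp only [gram, Matrix.submatrix_apply, Matrix.of_apply, hinr, dot_add_left,
      dot_add_right, hxw, hwx, hww, dot_sum_left, dot_sum_right, dot_smul_left, dot_smul_right,
      dot_up_up]
    simp only [v, mul_zero, Finset.sum_const_zero, add_zero, zero_add, one_mul, Matrix.mul_zero,
      Matrix.mul_one, Matrix.fromBlocks_apply₂₂, Matrix.add_apply, Matrix.mul_apply,
      Matrix.transpose_apply, Matrix.of_apply, Matrix.smul_apply, smul_eq_mul,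
      Matrix.transpose_one]
    rw [add_comm]
    simp only [mul_comm]

end Gram
-- Recursions for rank and determinant
section Rank

theorem rank_fromBlocks_diagonal {m m' : Type*} [Fintype m] [Fintype m'] [DecidableEq m]
    [DecidableEq m'] (A : Matrix m m ℂ) (D : Matrix m' m' ℂ) :
    (Matrix.fromBlocks A 0 0 D).rank = A.rank + D.rank := by
  let e := LinearEquiv.sumArrowLequivProdArrow m m' ℂ ℂ
  have h : (Matrix.fromBlocks A 0 0 D).mulVecLin =
      e.symm.toLinearMap ∘ₗ (A.mulVecLin.prodMap D.mulVecLin) ∘ₗ e.toLinearMap := by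
    refine LinearMap.ext fun v => ?_
    funext i
    rcases i with i | i <;>
      simp [e, Matrix.fromBlocks_mulVec, LinearEquiv.sumArrowLequivProdArrow,
        Equiv.sumArrowEquivProdArrow, Function.comp_def]
  have hp : ∀ (p : Submodule ℂ (m → ℂ)) (r : Submodule ℂ (m' → ℂ)),
      Module.finrank ℂ (p.prod r) = Module.finrank ℂ p + Module.finrank ℂ r := by
    intro p r
    have h1 : p.prod r = LinearMap.range (p.subtype.prodMap r.subtype) := by
      rw [LinearMap.range_prodMap, Submodule.range_subtype, Submodule.range_subtype]
    rw [h1, LinearMap.finrank_range_of_inj, Module.finrank_prod]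
    exact Function.Injective.prodMap p.injective_subtype r.injective_subtype
  rw [Matrix.rank, h, LinearMap.range_comp, LinearEquiv.finrank_map_eq,
    LinearMap.range_comp_of_range_eq_top _ (LinearEquiv.range e), LinearMap.range_prodMap, hp]
  rfl

/-- The number of monic diagrams. -/
noncomputable def wt (n : ℕ) (t : ℤ) : ℕ := Fintype.card (Link n t)

theorem wt_succ (n : ℕ) {t : ℤ} (ht : 0 ≤ t) : wt (n + 1) t = wt n (t - 1) + wt n (t + 1) := by
  rw [wt, ← Fintype.card_congr (linkSuccEquiv n t ht), Fintype.card_sum, wt, wt]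

theorem wt_eq_zero {n : ℕ} {t : ℤ} (h : t < 0 ∨ (n : ℤ) < t) : wt n t = 0 := by
  rw [wt, Fintype.card_eq_zero_iff]
  refine ⟨fun c => ?_⟩
  have h1 := c.2.card_fix
  have h2 : (fix (Finset.range n) c.1).card ≤ (Finset.range n).card := Finset.card_filter_le _ _
  rw [Finset.card_range] at h2
  omega

instance : Unique (Link 0 0) where
  default := ⟨1, ⟨fun _ => rfl, fun _ _ => rfl, fun i j h h' => by
    simp only [Equiv.Perm.coe_one, id_eq] at h'; omega, by simp [fix]⟩⟩
  uniq c := by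
    apply Subtype.ext
    ext i
    exact c.2.fixed_of_le i (Nat.zero_le i)

theorem wt_zero {t : ℤ} (ht : t ≠ 0) : wt 0 t = 0 :=
  wt_eq_zero (by simpa using lt_or_gt_of_ne ht)

variable {ω q : ℂ}

/-- The base change is unitriangular, so the ranks of the blocks add up; the second block is zero
when [t+2] = 0 and a non-zero multiple otherwise. -/
theorem rank_gram_succ (n t : ℕ) (hω : ω ≠ 0) (hq : ω ^ 4 = -q) (ht : qint q (t + 1) ≠ 0) :
    (gram ω (n + 1) t).rank = (gram ω n (t - 1 : ℤ)).rank +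
      if qint q (t + 2) = 0 then 0 else (gram ω n (t + 1 : ℤ)).rank := by
  obtain ⟨P, hP⟩ := gram_succ n t hω hq ht
  have hdet : IsUnit (Matrix.fromBlocks 1 0 P 1 : Matrix (Link n (t - 1 : ℤ) ⊕ Link n (t + 1 : ℤ))
      _ ℂ).det := by
    rw [Matrix.det_fromBlocks_zero₁₂]; simp
  rw [← Matrix.rank_submatrix (gram ω (n + 1) t) (linkSuccEquiv n t (Int.natCast_nonneg t))
    (linkSuccEquiv n t (Int.natCast_nonneg t)), hP, Matrix.rank_mul_eq_left_of_isUnit_det,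
    Matrix.rank_mul_eq_right_of_isUnit_det _ _ hdet, rank_fromBlocks_diagonal]
  · congr 1
    split_ifs with h
    · rw [h, zero_div, neg_zero, zero_smul, Matrix.rank_zero]
    · exact Matrix.rank_smul_of_mem_nonZeroDivisors _
        (mem_nonZeroDivisors_of_ne_zero (neg_ne_zero.2 (div_ne_zero h ht)))
  · rwa [Matrix.det_transpose]

/-- Absolute values dispose of the sign from the factor -1; only non-vanishing will matter. -/
theorem det_gram_succ (n t : ℕ) (hω : ω ≠ 0) (hq : ω ^ 4 = -q) (ht : qint q (t + 1) ≠ 0) :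
    ‖(gram ω (n + 1) t).det‖ = ‖(gram ω n (t - 1 : ℤ)).det‖ *
      ((‖qint q (t + 2)‖ / ‖qint q (t + 1)‖) ^ wt n (t + 1) * ‖(gram ω n (t + 1 : ℤ)).det‖) := by
  obtain ⟨P, hP⟩ := gram_succ n t hω hq ht
  rw [← Matrix.det_submatrix_equiv_self (linkSuccEquiv n t (Int.natCast_nonneg t)), hP,
    Matrix.det_mul, Matrix.det_mul, Matrix.det_transpose, Matrix.det_fromBlocks_zero₁₂,
    Matrix.det_fromBlocks_zero₁₂, Matrix.det_smul]
  simp [wt]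

/-- The bookkeeping behind the determinant formula: the exponents split as V j + V (j+1) by the
branching rule, and regrouping them leaves boundary terms at 0 and `M`. -/
theorem prod_telescope (a b : ℕ → ℝ) (V : ℕ → ℕ) : ∀ M : ℕ, (∀ k ≤ M, a k ≠ 0) →
    (∏ j ∈ Finset.range M, (a (j + 1) / b (j + 1)) ^ (V j + V (j + 1))) *
        a (M + 1) ^ V M * a 0 ^ V 0 =
      (∏ j ∈ Finset.range M, (a j / b (j + 1)) ^ V j) *
        (∏ j ∈ Finset.range M, (a (j + 2) / b (j + 1)) ^ V (j + 1)) * a 1 ^ V 0 * a M ^ V M := by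
  intro M
  induction M with
  | zero => intro _; simp
  | succ M ih =>
    intro h
    have h1 := ih fun k hk => h k (by omega)
    have h2 := h M (by omega)
    have h3 := h (M + 1) le_rfl
    rw [Finset.prod_range_succ, Finset.prod_range_succ, Finset.prod_range_succ]
    simp only [div_pow, pow_add] at h1 ⊢
    have h4 : a M ^ V M ≠ 0 := pow_ne_zero _ h2
    apply mul_right_cancel₀ h4
    linear_combination (a (M + 1) ^ V (M + 1) * a (M + 2) ^ V (M + 1) * a M ^ V M /
      (b (M + 1) ^ V M * b (M + 1) ^ V (M + 1))) * h1

/-- The absolute value of the Gram determinant. -/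
theorem norm_det_gram (hω : ω ≠ 0) (hq : ω ^ 4 = -q) (M K : ℕ)
    (hK : ∀ k, 1 ≤ k → k ≤ K → qint q k ≠ 0) : ∀ n s : ℕ, n ≤ M → s + n + M ≤ K →
    ‖(gram ω n (s - 1 : ℤ)).det‖ = ∏ j ∈ Finset.range M,
      (‖qint q (s + (j + 1))‖ / ‖qint q (j + 1)‖) ^ wt n (s - 1 + 2 * (j + 1)) := by
  -- The shift s = t + 1 lets the induction reach t = -1, where the matrix is empty and all ratios
  -- are [j]/[j]. For n ≤ M the factors omitted from the product have exponent 0; the bound s + n +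
  -- M ≤ K survives as n drops by 1 and s changes by ±1.
  have hempty : ∀ n s : ℕ, IsEmpty (Link n (s - 1 : ℤ)) →
      ‖(gram ω n (s - 1 : ℤ)).det‖ = 1 := by
    intro n s h
    rw [Matrix.det_isEmpty, norm_one]
  intro n
  induction n with
  | zero =>
    intro s _ _
    rw [Finset.prod_eq_one]
    · by_cases hs : s = 1
      · subst hs
        have : ∀ x : ℤ, x = 0 → ‖(gram ω 0 x).det‖ = 1 := by
          rintro x rfl
          rw [Matrix.det_unique]
          simp [gram, dot, vec]
        exact this _ (by norm_num)
      · apply hempty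
        rw [← Fintype.card_eq_zero_iff]
        exact wt_zero (by omega)
    · intro j _
      rw [wt_zero (by omega), pow_zero]
  | succ n ih =>
    intro s hn hs
    rcases Nat.eq_zero_or_pos s with rfl | hpos
    · rw [hempty _ _ (by
        rw [← Fintype.card_eq_zero_iff]
        exact wt_eq_zero (Or.inl (by simp)))]
      symm
      refine Finset.prod_eq_one fun j hj => ?_
      rw [Finset.mem_range] at hj
      rw [zero_add, div_self (norm_ne_zero_iff.2 (hK (j + 1) (by omega) (by omega))), one_pow]
    · obtain ⟨t, rfl⟩ : ∃ t, s = t + 1 := ⟨s - 1, by omega⟩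
      have e1 : ((t + 1 : ℕ) : ℤ) - 1 = t := by push_cast; ring
      have ih1 := ih t (by omega) (by omega)
      have ih2 := ih (t + 2) (by omega) (by omega)
      rw [show ((t + 2 : ℕ) : ℤ) - 1 = t + 1 by push_cast; ring] at ih2
      rw [e1, det_gram_succ n t hω hq (hK _ (by omega) (by omega)), ih1, ih2]
      have key := prod_telescope (fun k => ‖qint q (t + 1 + k)‖) (fun k => ‖qint q k‖)
        (fun j => wt n (t + 1 + 2 * j)) M
        (fun k hk => norm_ne_zero_iff.2 (hK _ (by omega) (by omega)))
      have hV : wt n (t + 1 + 2 * (M : ℤ)) = 0 := wt_eq_zero (Or.inr (by omega))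
      simp only [hV, pow_zero, mul_one] at key
      have p1 : ∏ j ∈ Finset.range M, (‖qint q (t + 1 + (j + 1))‖ / ‖qint q (j + 1)‖) ^
          wt (n + 1) ((t : ℤ) + 2 * (j + 1)) = ∏ j ∈ Finset.range M,
          (‖qint q (t + 1 + (j + 1))‖ / ‖qint q (j + 1)‖) ^
            (wt n (t + 1 + 2 * (j : ℤ)) + wt n (t + 1 + 2 * ((j + 1 : ℕ) : ℤ))) := by
        refine Finset.prod_congr rfl fun j _ => ?_
        rw [wt_succ n (by omega)]
        congr 3 <;> push_cast <;> ring
      have p2 : ∏ j ∈ Finset.range M, (‖qint q (t + (j + 1))‖ / ‖qint q (j + 1)‖) ^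
          wt n ((t : ℤ) - 1 + 2 * (j + 1)) = ∏ j ∈ Finset.range M,
          (‖qint q (t + 1 + j)‖ / ‖qint q (j + 1)‖) ^ wt n (t + 1 + 2 * (j : ℤ)) := by
        refine Finset.prod_congr rfl fun j _ => ?_
        rw [show t + (j + 1) = t + 1 + j by ring,
          show (t : ℤ) - 1 + 2 * (j + 1) = t + 1 + 2 * j by ring]
      have p3 : ∏ j ∈ Finset.range M, (‖qint q (t + 2 + (j + 1))‖ / ‖qint q (j + 1)‖) ^
          wt n ((t : ℤ) + 1 + 2 * (j + 1)) = ∏ j ∈ Finset.range M,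
          (‖qint q (t + 1 + (j + 2))‖ / ‖qint q (j + 1)‖) ^
            wt n (t + 1 + 2 * ((j + 1 : ℕ) : ℤ)) := by
        refine Finset.prod_congr rfl fun j _ => ?_
        rw [show t + 2 + (j + 1) = t + 1 + (j + 2) by ring]
        push_cast
        rfl
      rw [p1, p2, p3]
      have h0 : ‖qint q (t + 1)‖ ^ wt n (t + 1) ≠ 0 :=
        pow_ne_zero _ (norm_ne_zero_iff.2 (hK _ (by omega) (by omega)))
      simp only [Nat.cast_zero, mul_zero, add_zero] at key
      rw [div_pow]
      field_simp
      rw [show t + 2 = t + 1 + 1 from rfl]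
      linear_combination -key

end Rank

/-! ### Specialization to a root of unity -/

section Limit

open Filter Topology

/-- Up to a power of `q`, [k] is a geometric sum in q^2; this is where the order of q^2 enters. -/
theorem norm_qint {q : ℂ} (hq : q ≠ 0) (k : ℕ) :
    ‖qint q k‖ = ‖∑ i ∈ Finset.range k, (q ^ 2) ^ i‖ * ‖q‖ ^ (1 - (k : ℤ)) := by
  have : qint q k = (∑ i ∈ Finset.range k, (q ^ 2) ^ i) * q ^ (1 - (k : ℤ)) := by
    rw [qint, Finset.sum_mul, ← Finset.sum_range_reflect]
    refine Finset.sum_congr rfl fun i hi => ?_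
    rw [Finset.mem_range] at hi
    rw [← pow_mul, ← zpow_natCast, ← zpow_add₀ hq]
    congr 1
    omega
  rw [this, norm_mul, norm_zpow]

variable {q : ℂ} {ℓ : ℕ}

theorem geom_sum_eq_zero_iff_dvd {x : ℂ} (hx : orderOf x = ℓ) (hx1 : x ≠ 1) (k : ℕ) :
    ∑ i ∈ Finset.range k, x ^ i = 0 ↔ ℓ ∣ k := by
  rw [← hx, orderOf_dvd_iff_pow_eq_one, ← sub_eq_zero (a := x ^ k), ← geom_sum_mul x k]
  simp [sub_ne_zero.2 hx1]

theorem ne_zero_of_orderOf_sq (hℓ : 0 < ℓ) (hq : orderOf (q ^ 2) = ℓ) : q ≠ 0 := by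
  rintro rfl
  have := pow_orderOf_eq_one ((0 : ℂ) ^ 2)
  rw [hq, zero_pow two_ne_zero, zero_pow hℓ.ne'] at this
  exact zero_ne_one this

theorem qint_eq_zero_iff (hℓ : 0 < ℓ) (hq : orderOf (q ^ 2) = ℓ) (hq1 : q ^ 2 ≠ 1) (k : ℕ) :
    qint q k = 0 ↔ ℓ ∣ k := by
  have h0 := ne_zero_of_orderOf_sq hℓ hq
  rw [← norm_eq_zero, norm_qint h0, mul_eq_zero, norm_eq_zero, geom_sum_eq_zero_iff_dvd hq hq1]
  simp [zpow_ne_zero _ (norm_ne_zero_iff.2 h0)]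

/-- The zeros of the relevant quantum integers are roots of unity of bounded order, hence finitely
many. -/
theorem eventually_qint_ne_zero (q : ℂ) (K : ℕ) :
    ∀ᶠ x in 𝓝[≠] q, x ≠ 0 ∧ ∀ k, 1 ≤ k → k ≤ K → qint x k ≠ 0 := by
  refine nhdsNE_le_cofinite q ?_
  rw [← Filter.Eventually, Filter.eventually_cofinite]
  have hfin : ∀ k : ℕ, 1 ≤ k → {x : ℂ | x ^ (2 * k) = 1}.Finite := by
    intro k hk
    refine (Polynomial.nthRoots (2 * k) (1 : ℂ)).toFinset.finite_toSet.subset fun x hx => ?_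
    simpa [Polynomial.mem_nthRoots (show 0 < 2 * k by omega)] using hx
  refine ((Set.finite_singleton (0 : ℂ)).union
    ((Set.finite_Icc 1 K).biUnion fun k hk => hfin k hk.1)).subset fun x hx => ?_
  simp only [Set.mem_ofPred_eq, not_and_or, not_forall, not_not] at hx
  rcases hx with h | ⟨k, h1, h2, h3⟩
  · exact Or.inl h
  · by_cases h0 : x = 0
    · exact Or.inl h0
    refine Or.inr (Set.mem_biUnion (show k ∈ Set.Icc 1 K from ⟨h1, h2⟩) ?_)
    rw [← norm_eq_zero, norm_qint h0, mul_eq_zero, norm_eq_zero] at h3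
    rcases h3 with h3 | h3
    · have := geom_sum_mul (x ^ 2) k
      rw [h3, zero_mul, ← pow_mul] at this
      exact (sub_eq_zero.1 this.symm)
    · exact absurd h3 (zpow_ne_zero _ (norm_ne_zero_iff.2 h0))

/-- Separates the factor vanishing at a primitive ℓ-th root of unity from one tending to `m`. -/
theorem geom_sum_mul_eq (x : ℂ) (m ℓ : ℕ) : ∑ i ∈ Finset.range (m * ℓ), x ^ i =
    (∑ i ∈ Finset.range ℓ, x ^ i) * ∑ i ∈ Finset.range m, (x ^ ℓ) ^ i := by
  induction m with
  | zero => simp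
  | succ m ih =>
    rw [Nat.succ_mul, Finset.sum_range_add, ih, Finset.sum_range_succ (fun i => (x ^ ℓ) ^ i),
      mul_add, add_right_inj, Finset.sum_mul]
    refine Finset.sum_congr rfl fun i _ => ?_
    rw [← pow_mul, ← pow_add, mul_comm m ℓ, add_comm]

/-- If `ℓ ∣ s` then `[s + j] / [j]` has a non-zero limit at a primitive root of unity. -/
theorem exists_tendsto_ratio (hℓ : 0 < ℓ) (hq : orderOf (q ^ 2) = ℓ) (hq1 : q ^ 2 ≠ 1) {s : ℕ}
    (hs : ℓ ∣ s) {j : ℕ} (hj : 1 ≤ j) : ∃ L : ℝ, L ≠ 0 ∧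
      Tendsto (fun x : ℂ => ‖qint x (s + j)‖ / ‖qint x j‖) (𝓝[≠] q) (𝓝 L) := by
  have h0 := ne_zero_of_orderOf_sq hℓ hq
  have hcont : ∀ k : ℕ, Continuous fun x : ℂ => ‖∑ i ∈ Finset.range k, (x ^ 2) ^ i‖ := fun k => by
    fun_prop
  have hz : ∀ k : ℤ, Tendsto (fun x : ℂ => ‖x‖ ^ k) (𝓝[≠] q) (𝓝 (‖q‖ ^ k)) := fun k =>
    (continuous_norm.continuousAt.zpow₀ k (Or.inl (norm_ne_zero_iff.2 h0))).tendsto.mono_left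
      nhdsWithin_le_nhds
  have hz0 : ∀ k : ℤ, ‖q‖ ^ k ≠ 0 := fun k => zpow_ne_zero _ (norm_ne_zero_iff.2 h0)
  by_cases hdj : ℓ ∣ j
  · obtain ⟨a, rfl⟩ := hs
    obtain ⟨k, rfl⟩ := hdj
    have hk : 1 ≤ k := by
      rcases Nat.eq_zero_or_pos k with rfl | h
      · simp at hj
      · exact h
    have hqℓ : (q ^ 2) ^ ℓ = 1 := by rw [← hq]; exact pow_orderOf_eq_one _
    have hc2 : ∀ m : ℕ, Tendsto (fun x : ℂ => ‖∑ i ∈ Finset.range m, ((x ^ 2) ^ ℓ) ^ i‖) (𝓝[≠] q)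
        (𝓝 m) := by
      intro m
      have : Continuous fun x : ℂ => ‖∑ i ∈ Finset.range m, ((x ^ 2) ^ ℓ) ^ i‖ := by fun_prop
      have h2 := this.tendsto q
      simp only [hqℓ, one_pow, Finset.sum_const, Finset.card_range, nsmul_eq_mul, mul_one,
        Complex.norm_natCast] at h2
      exact h2.mono_left nhdsWithin_le_nhds
    have hk0 : (k : ℝ) ≠ 0 := by positivity
    -- Numerator and denominator both vanish at `q`; after cancelling the common factor the
    -- geometric sums tend to a + k and k.
    refine ⟨((a + k : ℕ) : ℝ) / k * ‖q‖ ^ (-((ℓ * a : ℕ) : ℤ)), ?_, ?_⟩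
    · refine mul_ne_zero (div_ne_zero ?_ hk0) (hz0 _)
      positivity
    refine (((hc2 (a + k)).div (hc2 k) hk0).mul (hz _)).congr' ?_
    filter_upwards [eventually_qint_ne_zero q ℓ] with x hx
    have hg : ‖∑ i ∈ Finset.range ℓ, (x ^ 2) ^ i‖ ≠ 0 := by
      intro h
      have := hx.2 ℓ hℓ le_rfl
      rw [← norm_ne_zero_iff, norm_qint hx.1, h, zero_mul] at this
      exact this rfl
    have hx0 : ‖x‖ ≠ 0 := norm_ne_zero_iff.2 hx.1
    rw [norm_qint hx.1, norm_qint hx.1, ← mul_add, mul_comm ℓ (a + k), mul_comm ℓ k,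
      geom_sum_mul_eq, geom_sum_mul_eq, norm_mul, norm_mul, mul_assoc, mul_assoc,
      mul_div_mul_left _ _ hg, mul_div_mul_comm, ← zpow_sub₀ hx0]
    congr 2
    push_cast
    ring
  · have hne : ∀ m : ℕ, ¬ ℓ ∣ m → ‖∑ i ∈ Finset.range m, (q ^ 2) ^ i‖ ≠ 0 := by
      intro m hm
      rw [norm_ne_zero_iff]
      exact fun h => hm ((geom_sum_eq_zero_iff_dvd hq hq1 m).1 h)
    have hsj : ¬ ℓ ∣ s + j := fun h => hdj ((Nat.dvd_add_right hs).1 h)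
    refine ⟨‖∑ i ∈ Finset.range (s + j), (q ^ 2) ^ i‖ / ‖∑ i ∈ Finset.range j, (q ^ 2) ^ i‖ *
      ‖q‖ ^ (-(s : ℤ)), ?_, ?_⟩
    · exact mul_ne_zero (div_ne_zero (hne _ hsj) (hne _ hdj)) (hz0 _)
    refine (((((hcont (s + j)).tendsto q).mono_left nhdsWithin_le_nhds).div
      (((hcont j).tendsto q).mono_left nhdsWithin_le_nhds) (hne _ hdj)).mul (hz _)).congr' ?_
    filter_upwards [eventually_qint_ne_zero q 0] with x hx
    have hx0 : ‖x‖ ≠ 0 := norm_ne_zero_iff.2 hx.1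
    rw [norm_qint hx.1, norm_qint hx.1, mul_div_mul_comm, ← zpow_sub₀ hx0]
    congr 2
    push_cast
    ring

theorem exists_fourth_root (x : ℂ) (hx : x ≠ 0) : ∃ ω : ℂ, ω ≠ 0 ∧ ω ^ 4 = -x := by
  obtain ⟨ω, h⟩ := IsAlgClosed.exists_pow_nat_eq (-x) (show 0 < 4 by norm_num)
  refine ⟨ω, ?_, h⟩
  rintro rfl
  simp at h
  exact hx h

/-- The Gram matrix as a function of the parameter. -/
noncomputable def pairingMatrix (q : ℂ) (n t : ℕ) : Matrix (Link n t) (Link n t) ℂ :=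
  Matrix.of fun c d => pairing q ((linkEquiv t n).symm c) ((linkEquiv t n).symm d)

theorem pairingMatrix_eq_gram {ω : ℂ} (hω : ω ≠ 0) (hq : ω ^ 4 = -q) (n t : ℕ) :
    pairingMatrix q n t = gram ω n t := by
  ext c d
  have h : ∀ c : Link n t, ((linkEquiv t n).symm c).1.matePerm = c.1 := fun c =>
    congrArg Subtype.val ((linkEquiv t n).apply_symm_apply c)
  rw [pairingMatrix, Matrix.of_apply, pairing_eq_dot _ _ hω hq, h, h, gram, Matrix.of_apply]

/-- The entries are 0 or powers of -(q + q⁻¹), so continuity needs no coherent choice of `ω`. -/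
theorem tendsto_det_pairingMatrix (hq : q ≠ 0) (n t : ℕ) :
    Tendsto (fun x => ‖(pairingMatrix x n t).det‖) (𝓝[≠] q) (𝓝 ‖(pairingMatrix q n t).det‖) := by
  have h : ContinuousAt (fun x => pairingMatrix x n t) q := by
    refine continuousAt_pi.2 fun c => continuousAt_pi.2 fun d => ?_
    simp only [pairingMatrix, Matrix.of_apply, pairing]
    split_ifs
    · exact ((continuousAt_id.add (continuousAt_inv₀ hq)).neg).pow _
    · exact continuousAt_const
  have h2 : ContinuousAt (fun x => (pairingMatrix x n t).det) q :=
    (Continuous.matrix_det (A := fun M : Matrix (Link n t) (Link n t) ℂ => M)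
      continuous_id).continuousAt.comp h
  exact h2.norm.tendsto.mono_left nhdsWithin_le_nhds

/-- The form is non-degenerate if `t ≡ -1` modulo `ℓ`. -/
theorem rank_gram_of_dvd {ω : ℂ} (hω : ω ≠ 0) (hωq : ω ^ 4 = -q) (hℓ : 0 < ℓ)
    (hq : orderOf (q ^ 2) = ℓ) (hq1 : q ^ 2 ≠ 1) (n t : ℕ) (ht : ℓ ∣ t + 1) :
    (gram ω n t).rank = wt n t := by
  have h0 := ne_zero_of_orderOf_sq hℓ hq
  choose L hL hL' using fun j : ℕ => exists_tendsto_ratio hℓ hq hq1 ht (Nat.succ_pos j)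
  have hlim : Tendsto (fun x : ℂ => ∏ j ∈ Finset.range n,
      (‖qint x (t + 1 + (j + 1))‖ / ‖qint x (j + 1)‖) ^ wt n ((t + 1 : ℕ) - 1 + 2 * (j + 1)))
      (𝓝[≠] q) (𝓝 (∏ j ∈ Finset.range n, L j ^ wt n ((t + 1 : ℕ) - 1 + 2 * (j + 1)))) :=
    tendsto_finsetProd _ fun j _ => (hL' j).pow _
  -- Near `q` the determinant formula holds, so continuity identifies the determinant at `q`, in
  -- absolute value, with the product of the non-zero limits.
  have heq := tendsto_nhds_unique (tendsto_det_pairingMatrix h0 n t) (hlim.congr' (by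
    filter_upwards [eventually_qint_ne_zero q (t + 1 + n + n)] with x hx
    obtain ⟨ω', h1, h2⟩ := exists_fourth_root x hx.1
    have key := norm_det_gram h1 h2 n _ hx.2 n (t + 1) le_rfl le_rfl
    have e : ((t + 1 : ℕ) : ℤ) - 1 = t := by push_cast; ring
    have e' : ∀ y : ℤ, y = t → ‖(gram ω' n y).det‖ = ‖(gram ω' n t).det‖ := by
      rintro _ rfl
      rfl
    rw [← key, e' _ e, pairingMatrix_eq_gram h1 h2]))
  have hdet : (gram ω n t).det ≠ 0 := by
    rw [← pairingMatrix_eq_gram hω hωq, ← norm_ne_zero_iff, heq]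
    exact Finset.prod_ne_zero_iff.2 fun j _ => pow_ne_zero _ (hL j)
  exact Matrix.rank_of_det_ne_zero hdet

end Limit
-- Dimensions as cardinality and rank
section Dimension

theorem w_eq_wt (t n : ℕ) : w t n = wt n t := by
  classical
  have : Fintype (MonicDiagram t n) := Fintype.ofFinite _
  rw [w, Module.finrank_finsupp_self, wt]
  exact Fintype.card_congr (linkEquiv t n)

/-- W/Rad is isomorphic to the range of the form viewed as a map to the dual, and in coordinates
that map is the transposed Gram matrix. -/
theorem l_eq_rank (q : ℂ) (t n : ℕ) : l q t n = (pairingMatrix q n t).rank := by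
  classical
  have : Fintype (MonicDiagram t n) := Fintype.ofFinite _
  let A : Matrix (MonicDiagram t n) (MonicDiagram t n) ℂ := Matrix.of (pairing q)
  have hA : pairingMatrix q n t = A.submatrix (linkEquiv t n).symm (linkEquiv t n).symm := rfl
  rw [hA, Matrix.rank_submatrix, ← Matrix.rank_transpose, Matrix.rank]
  have h1 : l q t n = Module.finrank ℂ (LinearMap.range (form q t n)) :=
    (form q t n).quotKerEquivRange.finrank_eq
  let e := Finsupp.linearEquivFunOnFinite ℂ ℂ (MonicDiagram t n)
  let f : (CellModule t n →ₗ[ℂ] ℂ) ≃ₗ[ℂ] (MonicDiagram t n → ℂ) :=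
    (Finsupp.llift ℂ ℂ ℂ (MonicDiagram t n)).symm
  have h : A.transpose.mulVecLin = f.toLinearMap ∘ₗ form q t n ∘ₗ e.symm.toLinearMap := by
    refine LinearMap.ext fun v => ?_
    funext D
    obtain ⟨v, rfl⟩ := e.surjective v
    simp only [LinearMap.comp_apply, LinearEquiv.coe_coe, LinearEquiv.symm_apply_apply, form, f,
      Finsupp.llift_symm_apply, Finsupp.linearCombination_apply,
      Matrix.mulVecLin_apply, Matrix.mulVec, dotProduct, Matrix.transpose_apply]
    rw [Finsupp.sum_fintype _ _ (by simp), LinearMap.sum_apply]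
    refine Finset.sum_congr rfl fun D' _ => ?_
    simp [A, e, mul_comm]
  rw [h1, h, LinearMap.range_comp, LinearEquiv.finrank_map_eq,
    LinearMap.range_comp_of_range_eq_top _ (LinearEquiv.range _)]

end Dimension

/-! ### Solving the rank recursion -/

section Recursion

/-- The sum of the numbers of monic diagrams along the progression `m + 2iℓ`, `i < N`. -/
noncomputable def wtSum (N ℓ n : ℕ) (m : ℤ) : ℤ :=
  ∑ i ∈ Finset.range N, (wt n (m + 2 * i * ℓ) : ℤ)

variable {N ℓ : ℕ}

theorem wtSum_succ (n : ℕ) {m : ℤ} (hm : 0 ≤ m) :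
    wtSum N ℓ (n + 1) m = wtSum N ℓ n (m - 1) + wtSum N ℓ n (m + 1) := by
  rw [wtSum, wtSum, wtSum, ← Finset.sum_add_distrib]
  refine Finset.sum_congr rfl fun i _ => ?_
  rw [wt_succ n (by positivity), Nat.cast_add]
  rw [show m + 2 * i * ℓ - 1 = m - 1 + 2 * i * ℓ by ring,
    show m + 2 * i * ℓ + 1 = m + 1 + 2 * i * ℓ by ring]

/-- Telescoping; the last term vanishes since m + 2Nℓ > n. The value m = -1 is admitted for use at t
- 1. -/
theorem wtSum_sub_wtSum {n : ℕ} (hn : n < N) (hℓ : 0 < ℓ) {m : ℤ} (hm : -1 ≤ m) :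
    wtSum N ℓ n m - wtSum N ℓ n (m + 2 * ℓ) = wt n m := by
  have h1 : wtSum N ℓ n (m + 2 * ℓ) =
      ∑ i ∈ Finset.range N, (wt n (m + 2 * ((i + 1 : ℕ) : ℤ) * ℓ) : ℤ) := by
    refine Finset.sum_congr rfl fun i _ => ?_
    congr 2
    push_cast
    ring
  rw [h1, wtSum, ← Finset.sum_sub_distrib,
    Finset.sum_range_sub' (fun i : ℕ => (wt n (m + 2 * (i : ℤ) * ℓ) : ℤ))]
  have h2 : wt n (m + 2 * (N : ℤ) * ℓ) = 0 := by
    refine wt_eq_zero (Or.inr ?_)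
    have : (N : ℤ) * 1 ≤ N * ℓ := by gcongr; exact_mod_cast hℓ
    have h3 : (n : ℤ) < N := by exact_mod_cast hn
    nlinarith
  rw [h2]
  simp

/-- The condition on `t` makes s = ℓ - 2 - r non-negative, and s + 1 is then `bBar ℓ t`. -/
theorem exists_eq_mul_add {t : ℕ} (hℓ : 0 < ℓ) (ht : ¬ ℓ ∣ t + 1) :
    ∃ a r s, ℓ = r + s + 2 ∧ t = a * ℓ + r := by
  have hlt := Nat.mod_lt t hℓ
  have h := Nat.div_add_mod' t ℓ
  refine ⟨t / ℓ, t % ℓ, ℓ - 2 - t % ℓ, ?_, h.symm⟩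
  have hne : t % ℓ ≠ ℓ - 1 := by
    intro h'
    refine ht ⟨t / ℓ + 1, ?_⟩
    rw [h'] at h
    rw [mul_add, mul_comm ℓ]
    omega
  omega

theorem bBar_eq {a r : ℕ} (hr : r < ℓ) : bBar ℓ (a * ℓ + r) = ℓ - 1 - r := by
  rw [bBar, b, Nat.mul_add_mod_self_right, Nat.mod_eq_of_lt hr]

/-- Passing from `t` to t ∓ 1 within a residue block changes `bBar` by ±1, so t + 2 `bBar` moves in
the opposite direction to `t` and the right side obeys the branching rule. The two ends of the block
agree with the exceptional behaviour of the rank. -/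
theorem rank_gram_eq {q ω : ℂ} (hω : ω ≠ 0) (hωq : ω ^ 4 = -q) (hℓ : 0 < ℓ)
    (hq : orderOf (q ^ 2) = ℓ) (hq1 : q ^ 2 ≠ 1) (n : ℕ) : n < N → ∀ t : ℕ, ¬ ℓ ∣ t + 1 →
    ((gram ω n t).rank : ℤ) = wtSum N ℓ n t - wtSum N ℓ n (t + 2 * bBar ℓ t) := by
  have hℓ1 : ℓ ≠ 1 := by
    rintro rfl
    exact hq1 (orderOf_eq_one_iff.1 hq)
  induction n with
  | zero =>
    intro hN t ht
    have hpos : 1 ≤ bBar ℓ t := by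
      obtain ⟨a, r, s, hs, rfl⟩ := exists_eq_mul_add hℓ ht
      rw [bBar_eq (by omega)]
      omega
    have h2 : wtSum N ℓ 0 (t + 2 * bBar ℓ t) = 0 := by
      refine Finset.sum_eq_zero fun i _ => ?_
      have : (0 : ℤ) ≤ 2 * i * ℓ := by positivity
      rw [wt_zero (by omega), Nat.cast_zero]
    have h1 : wtSum N ℓ 0 t = wt 0 t := by
      have h3 := wtSum_sub_wtSum (n := 0) hN hℓ (m := t) (by omega)
      have h4 : wtSum N ℓ 0 (t + 2 * ℓ) = 0 := by
        refine Finset.sum_eq_zero fun i _ => ?_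
        have : (0 : ℤ) ≤ 2 * i * ℓ := by positivity
        rw [wt_zero (by omega), Nat.cast_zero]
      rw [← h3, h4, sub_zero]
    rw [h1, h2, sub_zero, Nat.cast_inj]
    have key : ∀ x : ℤ, (gram ω 0 x).rank = wt 0 x := by
      intro x
      by_cases hx : x = 0
      · subst hx
        refine Matrix.rank_of_det_ne_zero ?_
        rw [Matrix.det_unique]
        simp [gram, dot, vec]
      · have := Matrix.rank_le_card_width (gram ω 0 x)
        have h5 : Fintype.card (Link 0 x) = 0 := wt_zero hx
        rw [wt, h5]
        omega
    exact key t
  | succ n ih =>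
    intro hN t ht
    obtain ⟨a, r, s, hℓdef, htdef⟩ := exists_eq_mul_add hℓ ht
    have hb : bBar ℓ t = s + 1 := by rw [htdef, bBar_eq (by omega)]; omega
    have hq0 : qint q (t + 1) ≠ 0 := fun h => ht ((qint_eq_zero_iff hℓ hq hq1 _).1 h)
    rw [rank_gram_succ n t hω hωq hq0, wtSum_succ n (by positivity), wtSum_succ n (by positivity),
      hb]
    have hleft : ((gram ω n (t - 1 : ℤ)).rank : ℤ) =
        wtSum N ℓ n (t - 1) - wtSum N ℓ n (t + 2 * (s + 1 : ℕ) + 1) := by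
      -- Here t - 1 ≡ -1: the sums are offset by 2ℓ and telescope to the full dimension, matching
      -- non-degeneracy. For t = 0 both sides vanish.
      by_cases hr0 : r = 0
      · have e : (t + 2 * (s + 1 : ℕ) + 1 : ℤ) = (t - 1 : ℤ) + 2 * ℓ := by
          rw [hℓdef, hr0]; push_cast; ring
        rw [e, wtSum_sub_wtSum (by omega) hℓ (by omega), Nat.cast_inj]
        rcases Nat.eq_zero_or_pos t with h0 | hpos
        · have h5 : wt n (t - 1 : ℤ) = 0 := wt_eq_zero (Or.inl (by omega))
          have := Matrix.rank_le_card_width (gram ω n (t - 1 : ℤ))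
          rw [wt] at h5 ⊢
          omega
        · obtain ⟨u, hu⟩ : ∃ u, t = u + 1 := ⟨t - 1, by omega⟩
          have h5 := rank_gram_of_dvd hω hωq hℓ hq hq1 n u ⟨a, by rw [← hu, htdef, hr0]; ring⟩
          have h6 : (t - 1 : ℤ) = u := by rw [hu]; push_cast; ring
          rw [h6, h5]
      · obtain ⟨r', rfl⟩ : ∃ r', r = r' + 1 := ⟨r - 1, by omega⟩
        have h6 : (t - 1 : ℤ) = (a * ℓ + r' : ℕ) := by rw [htdef]; push_cast; ring
        have h7 := ih (by omega) (a * ℓ + r') (by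
          rw [add_assoc, Nat.dvd_add_right (Dvd.intro_left a rfl)]
          exact fun h => absurd (Nat.le_of_dvd (by omega) h) (by omega))
        rw [bBar_eq (by omega), ← h6] at h7
        rw [h7]
        congr 2
        omega
    have hright : ((if qint q (t + 2) = 0 then 0 else (gram ω n (t + 1 : ℤ)).rank : ℕ) : ℤ) =
        wtSum N ℓ n (t + 1) - wtSum N ℓ n (t + 2 * (s + 1 : ℕ) - 1) := by
      -- Here [t+2] = 0 and `bBar` is 1, so the two sums coincide and cancel.
      by_cases hs : s = 0
      · rw [if_pos ((qint_eq_zero_iff hℓ hq hq1 _).2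
          ⟨a + 1, by rw [htdef, hℓdef, hs]; ring⟩), hs]
        simp only [zero_add, Nat.cast_zero, Nat.cast_one, mul_one]
        rw [show (t : ℤ) + 2 - 1 = t + 1 by ring, sub_self]
      · have hnd : ¬ ℓ ∣ a * ℓ + (r + 1) + 1 := by
          rw [add_assoc, Nat.dvd_add_right (Dvd.intro_left a rfl)]
          exact fun h => absurd (Nat.le_of_dvd (by omega) h) (by omega)
        rw [if_neg (fun h => hnd (by
          have := (qint_eq_zero_iff hℓ hq hq1 _).1 h
          rwa [htdef] at this))]
        have h6 : (t + 1 : ℤ) = (a * ℓ + (r + 1) : ℕ) := by rw [htdef]; push_cast; ring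
        have h7 := ih (by omega) (a * ℓ + (r + 1)) hnd
        rw [bBar_eq (by omega), ← h6] at h7
        rw [h7]
        congr 2
        omega
    rw [Nat.cast_add, hleft, hright]
    ring

end Recursion

/-! ### Iterates of the linkage map -/

section Linkage

variable {ℓ : ℕ}

/-- `g` reflects `t` in the next integer congruent to -1 modulo ℓ, which lies at distance `bBar ℓ
t`. -/
theorem g_eq {t : ℕ} (hℓ : 0 < ℓ) (ht : ¬ ℓ ∣ t + 1) : g ℓ t = t + 2 * bBar ℓ t := by
  obtain ⟨a, r, s, hs, rfl⟩ := exists_eq_mul_add hℓ ht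
  rw [bBar_eq (by omega), g, b, Nat.mul_add_mod_self_right, Nat.mod_eq_of_lt (by omega),
    mul_comm a, Nat.mul_add_div hℓ, Nat.div_eq_of_lt (by omega), add_zero, add_mul, mul_comm a]
  omega

/-- Two reflections in successive walls at distance ℓ compose to a translation by 2ℓ. -/
theorem g_g {t : ℕ} (hℓ : 0 < ℓ) (ht : ¬ ℓ ∣ t + 1) : g ℓ (g ℓ t) = t + 2 * ℓ := by
  obtain ⟨a, r, s, hs, rfl⟩ := exists_eq_mul_add hℓ ht
  have h1 : g ℓ (a * ℓ + r) = (a + 1) * ℓ + s := by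
    rw [g_eq hℓ ht, bBar_eq (by omega), add_mul]
    omega
  have h2 : ¬ ℓ ∣ (a + 1) * ℓ + s + 1 := by
    rw [add_assoc, Nat.dvd_add_right (Dvd.intro_left _ rfl)]
    exact fun h => absurd (Nat.le_of_dvd (by omega) h) (by omega)
  rw [h1, g_eq hℓ h2, bBar_eq (by omega), add_mul]
  omega

theorem g_iterate {t : ℕ} (hℓ : 0 < ℓ) (ht : ¬ ℓ ∣ t + 1) (i : ℕ) :
    (g ℓ)^[2 * i] t = t + 2 * i * ℓ ∧ (g ℓ)^[2 * i + 1] t = t + 2 * bBar ℓ t + 2 * i * ℓ := by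
  have key : ∀ i, (g ℓ)^[2 * i] t = t + 2 * i * ℓ := by
    intro i
    induction i with
    | zero => simp
    | succ i ih =>
      have hnd : ¬ ℓ ∣ t + 2 * i * ℓ + 1 := by
        rw [add_right_comm, Nat.dvd_add_left (Dvd.intro_left _ rfl)]
        exact ht
      rw [mul_add, mul_one, Function.iterate_succ_apply', Function.iterate_succ_apply', ih,
        g_g hℓ hnd]
      ring
  refine ⟨key i, ?_⟩
  have hnd : ¬ ℓ ∣ t + 2 * i * ℓ + 1 := by
    rw [add_right_comm, Nat.dvd_add_left (Dvd.intro_left _ rfl)]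
    exact ht
  rw [Function.iterate_succ_apply', key, g_eq hℓ hnd]
  rw [bBar, b, Nat.add_mul_mod_self_right, bBar, b]
  ring

theorem sum_range_two_mul (f : ℕ → ℤ) (N : ℕ) : ∑ i ∈ Finset.range (2 * N), f i =
    ∑ i ∈ Finset.range N, (f (2 * i) + f (2 * i + 1)) := by
  induction N with
  | zero => rfl
  | succ N ih =>
    rw [mul_add, mul_one, Finset.sum_range_succ, Finset.sum_range_succ, ih,
      Finset.sum_range_succ _ N, add_assoc]

theorem w_eq_zero {t n : ℕ} (h : n < t) : w t n = 0 := by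
  rw [w_eq_wt, wt_eq_zero (Or.inr (by exact_mod_cast h))]

end Linkage

end TemperleyLieb

/-! ### The theorem -/

theorem mainTheorem11 (q : ℂ) (ℓ : ℕ) (hℓ : 0 < ℓ) (hq : orderOf (q ^ 2) = ℓ)
    (t : ℕ) (ht : ¬ (t : ℤ) ≡ -1 [ZMOD (ℓ : ℤ)]) (n : ℕ) :
    (Function.support fun i : ℕ =>
      (TemperleyLieb.w (t + 2 * i * ℓ) n : ℤ)).Finite ∧
    (Function.support fun i : ℕ =>
      (TemperleyLieb.w (t + 2 * TemperleyLieb.bBar ℓ t + 2 * i * ℓ) n : ℤ)).Finite ∧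
    (TemperleyLieb.l q t n : ℤ) =
      (∑ᶠ i : ℕ, (TemperleyLieb.w (t + 2 * i * ℓ) n : ℤ)) -
        ∑ᶠ i : ℕ, (TemperleyLieb.w (t + 2 * TemperleyLieb.bBar ℓ t + 2 * i * ℓ) n : ℤ) ∧
    (TemperleyLieb.l q t n : ℤ) =
      ∑ᶠ i : ℕ, ((TemperleyLieb.w (t + 2 * i * ℓ) n : ℤ) -
        (TemperleyLieb.w (t + 2 * TemperleyLieb.bBar ℓ t + 2 * i * ℓ) n : ℤ)) ∧
    (Function.support fun i : ℕ =>
      (-1 : ℤ) ^ i * (TemperleyLieb.w ((TemperleyLieb.g ℓ)^[i] t) n : ℤ)).Finite ∧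
    (TemperleyLieb.l q t n : ℤ) =
      ∑ᶠ i : ℕ, (-1 : ℤ) ^ i * (TemperleyLieb.w ((TemperleyLieb.g ℓ)^[i] t) n : ℤ) := by
  have hnd : ¬ ℓ ∣ t + 1 := by
    intro h
    refine ht (Int.ModEq.symm ((Int.modEq_iff_dvd).2 ?_))
    rw [sub_neg_eq_add]
    exact_mod_cast h
  -- For ℓ = 1 every `t` is congruent to -1, so this case is excluded by the hypothesis on `t`.
  have hq1 : q ^ 2 ≠ 1 := by
    intro h
    rw [h, orderOf_one] at hq
    exact hnd (hq ▸ one_dvd _)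
  have hle : ∀ i : ℕ, i ≤ i * ℓ := fun i => Nat.le_mul_of_pos_right i hℓ
  have hA : (Function.support fun i : ℕ => (TemperleyLieb.w (t + 2 * i * ℓ) n : ℤ)) ⊆
      Finset.range (n + 1) := by
    intro i hi
    by_contra h
    rw [Finset.coe_range, Set.mem_Iio, not_lt] at h
    refine hi ?_
    have := hle i
    have h2 : 2 * i * ℓ = 2 * (i * ℓ) := mul_assoc _ _ _
    simp only [TemperleyLieb.w_eq_zero (show n < t + 2 * i * ℓ by omega), Nat.cast_zero]
  have hB : (Function.support fun i : ℕ =>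
      (TemperleyLieb.w (t + 2 * TemperleyLieb.bBar ℓ t + 2 * i * ℓ) n : ℤ)) ⊆
      Finset.range (n + 1) := by
    intro i hi
    by_contra h
    rw [Finset.coe_range, Set.mem_Iio, not_lt] at h
    refine hi ?_
    have := hle i
    have h2 : 2 * i * ℓ = 2 * (i * ℓ) := mul_assoc _ _ _
    simp only [TemperleyLieb.w_eq_zero
      (show n < t + 2 * TemperleyLieb.bBar ℓ t + 2 * i * ℓ by omega), Nat.cast_zero]
  have hC : (Function.support fun i : ℕ =>
      (-1 : ℤ) ^ i * (TemperleyLieb.w ((TemperleyLieb.g ℓ)^[i] t) n : ℤ)) ⊆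
      Finset.range (2 * (n + 1)) := by
    intro i hi
    by_contra h
    rw [Finset.coe_range, Set.mem_Iio, not_lt] at h
    refine hi ?_
    have hlt : n < (TemperleyLieb.g ℓ)^[i] t := by
      obtain ⟨j, rfl | rfl⟩ := Nat.even_or_odd' i
      · have := hle j
        rw [(TemperleyLieb.g_iterate hℓ hnd j).1, mul_assoc]
        omega
      · have := hle j
        rw [(TemperleyLieb.g_iterate hℓ hnd j).2, mul_assoc]
        omega
    simp only [TemperleyLieb.w_eq_zero hlt, Nat.cast_zero, mul_zero]
  have hrank : (TemperleyLieb.l q t n : ℤ) =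
      ∑ i ∈ Finset.range (n + 1), (TemperleyLieb.w (t + 2 * i * ℓ) n : ℤ) -
        ∑ i ∈ Finset.range (n + 1),
          (TemperleyLieb.w (t + 2 * TemperleyLieb.bBar ℓ t + 2 * i * ℓ) n : ℤ) := by
    obtain ⟨ω, hω, hωq⟩ :=
      TemperleyLieb.exists_fourth_root q (TemperleyLieb.ne_zero_of_orderOf_sq hℓ hq)
    rw [TemperleyLieb.l_eq_rank, TemperleyLieb.pairingMatrix_eq_gram hω hωq,
      TemperleyLieb.rank_gram_eq hω hωq hℓ hq hq1 n (Nat.lt_succ_self n) t hnd]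
    simp only [TemperleyLieb.wtSum, TemperleyLieb.w_eq_wt]
    push_cast
    rfl
  have hsA := finsum_eq_sum_of_support_subset _ hA
  have hsB := finsum_eq_sum_of_support_subset _ hB
  have hfA := (Finset.finite_toSet _).subset hA
  have hfB := (Finset.finite_toSet _).subset hB
  refine ⟨hfA, hfB, ?_, ?_, (Finset.finite_toSet _).subset hC, ?_⟩
  · rw [hsA, hsB, hrank]
  · rw [finsum_sub_distrib hfA hfB, hsA, hsB, hrank]
  -- Even iterates of `g` give the terms of the first sum, odd iterates those of the second; hence
  -- the cut-off at 2(n+1).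
  · rw [finsum_eq_sum_of_support_subset _ hC, TemperleyLieb.sum_range_two_mul, hrank,
      ← Finset.sum_sub_distrib]
    refine Finset.sum_congr rfl fun i _ => ?_
    rw [(TemperleyLieb.g_iterate hℓ hnd i).1, (TemperleyLieb.g_iterate hℓ hnd i).2, pow_succ,
      pow_mul]
    simp [sub_eq_add_neg]
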